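/- Let $d\ge 2$, $\Omega=(-1,1)^d$ and $3\Omega=(-3,3)^d$. For $p,q\in(1,\infty)$ and a weight $a\ge 0$ consider the energies (IV) for $s,t\in(0,1)$: $$\mathcal J(v)=\int_{\mathbb R^d}\!\int_{\mathbb R^d}\frac1p\frac{|v(x)-v(y)|^p}{|x-y|^{d+sp}}\,dx\,dy+\int_{\mathbb R^d}\!\int_{\mathbb R^d}\frac1q\,a(x,y)\frac{|v(x)-v(y)|^q}{|x-y|^{d+tq}}\,dx\,dy;$$ (II) for $s\in(0,1)$, $t=1$: $$\mathcal J(v)=\int_{\mathbb R^d}\!\int_{\mathbb R^d}\frac1p\frac{|v(x)-v(y)|^p}{|x-y|^{d+sp}}\,dx\,dy+\int_{\Omega}\frac1q\,a(x)|\nabla v|^q\,dx;$$ (III) for $s=1$, $t\in(0,1)$: $$\mathcal J(v)=\int_{\Omega}\frac1p|\nabla v|^p\,dx+\int_{\mathbb R^d}\!\int_{\mathbb R^d}\frac1q\,a(x,y)\frac{|v(x)-v(y)|^q}{|x-y|^{d+tq}}\,dx\,dy;$$ in (II) and (III) $\nabla v\in L^1_{\mathrm{loc}}(\mathbb R^d)$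 is the weak gradient of $v$ on $\mathbb R^d$, and $\mathcal J(v)=\infty$ if there is none. Let $W_0(\Omega)$ be the space of all $v\in L^1_{\mathrm{loc}}(\mathbb R^d)$ with $\mathcal J(v)<\infty$ and $v=0$ a.e. outside $\Omega$, with the norm $\|v\|_{\mathcal J}=\inf\{\lambda>0:\mathcal J(v/\lambda)\le 1\}$, and let $H_0(\Omega)$ be the closure of $C_0^\infty(\Omega)$ in $W_0(\Omega)$. Say that the Lavrentiev gap occurs for $\mathcal J$ if there is $u_D\in C^\infty(\mathbb R^d)$ vanishing outside $3\Omega$ such that $$\inf\{\mathcal J(v): v\in u_D+W_0(\Omega)\}<\inf\{\mathcal J(v): v\in u_D+H_0(\Omega)\}.$$ **Theorem.** Let $p,q>1$, $\alpha\in[0,1]$, $s-\frac dp>0$ and $$\frac{p}{p-1}\Big(s-\frac dp\Big)<\frac{q}{q-1}\Big(t-\frac{d+\alpha}{q}\Big).$$ If $s,t\in(0,1)$, then there is a measurable, symmetric, nonnegative, bounded weight $a:\mathbb R^d\times\mathbb R^d\to[0,\infty)$, vanishing outside $3\Omega\times3\Omega$ and with $a\in C^{\alpha}(\overline\Omega\times\overline\Omega)$,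 for which the Lavrentiev gap occurs for the energy (IV). The choices $t=1$ and $s=1$ give the mixed models: if $s\in(0,1)$ and $t=1$, there is a measurable, nonnegative, bounded weight $a:\mathbb R^d\to[0,\infty)$, vanishing outside $3\Omega$ and with $a\in C^\alpha(\overline\Omega)$, for which the gap occurs for the energy (II); if $s=1$ and $t\in(0,1)$, there is a weight $a(x,y)$ as in the first case for which the gap occurs for the energy (III). Here $C^\alpha$ means continuous and Hölder continuous with exponent $\alpha$ (Lipschitz if $\alpha=1$, just continuous and bounded if $\alpha=0$). -/

import Mathlib

open MeasureTheory Set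
open scoped ENNReal NNReal ContDiff

noncomputable section

namespace NonlocalGap

/-- The open cube `(-r, r)^d` in Euclidean space; `Ω` is `cube d 1` and `3Ω` is `cube d 3`. -/
def cube (d : ℕ) (r : ℝ) : Set (EuclideanSpace ℝ (Fin d)) :=
  {x | ∀ i, |x i| < r}

/-- The weighted nonlocal phase
`∫∫ (1/p) k(x,y) |v(x) - v(y)|^p / |x - y|^(d + s p) dx dy` over the whole space,
as an extended nonnegative number. -/
def nonlocalPhase {d : ℕ} (s p : ℝ)
    (k : EuclideanSpace ℝ (Fin d) → EuclideanSpace ℝ (Fin d) → ℝ)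
    (v : EuclideanSpace ℝ (Fin d) → ℝ) : ℝ≥0∞ :=
  ∫⁻ x, ∫⁻ y, ENNReal.ofReal
    (1 / p * k x y * (|v x - v y| ^ p / ‖x - y‖ ^ ((d : ℝ) + s * p)))

/-- `G` is the weak gradient of `v` on the whole space, both being locally integrable. -/
def HasWeakGradient {d : ℕ} (v : EuclideanSpace ℝ (Fin d) → ℝ)
    (G : EuclideanSpace ℝ (Fin d) → EuclideanSpace ℝ (Fin d)) : Prop :=
  LocallyIntegrable v ∧ LocallyIntegrable G ∧
    ∀ φ : EuclideanSpace ℝ (Fin d) → ℝ, ContDiff ℝ ∞ φ → HasCompactSupport φ →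
      ∫ x, v x • gradient φ x = -∫ x, φ x • G x

/-- The weighted local phase `∫_Ω (1/p) w(x) |∇v(x)|^p dx`. The weak gradient is unique almost
everywhere, so the infimum is the value at that gradient, and it is `∞` if `v` has none. -/
def localPhase {d : ℕ} (p : ℝ) (w : EuclideanSpace ℝ (Fin d) → ℝ)
    (v : EuclideanSpace ℝ (Fin d) → ℝ) : ℝ≥0∞ :=
  ⨅ (G : EuclideanSpace ℝ (Fin d) → EuclideanSpace ℝ (Fin d)) (_ : HasWeakGradient v G),
    ∫⁻ x in cube d 1, ENNReal.ofReal (1 / p * w x * ‖G x‖ ^ p)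

/-- Nonlocal double phase energy (both phases nonlocal). -/
def energyNonlocal {d : ℕ} (s p t q : ℝ)
    (a : EuclideanSpace ℝ (Fin d) → EuclideanSpace ℝ (Fin d) → ℝ)
    (v : EuclideanSpace ℝ (Fin d) → ℝ) : ℝ≥0∞ :=
  nonlocalPhase s p (fun _ _ => 1) v + nonlocalPhase t q a v

/-- Mixed energy: nonlocal first phase, weighted local second phase. -/
def energyNonlocalLocal {d : ℕ} (s p q : ℝ) (a : EuclideanSpace ℝ (Fin d) → ℝ)
    (v : EuclideanSpace ℝ (Fin d) → ℝ) : ℝ≥0∞ :=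
  nonlocalPhase s p (fun _ _ => 1) v + localPhase q a v

/-- Mixed energy: local first phase, weighted nonlocal second phase. -/
def energyLocalNonlocal {d : ℕ} (p t q : ℝ)
    (a : EuclideanSpace ℝ (Fin d) → EuclideanSpace ℝ (Fin d) → ℝ)
    (v : EuclideanSpace ℝ (Fin d) → ℝ) : ℝ≥0∞ :=
  localPhase p (fun _ => 1) v + nonlocalPhase t q a v

/-- The Luxemburg functional `inf {l > 0 : J (v / l) ≤ 1}` (`∞` if there is no such `l`). -/
def luxNorm {d : ℕ} (J : (EuclideanSpace ℝ (Fin d) → ℝ) → ℝ≥0∞)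
    (v : EuclideanSpace ℝ (Fin d) → ℝ) : ℝ≥0∞ :=
  ⨅ (l : ℝ) (_ : 0 < l) (_ : J (fun x => v x / l) ≤ 1), ENNReal.ofReal l

/-- `W_0(Ω)`: locally integrable functions of finite energy vanishing a.e. outside `Ω`. -/
def W₀ {d : ℕ} (J : (EuclideanSpace ℝ (Fin d) → ℝ) → ℝ≥0∞) :
    Set (EuclideanSpace ℝ (Fin d) → ℝ) :=
  {v | LocallyIntegrable v ∧ J v < ⊤ ∧ ∀ᵐ x, x ∉ cube d 1 → v x = 0}

/-- `H_0(Ω)`: the closure of `C_0^∞(Ω)` in `W_0(Ω)` with respect to the Luxemburg norm. -/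
def H₀ {d : ℕ} (J : (EuclideanSpace ℝ (Fin d) → ℝ) → ℝ≥0∞) :
    Set (EuclideanSpace ℝ (Fin d) → ℝ) :=
  {v | v ∈ W₀ J ∧ ∀ ε : ℝ≥0∞, 0 < ε → ∃ φ : EuclideanSpace ℝ (Fin d) → ℝ,
    ContDiff ℝ ∞ φ ∧ HasCompactSupport φ ∧ tsupport φ ⊆ cube d 1 ∧ luxNorm J (v - φ) < ε}

/-- The affine space `u_D + W_0(Ω)`. -/
def W {d : ℕ} (J : (EuclideanSpace ℝ (Fin d) → ℝ) → ℝ≥0∞)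
    (uD : EuclideanSpace ℝ (Fin d) → ℝ) : Set (EuclideanSpace ℝ (Fin d) → ℝ) :=
  {v | v - uD ∈ W₀ J}

/-- The affine space `u_D + H_0(Ω)`. -/
def H {d : ℕ} (J : (EuclideanSpace ℝ (Fin d) → ℝ) → ℝ≥0∞)
    (uD : EuclideanSpace ℝ (Fin d) → ℝ) : Set (EuclideanSpace ℝ (Fin d) → ℝ) :=
  {v | v - uD ∈ H₀ J}

/-- Boundary data: smooth functions vanishing outside `3Ω`. -/
def IsBoundaryDatum {d : ℕ} (uD : EuclideanSpace ℝ (Fin d) → ℝ) : Prop :=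
  ContDiff ℝ ∞ uD ∧ ∀ x, x ∉ cube d 3 → uD x = 0

/-- The Lavrentiev gap for the energy `J`: for some boundary datum `u_D`, the infimum of `J` over
`u_D + W_0(Ω)` is strictly below its infimum over `u_D + H_0(Ω)`. -/
def LavrentievGap {d : ℕ} (J : (EuclideanSpace ℝ (Fin d) → ℝ) → ℝ≥0∞) : Prop :=
  ∃ uD : EuclideanSpace ℝ (Fin d) → ℝ, IsBoundaryDatum uD ∧
    (⨅ v ∈ W J uD, J v) < ⨅ v ∈ H J uD, J v

/-- The class `C^α(S)`, `α ∈ [0, 1]`: continuous functions on `S` that are `α`-Hölder there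
(Lipschitz if `α = 1`). -/
def IsHolderClass {X : Type*} [PseudoEMetricSpace X] (α : ℝ) (S : Set X) (f : X → ℝ) : Prop :=
  ContinuousOn f S ∧ ∃ C : ℝ≥0, HolderOnWith C α.toNNReal f S

/-- Nonnegative bounded measurable weights `a(x, y)`, symmetric, vanishing outside `3Ω × 3Ω`
and of class `C^α` on `closure Ω × closure Ω`. -/
structure IsPairWeight {d : ℕ} (α : ℝ)
    (a : EuclideanSpace ℝ (Fin d) → EuclideanSpace ℝ (Fin d) → ℝ) : Prop where
  nonneg : ∀ x y, 0 ≤ a x y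
  bounded : ∃ M : ℝ, ∀ x y, a x y ≤ M
  measurable : Measurable (Function.uncurry a)
  symmetric : ∀ x y, a x y = a y x
  vanishes : ∀ x y, x ∉ cube d 3 ∨ y ∉ cube d 3 → a x y = 0
  holder : IsHolderClass α (closure (cube d 1) ×ˢ closure (cube d 1)) (Function.uncurry a)

/-- Nonnegative bounded measurable weights `a(x)`, vanishing outside `3Ω` and of class `C^α` on
`closure Ω`. -/
structure IsPointWeight {d : ℕ} (α : ℝ) (a : EuclideanSpace ℝ (Fin d) → ℝ) : Prop where
  nonneg : ∀ x, 0 ≤ a x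
  bounded : ∃ M : ℝ, ∀ x, a x ≤ M
  measurable : Measurable a
  vanishes : ∀ x, x ∉ cube d 3 → a x = 0
  holder : IsHolderClass α (closure (cube d 1)) a

end NonlocalGap

end

/-!
The gap is produced by a Cantor set on a coordinate axis of the cube. Fix a contraction ratio
`l = 2 ^ (-1/D) < 1/2`, so that the Cantor set has dimension `D < 1`. Over each gap of its
construction put the ball having the gap as a diameter (`gapBall`). The weight is a multiple `M` of
`dist(·, Kᶜ)^β`, where `K` is the union of the gap balls (`gapSet`) in the local case and the union
of the products `Q ×ˢ Q` of gap balls `Q` (`gapPairSet`) in the nonlocal case.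

*The competitor.* A datum rising from `0` to `1` along the axis is corrected by a series whose sum
turns it, on the axis, into the Cantor function (`competitor`). The result is constant on every gap
ball (`exists_competitor_eq`), so that its weighted phase vanishes. The `k`-th correction has height
`2 ^ (-k)`, varies at scale `l ^ k` and is supported in `2 ^ k` pieces of volume of order
`l ^ (d k)`; its unweighted energy is thus at most of order `(2 ^ (1 - p) l ^ (d - s p)) ^ k`. These
energies are summable when `D` exceeds `(s p - d) / (p - 1)`, the left side of the condition on the
exponents (`nonlocalPhase_tsum_correction_lt_top`, `localPhase_tsum_correction_lt_top`).

*Smooth functions.* A smooth function with the same boundary values has increment `1` between the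
two ends of the axis, and since the Cantor set has length zero this increment is carried by the
gaps. A chain of balls in a gap ball bounds the increment over a gap of length of order `R` by
`R ^ (t - (d + β) / q)` times the `q`-th root of the weighted energy in that ball
(`exists_diameter_bound`); the weight degenerates at the end points of the gap, which costs the
exponent `β / q`. In the local case a Poincaré inequality (`lintegral_ball_oscillation_le`) supplies
the oscillation bound. Hölder's inequality within each generation and a geometric series over the
generations give a positive lower bound for the weighted phase (`exists_nonlocalPhase_lower_bound`,
`exists_localPhase_lower_bound`). The series converges when `D` is below
`q / (q - 1) * (t - (d + β) / q)`, the right side of the condition.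

*Conclusion.* For `β = α > 0`, the condition on the exponents leaves room for `D`
(`exists_parameters`); if `α = 0`, a small `β > 0` still does, as the condition is open and a higher
Hölder exponent is better on bounded sets. The lower bound passes from smooth functions to their
closure because convergence in the Luxemburg norm forces the energy of the difference to vanish
(`lavrentievGap_of_lower_bound`), and for large `M` it exceeds the energy of the competitor
(`exists_lavrentievGap`).
-/

namespace NonlocalGap

variable {d : ℕ}

local notation "𝔼" => EuclideanSpace ℝ (Fin d)

/-! ### A criterion for the gap -/

theorem abs_add_rpow_le {p : ℝ} (hp : 1 ≤ p) (a b : ℝ) :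
    |a + b| ^ p ≤ 2 ^ (p - 1) * (|a| ^ p + |b| ^ p) := by
  have h := NNReal.rpow_add_le_mul_rpow_add_rpow ‖a‖₊ ‖b‖₊ hp
  have h' : (‖a‖ + ‖b‖) ^ p ≤ 2 ^ (p - 1) * (‖a‖ ^ p + ‖b‖ ^ p) := by exact_mod_cast h
  exact (Real.rpow_le_rpow (abs_nonneg _) (abs_add_le a b) (by linarith)).trans h'

theorem norm_add_rpow_le {F : Type*} [SeminormedAddCommGroup F] {p : ℝ} (hp : 1 ≤ p) (a b : F) :
    ‖a + b‖ ^ p ≤ 2 ^ (p - 1) * (‖a‖ ^ p + ‖b‖ ^ p) := by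
  have h := abs_add_rpow_le hp ‖a‖ ‖b‖
  rw [abs_of_nonneg (by positivity), abs_norm, abs_norm] at h
  exact (Real.rpow_le_rpow (norm_nonneg _) (norm_add_le a b) (by linarith)).trans h

theorem aemeasurable_nonlocal_integrand (s p : ℝ) {k : 𝔼 → 𝔼 → ℝ}
    (hk : Measurable (Function.uncurry k)) {f : 𝔼 → ℝ} (hf : AEMeasurable f) :
    AEMeasurable (fun z : 𝔼 × 𝔼 => ENNReal.ofReal
      (1 / p * k z.1 z.2 * (|f z.1 - f z.2| ^ p / ‖z.1 - z.2‖ ^ ((d : ℝ) + s * p))))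
      (volume.prod volume) := by
  have h1 : AEMeasurable (fun z : 𝔼 × 𝔼 => f z.1) (volume.prod volume) := hf.comp_fst
  have h2 : AEMeasurable (fun z : 𝔼 × 𝔼 => f z.2) (volume.prod volume) := hf.comp_snd
  have h3 : Measurable (fun z : 𝔼 × 𝔼 => k z.1 z.2) := hk
  have h4 : AEMeasurable (fun z : 𝔼 × 𝔼 => |f z.1 - f z.2|) (volume.prod volume) := by
    simpa [Real.norm_eq_abs] using (h1.sub h2).norm
  exact (((h3.const_mul (1 / p)).aemeasurable).mul ((h4.pow_const p).div
    (((measurable_fst.sub measurable_snd).norm.pow_const _).aemeasurable))).ennreal_ofReal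

/-- The nonlocal phase as an integral over the product space. -/
theorem nonlocalPhase_eq_lintegral_prod (s p : ℝ) {k : 𝔼 → 𝔼 → ℝ}
    (hk : Measurable (Function.uncurry k)) {f : 𝔼 → ℝ} (hf : AEMeasurable f) :
    nonlocalPhase s p k f = ∫⁻ z : 𝔼 × 𝔼, ENNReal.ofReal
      (1 / p * k z.1 z.2 * (|f z.1 - f z.2| ^ p / ‖z.1 - z.2‖ ^ ((d : ℝ) + s * p)))
      ∂(volume.prod volume) :=
  (lintegral_prod _ (aemeasurable_nonlocal_integrand s p hk hf)).symm

theorem nonlocalPhase_add_le (s : ℝ) {p : ℝ} (hp : 1 < p) {k : 𝔼 → 𝔼 → ℝ}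
    (hk : Measurable (Function.uncurry k)) (hk0 : ∀ x y, 0 ≤ k x y) {f g : 𝔼 → ℝ}
    (hf : AEMeasurable f) (hg : AEMeasurable g) :
    nonlocalPhase s p k (f + g) ≤
      ENNReal.ofReal (2 ^ (p - 1)) * (nonlocalPhase s p k f + nonlocalPhase s p k g) := by
  rw [nonlocalPhase_eq_lintegral_prod s p hk hf, nonlocalPhase_eq_lintegral_prod s p hk hg,
    nonlocalPhase_eq_lintegral_prod s p hk (hf.add hg),
    ← lintegral_add_left' (aemeasurable_nonlocal_integrand s p hk hf),
    ← lintegral_const_mul' _ _ ENNReal.ofReal_ne_top]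
  refine lintegral_mono fun z => ?_
  have hk' := hk0 z.1 z.2
  have hp' : 0 ≤ 1 / p := by positivity
  rw [← ENNReal.ofReal_add (by positivity) (by positivity),
    ← ENNReal.ofReal_mul (by positivity)]
  refine ENNReal.ofReal_le_ofReal ?_
  have h := abs_add_rpow_le hp.le (f z.1 - f z.2) (g z.1 - g z.2)
  have e : f z.1 - f z.2 + (g z.1 - g z.2) = (f + g) z.1 - (f + g) z.2 := by
    simp only [Pi.add_apply]; ring
  rw [e] at h
  set N := ‖z.1 - z.2‖ ^ ((d : ℝ) + s * p)
  have hN : 0 ≤ N := by positivity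
  calc _ ≤ 1 / p * k z.1 z.2 *
        ((2 ^ (p - 1) * (|f z.1 - f z.2| ^ p + |g z.1 - g z.2| ^ p)) / N) := by gcongr
    _ = _ := by ring

/-- Homogeneity of degree `p`, in the form used to rescale by the Luxemburg functional. -/
theorem nonlocalPhase_div (s : ℝ) {p : ℝ} (k : 𝔼 → 𝔼 → ℝ) (f : 𝔼 → ℝ) {l : ℝ} (hl : l ≠ 0) :
    nonlocalPhase s p k f = ENNReal.ofReal (|l| ^ p) * nonlocalPhase s p k (fun x => f x / l) := by
  unfold nonlocalPhase
  rw [← lintegral_const_mul' _ _ ENNReal.ofReal_ne_top]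
  refine lintegral_congr fun x => ?_
  rw [← lintegral_const_mul' _ _ ENNReal.ofReal_ne_top]
  refine lintegral_congr fun y => ?_
  rw [← ENNReal.ofReal_mul (by positivity), ← sub_div, abs_div,
    Real.div_rpow (abs_nonneg _) (abs_nonneg _)]
  congr 1
  have : |l| ^ p ≠ 0 := by positivity
  field_simp

theorem nonlocalPhase_const_mul (s p : ℝ) (k : 𝔼 → 𝔼 → ℝ) (f : 𝔼 → ℝ) {M : ℝ} (hM : 0 ≤ M) :
    nonlocalPhase s p (fun x y => M * k x y) f = ENNReal.ofReal M * nonlocalPhase s p k f := by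
  unfold nonlocalPhase
  rw [← lintegral_const_mul' _ _ ENNReal.ofReal_ne_top]
  refine lintegral_congr fun x => ?_
  rw [← lintegral_const_mul' _ _ ENNReal.ofReal_ne_top]
  refine lintegral_congr fun y => ?_
  rw [← ENNReal.ofReal_mul hM]
  ring_nf

theorem HasWeakGradient.add {v w : 𝔼 → ℝ} {G K : 𝔼 → 𝔼} (hv : HasWeakGradient v G)
    (hw : HasWeakGradient w K) : HasWeakGradient (v + w) (G + K) := by
  refine ⟨hv.1.add hw.1, hv.2.1.add hw.2.1, fun φ hφ hc => ?_⟩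
  have hgc : Continuous (gradient φ) := by
    have := hφ.continuous_fderiv (by simp)
    exact (InnerProductSpace.toDual ℝ 𝔼).symm.continuous.comp this
  have hgs : HasCompactSupport (gradient φ) := by
    have h1 := hc.fderiv (𝕜 := ℝ)
    exact h1.comp_left (g := (InnerProductSpace.toDual ℝ 𝔼).symm) (by simp)
  have i1 := hv.1.integrable_smul_right_of_hasCompactSupport hgc hgs
  have i2 := hw.1.integrable_smul_right_of_hasCompactSupport hgc hgs
  have i3 := hv.2.1.integrable_smul_left_of_hasCompactSupport hφ.continuous hc
  have i4 := hw.2.1.integrable_smul_left_of_hasCompactSupport hφ.continuous hc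
  have e1 := hv.2.2 φ hφ hc
  have e2 := hw.2.2 φ hφ hc
  simp only [Pi.add_apply, add_smul, smul_add]
  rw [integral_add i1 i2, integral_add i3 i4, e1, e2]
  abel

theorem HasWeakGradient.const_mul {v : 𝔼 → ℝ} {G : 𝔼 → 𝔼} (hv : HasWeakGradient v G) (c : ℝ) :
    HasWeakGradient (fun x => c * v x) (fun x => c • G x) := by
  refine ⟨hv.1.smul c, hv.2.1.smul c, fun φ hφ hc => ?_⟩
  have e := hv.2.2 φ hφ hc
  simp only [mul_smul, smul_comm _ c]
  rw [integral_smul, integral_smul, e, smul_neg]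

theorem localPhase_add_le {p : ℝ} (hp : 1 < p) {w : 𝔼 → ℝ} (hw : Measurable w)
    (hw0 : ∀ x, 0 ≤ w x) (f g : 𝔼 → ℝ) :
    localPhase p w (f + g) ≤
      ENNReal.ofReal (2 ^ (p - 1)) * (localPhase p w f + localPhase p w g) := by
  have hc0 : ENNReal.ofReal ((2:ℝ) ^ (p - 1)) ≠ 0 := by
    simp only [ne_eq, ENNReal.ofReal_eq_zero, not_le]; positivity
  simp only [localPhase, ENNReal.iInf_add, ENNReal.add_iInf,
    ENNReal.mul_iInf_of_ne hc0 ENNReal.ofReal_ne_top]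
  refine le_iInf fun G => le_iInf fun hG => le_iInf fun K => le_iInf fun hK => ?_
  refine (iInf₂_le (K + G) (hK.add hG)).trans ?_
  have hm : AEMeasurable K := hK.2.1.aestronglyMeasurable.aemeasurable
  have hp' : 0 ≤ 1 / p := by positivity
  have hm' : AEMeasurable (fun x => ENNReal.ofReal (1 / p * w x * ‖K x‖ ^ p))
      (volume.restrict (cube d 1)) :=
    (((hw.const_mul (1 / p)).aemeasurable.mul (hm.norm.pow_const p)).ennreal_ofReal).restrict
  rw [← lintegral_add_left' hm',
    ← lintegral_const_mul' _ _ ENNReal.ofReal_ne_top]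
  refine lintegral_mono fun x => ?_
  have hx := hw0 x
  rw [← ENNReal.ofReal_add (by positivity) (by positivity), ← ENNReal.ofReal_mul (by positivity)]
  refine ENNReal.ofReal_le_ofReal ?_
  have h := norm_add_rpow_le hp.le (K x) (G x)
  calc _ ≤ 1 / p * w x * (2 ^ (p - 1) * (‖K x‖ ^ p + ‖G x‖ ^ p)) := by
        rw [Pi.add_apply]; gcongr
    _ = _ := by ring

theorem localPhase_div_le {p : ℝ} (w : 𝔼 → ℝ) (f : 𝔼 → ℝ) {l : ℝ} (hl : l ≠ 0) :
    localPhase p w f ≤ ENNReal.ofReal (|l| ^ p) * localPhase p w (fun x => f x / l) := by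
  have hc0 : ENNReal.ofReal (|l| ^ p) ≠ 0 := by
    simp only [ne_eq, ENNReal.ofReal_eq_zero, not_le]; positivity
  simp only [localPhase, ENNReal.mul_iInf_of_ne hc0 ENNReal.ofReal_ne_top]
  refine le_iInf fun G => le_iInf fun hG => ?_
  have h1 := hG.const_mul l
  have h2 : (fun x => l * (f x / l)) = f := by ext x; field_simp
  rw [h2] at h1
  refine (iInf₂_le _ h1).trans ?_
  rw [← lintegral_const_mul' _ _ ENNReal.ofReal_ne_top]
  refine lintegral_mono fun x => ?_
  rw [← ENNReal.ofReal_mul (by positivity), norm_smul, Real.norm_eq_abs,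
    Real.mul_rpow (abs_nonneg _) (norm_nonneg _)]
  exact ENNReal.ofReal_le_ofReal (by ring_nf; rfl)

theorem localPhase_const_mul (p : ℝ) (w : 𝔼 → ℝ) (f : 𝔼 → ℝ) {M : ℝ} (hM : 0 < M) :
    localPhase p (fun x => M * w x) f = ENNReal.ofReal M * localPhase p w f := by
  have hc0 : ENNReal.ofReal M ≠ 0 := by simpa using hM
  simp only [localPhase, ENNReal.mul_iInf_of_ne hc0 ENNReal.ofReal_ne_top]
  refine iInf_congr fun G => iInf_congr fun hG => ?_
  rw [← lintegral_const_mul' _ _ ENNReal.ofReal_ne_top]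
  refine lintegral_congr fun x => ?_
  rw [← ENNReal.ofReal_mul hM.le]
  ring_nf

/-- The test functions `C_0^∞(Ω)`, with `Ω` the cube `cube d 1`. -/
def IsTest (φ : 𝔼 → ℝ) : Prop :=
  ContDiff ℝ ∞ φ ∧ HasCompactSupport φ ∧ tsupport φ ⊆ cube d 1

/-- Lower bounds for the second phase on `u_D + C_0^∞(Ω)` pass to the closure `u_D + H_0(Ω)` up to
the constant of the quasi-triangle inequality; a competitor in `u_D + W_0(Ω)` of smaller energy
then produces a gap. -/
theorem lavrentievGap_of_lower_bound {P Q : (𝔼 → ℝ) → ℝ≥0∞} {q : ℝ} (hq : 1 < q)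
    {K c : ℝ≥0∞} (hK0 : K ≠ 0) (hK : K ≠ ⊤)
    (hadd : ∀ f g : 𝔼 → ℝ, AEMeasurable f → AEMeasurable g → Q (f + g) ≤ K * (Q f + Q g))
    (hdiv : ∀ (f : 𝔼 → ℝ) (l : ℝ), l ≠ 0 →
      Q f ≤ ENNReal.ofReal (|l| ^ q) * Q (fun x => f x / l))
    {uD : 𝔼 → ℝ} (huD : IsBoundaryDatum uD)
    (hlow : ∀ φ : 𝔼 → ℝ, IsTest φ → c ≤ Q (uD + φ))
    {v : 𝔼 → ℝ} (hv : v ∈ W (fun f => P f + Q f) uD) (hlt : K * (P v + Q v) < c) :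
    LavrentievGap (fun f => P f + Q f) := by
  refine ⟨uD, huD, ?_⟩
  have key : ∀ f ∈ H (fun f => P f + Q f) uD, c / K ≤ Q f := by
    intro f hf
    rw [ENNReal.div_le_iff_le_mul (Or.inl hK0) (Or.inl hK), mul_comm]
    have hb : ∀ ε : ℝ, 0 < ε → ε ≤ 1 → c ≤ K * (Q f + ENNReal.ofReal ε) := by
      intro ε hε hε1
      obtain ⟨φ, h1, h2, h3, h4⟩ := hf.2 (ENNReal.ofReal ε) (by simpa using hε)
      simp only [luxNorm, iInf_lt_iff] at h4
      obtain ⟨l, hl, hJ, hlε⟩ := h4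
      have hlε' : l < ε := (ENNReal.ofReal_lt_ofReal_iff hε).1 hlε
      have hfm : AEMeasurable f := by
        have ha := hf.1.1.aestronglyMeasurable.aemeasurable
        have := ha.add huD.1.continuous.measurable.aemeasurable
        simpa using this
      have hg : AEMeasurable (uD + φ - f) :=
        ((huD.1.continuous.add h1.continuous).measurable.aemeasurable).sub hfm
      have e1 : Q (uD + φ - f) ≤ ENNReal.ofReal ε := by
        -- the sign of `f - u_D - φ` is absorbed by scaling with `-l`
        have h5 := hdiv (uD + φ - f) (-l) (by linarith)
        have h6 : (fun x => (uD + φ - f) x / -l) = fun x => (f - uD - φ) x / l := by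
          ext x
          simp only [Pi.add_apply, Pi.sub_apply]
          field_simp
          ring
        rw [h6, abs_neg, abs_of_pos hl] at h5
        have h7 : Q (fun x => (f - uD - φ) x / l) ≤ 1 := le_add_self.trans hJ
        have h8 : l ^ q ≤ ε := by
          refine le_trans ?_ hlε'.le
          calc l ^ q ≤ l ^ (1 : ℝ) :=
                Real.rpow_le_rpow_of_exponent_ge hl (by linarith) hq.le
            _ = l := Real.rpow_one l
        calc _ ≤ ENNReal.ofReal (l ^ q) * 1 := h5.trans (by gcongr)
          _ ≤ _ := by rw [mul_one]; exact ENNReal.ofReal_le_ofReal h8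
      calc c ≤ Q (uD + φ) := hlow φ ⟨h1, h2, h3⟩
        _ = Q (f + (uD + φ - f)) := by congr 1; abel
        _ ≤ K * (Q f + Q (uD + φ - f)) := hadd _ _ hfm hg
        _ ≤ _ := by gcongr
    have ht : Filter.Tendsto (fun n : ℕ => K * (Q f + ENNReal.ofReal (1 / ((n : ℝ) + 1))))
        Filter.atTop (nhds (K * (Q f + ENNReal.ofReal 0))) := by
      refine ENNReal.Tendsto.const_mul (tendsto_const_nhds.add ?_) (Or.inr hK)
      exact (ENNReal.continuous_ofReal.tendsto 0).comp tendsto_one_div_add_atTop_nhds_zero_nat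
    rw [ENNReal.ofReal_zero, add_zero] at ht
    refine ge_of_tendsto' ht fun n => hb _ (by positivity) ?_
    rw [div_le_one (by positivity)]
    linarith [n.cast_nonneg (α := ℝ)]
  calc (⨅ f ∈ W (fun f => P f + Q f) uD, P f + Q f) ≤ P v + Q v := iInf₂_le v hv
    _ < c / K := by
      rw [ENNReal.lt_div_iff_mul_lt (Or.inl hK0) (Or.inl hK), mul_comm]; exact hlt
    _ ≤ _ := le_iInf₂ fun f hf => (key f hf).trans le_add_self

/-! ### Gagliardo energy of bounded Lipschitz functions -/

/-- The radial profile dominating the Gagliardo integrand of a function which is bounded and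
Lipschitz at unit scale. -/
noncomputable def gagliardoProfile (d : ℕ) (s p : ℝ) (r : ℝ) : ℝ :=
  min 1 r ^ p / r ^ ((d : ℝ) + s * p)

theorem gagliardoProfile_nonneg (s p : ℝ) {r : ℝ} (hr : 0 ≤ r) : 0 ≤ gagliardoProfile d s p r := by
  unfold gagliardoProfile
  have : 0 ≤ min 1 r := le_min zero_le_one hr
  positivity

theorem nontrivial_euclideanSpace (hd : 1 ≤ d) : Nontrivial 𝔼 := by
  apply Module.nontrivial_of_finrank_pos (R := ℝ)
  rw [finrank_euclideanSpace_fin]; omega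

theorem integrable_gagliardoProfile (hd : 1 ≤ d) {s p : ℝ} (hs : 0 < s) (hs1 : s < 1)
    (hp : 1 < p) : Integrable (fun z : 𝔼 => gagliardoProfile d s p ‖z‖) := by
  have hfr : Module.finrank ℝ 𝔼 = d := finrank_euclideanSpace_fin
  have : Nontrivial 𝔼 := nontrivial_euclideanSpace hd
  have hsp : 0 < s * p := by positivity
  have hsp' : s * p < p := by nlinarith
  rw [integrable_fun_norm_addHaar, hfr, ← Ioc_union_Ioi_eq_Ioi zero_le_one]
  refine IntegrableOn.union ?_ ?_
  · have h : IntegrableOn (fun y : ℝ => y ^ (p - s * p - 1)) (Ioc 0 1) := by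
      rw [← intervalIntegrable_iff_integrableOn_Ioc_of_le zero_le_one]
      exact intervalIntegral.intervalIntegrable_rpow' (by linarith)
    refine h.congr_fun (fun y hy => ?_) measurableSet_Ioc
    have hy0 : 0 < y := hy.1
    simp only [gagliardoProfile, smul_eq_mul, min_eq_right hy.2]
    rw [← Real.rpow_natCast, ← Real.rpow_sub hy0, ← Real.rpow_add hy0, Nat.cast_sub hd]
    congr 1
    push_cast
    ring
  · have h : IntegrableOn (fun y : ℝ => y ^ (-1 - s * p)) (Ioi 1) :=
      integrableOn_Ioi_rpow_of_lt (by linarith) zero_lt_one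
    refine h.congr_fun (fun y hy => ?_) measurableSet_Ioi
    have hy1 : 1 < y := hy
    have hy0 : 0 < y := by linarith
    simp only [gagliardoProfile, smul_eq_mul, min_eq_left hy1.le, Real.one_rpow]
    rw [← Real.rpow_natCast, one_div, ← Real.rpow_neg hy0.le, ← Real.rpow_add hy0,
      Nat.cast_sub hd]
    congr 1
    push_cast
    ring

theorem lintegral_gagliardoProfile_scaled (hd : 1 ≤ d) {s p : ℝ} (hs : 0 < s) (hs1 : s < 1)
    (hp : 1 < p) {l : ℝ} (hl : 0 < l) :
    ∫⁻ z : 𝔼, ENNReal.ofReal (min 1 (‖z‖ / l) ^ p / ‖z‖ ^ ((d : ℝ) + s * p)) =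
      ENNReal.ofReal (l ^ (-(s * p)) * ∫ z : 𝔼, gagliardoProfile d s p ‖z‖) := by
  have hi := integrable_gagliardoProfile hd hs hs1 hp
  have hfr : Module.finrank ℝ 𝔼 = d := finrank_euclideanSpace_fin
  have e : ∀ z : 𝔼, min 1 (‖z‖ / l) ^ p / ‖z‖ ^ ((d : ℝ) + s * p) =
      l ^ (-((d : ℝ) + s * p)) * gagliardoProfile d s p ‖l⁻¹ • z‖ := by
    intro z
    have h1 : ‖l⁻¹ • z‖ = ‖z‖ / l := by
      rw [norm_smul, norm_inv, Real.norm_of_nonneg hl.le]; ring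
    rw [h1, gagliardoProfile, Real.div_rpow (norm_nonneg _) hl.le, Real.rpow_neg hl.le]
    have : l ^ ((d : ℝ) + s * p) ≠ 0 := by positivity
    field_simp
  simp only [e]
  have hi2 : Integrable (fun z : 𝔼 => gagliardoProfile d s p ‖l⁻¹ • z‖) :=
    hi.comp_smul (inv_ne_zero hl.ne')
  rw [← ofReal_integral_eq_lintegral_ofReal (hi2.const_mul _)
    (Filter.Eventually.of_forall fun z => mul_nonneg (by positivity)
      (gagliardoProfile_nonneg s p (norm_nonneg _))), integral_const_mul,
    Measure.integral_comp_inv_smul_of_nonneg volume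
      (fun z : 𝔼 => gagliardoProfile d s p ‖z‖) hl.le, hfr, smul_eq_mul, ← mul_assoc]
  congr 2
  rw [← Real.rpow_natCast, ← Real.rpow_add hl]
  congr 1
  ring

/-- A function supported in `S`, of size `A` and varying at scale `l`, has `W^{s,p}` energy at most
of order `A ^ p * l ^ (-s p) * |S|`. -/
theorem nonlocalPhase_le_of_support (hd : 1 ≤ d) {s p : ℝ} (hs : 0 < s) (hs1 : s < 1)
    (hp : 1 < p) {k : 𝔼 → 𝔼 → ℝ} {B : ℝ} (hk0 : ∀ x y, 0 ≤ k x y) (hkB : ∀ x y, k x y ≤ B)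
    {f : 𝔼 → ℝ} {S : Set 𝔼} (hS : MeasurableSet S) (hf : ∀ x, x ∉ S → f x = 0) {A l : ℝ}
    (hA : 0 ≤ A) (hl : 0 < l) (hlip : ∀ x y, |f x - f y| ≤ A * min 1 (‖x - y‖ / l)) :
    nonlocalPhase s p k f ≤ ENNReal.ofReal
      (2 * B / p * A ^ p * l ^ (-(s * p)) * ∫ z : 𝔼, gagliardoProfile d s p ‖z‖) * volume S := by
  have hB : 0 ≤ B := (hk0 0 0).trans (hkB 0 0)
  have hI : 0 ≤ ∫ z : 𝔼, gagliardoProfile d s p ‖z‖ :=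
    integral_nonneg fun z => gagliardoProfile_nonneg s p (norm_nonneg _)
  set I := ∫ z : 𝔼, gagliardoProfile d s p ‖z‖
  have hp0 : 0 < p := by linarith
  set c : ℝ := B / p * A ^ p with hc
  have hc0 : 0 ≤ c := by positivity
  let Ψ : 𝔼 → ℝ≥0∞ := fun z =>
    ENNReal.ofReal c * ENNReal.ofReal (min 1 (‖z‖ / l) ^ p / ‖z‖ ^ ((d : ℝ) + s * p))
  have hΨm : Measurable Ψ := by
    refine Measurable.const_mul (Measurable.ennreal_ofReal ?_) _
    exact (((measurable_const.min (measurable_norm.div_const l))).pow_const p).div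
      (measurable_norm.pow_const _)
  have hΨ : ∫⁻ z, Ψ z = ENNReal.ofReal (c * (l ^ (-(s * p)) * I)) := by
    rw [lintegral_const_mul' _ _ ENNReal.ofReal_ne_top,
      lintegral_gagliardoProfile_scaled hd hs hs1 hp hl, ← ENNReal.ofReal_mul hc0]
  let χ : 𝔼 → ℝ≥0∞ := S.indicator 1
  have hχm : Measurable χ := measurable_one.indicator hS
  have hχ : ∫⁻ x, χ x = volume S := by
    simp only [χ]; rw [lintegral_indicator hS]; simp
  have hpt : ∀ x y, ENNReal.ofReal
      (1 / p * k x y * (|f x - f y| ^ p / ‖x - y‖ ^ ((d : ℝ) + s * p))) ≤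
      χ x * Ψ (x - y) + χ y * Ψ (x - y) := by
    intro x y
    by_cases hxy : x ∉ S ∧ y ∉ S
    · rw [hf x hxy.1, hf y hxy.2]
      simp [Real.zero_rpow hp0.ne']
    have h1 : 1 ≤ χ x + χ y := by
      by_cases hx : x ∈ S
      · simp [χ, hx]
      · have hy : y ∈ S := by tauto
        simp [χ, hy]
    have h2 : ENNReal.ofReal
        (1 / p * k x y * (|f x - f y| ^ p / ‖x - y‖ ^ ((d : ℝ) + s * p))) ≤ Ψ (x - y) := by
      simp only [Ψ]
      rw [← ENNReal.ofReal_mul hc0]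
      refine ENNReal.ofReal_le_ofReal ?_
      have hm : 0 ≤ min 1 (‖x - y‖ / l) := le_min zero_le_one (by positivity)
      have h3 : |f x - f y| ^ p ≤ A ^ p * min 1 (‖x - y‖ / l) ^ p := by
        rw [← Real.mul_rpow hA hm]
        exact Real.rpow_le_rpow (abs_nonneg _) (hlip x y) hp0.le
      have h4 := hkB x y
      calc _ ≤ 1 / p * B *
            (A ^ p * min 1 (‖x - y‖ / l) ^ p / ‖x - y‖ ^ ((d : ℝ) + s * p)) := by gcongr
        _ = _ := by rw [hc]; ring
    calc _ ≤ 1 * Ψ (x - y) := by rw [one_mul]; exact h2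
      _ ≤ (χ x + χ y) * Ψ (x - y) := by gcongr
      _ = _ := add_mul _ _ _
  have hJ : ∀ x, ∫⁻ y, Ψ (x - y) = ∫⁻ z, Ψ z := fun x =>
    lintegral_sub_left_eq_self (fun z => Ψ z) x
  have hJ' : ∀ y, ∫⁻ x, Ψ (x - y) = ∫⁻ z, Ψ z := fun y =>
    lintegral_sub_right_eq_self (fun z => Ψ z) y
  calc nonlocalPhase s p k f ≤ ∫⁻ x, ∫⁻ y, (χ x * Ψ (x - y) + χ y * Ψ (x - y)) :=
        lintegral_mono fun x => lintegral_mono fun y => hpt x y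
    _ = ∫⁻ x, ((∫⁻ y, χ x * Ψ (x - y)) + ∫⁻ y, χ y * Ψ (x - y)) := by
        refine lintegral_congr fun x => lintegral_add_left ?_ _
        exact (hΨm.comp (measurable_const.sub measurable_id)).const_mul _
    _ = (∫⁻ x, ∫⁻ y, χ x * Ψ (x - y)) + ∫⁻ x, ∫⁻ y, χ y * Ψ (x - y) := by
        refine lintegral_add_left ?_ _
        refine Measurable.lintegral_prod_right' (f := fun z : 𝔼 × 𝔼 => χ z.1 * Ψ (z.1 - z.2)) ?_
        exact (hχm.comp measurable_fst).mul (hΨm.comp (measurable_fst.sub measurable_snd))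
    _ = volume S * (∫⁻ z, Ψ z) + volume S * ∫⁻ z, Ψ z := by
        congr 1
        · have : ∀ x, ∫⁻ y, χ x * Ψ (x - y) = χ x * ∫⁻ z, Ψ z := fun x => by
            have hm : Measurable fun y => Ψ (x - y) := hΨm.comp (measurable_const.sub measurable_id)
            rw [lintegral_const_mul _ hm, hJ]
          simp only [this]
          rw [lintegral_mul_const _ hχm, hχ]
        · rw [lintegral_lintegral_swap]
          · have : ∀ y, ∫⁻ x, χ y * Ψ (x - y) = χ y * ∫⁻ z, Ψ z := fun y => by
              have hm : Measurable fun x => Ψ (x - y) :=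
                hΨm.comp (measurable_id.sub measurable_const)
              rw [lintegral_const_mul _ hm, hJ']
            simp only [this]
            rw [lintegral_mul_const _ hχm, hχ]
          · exact ((hχm.comp measurable_snd).mul
              (hΨm.comp (measurable_fst.sub measurable_snd))).aemeasurable
    _ = _ := by
        have h0 : 0 ≤ c * (l ^ (-(s * p)) * I) := by positivity
        rw [hΨ, ← mul_add, ← ENNReal.ofReal_add h0 h0, mul_comm (volume S)]
        congr 2
        rw [hc]
        ring

/-! ### Weak gradients -/

theorem hasWeakGradient_of_contDiff {f : 𝔼 → ℝ} (hf : ContDiff ℝ 1 f) :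
    HasWeakGradient f (gradient f) := by
  have hgc : Continuous (gradient f) :=
    (InnerProductSpace.toDual ℝ 𝔼).symm.continuous.comp (hf.continuous_fderiv (by simp))
  refine ⟨hf.continuous.locallyIntegrable, hgc.locallyIntegrable, fun φ hφ hc => ?_⟩
  have hφc : Continuous (gradient φ) :=
    (InnerProductSpace.toDual ℝ 𝔼).symm.continuous.comp (hφ.continuous_fderiv (by simp))
  have hφs : HasCompactSupport (gradient φ) :=
    (hc.fderiv (𝕜 := ℝ)).comp_left (g := (InnerProductSpace.toDual ℝ 𝔼).symm) (by simp)
  have i1 : Integrable fun x => f x • gradient φ x :=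
    hf.continuous.locallyIntegrable.integrable_smul_right_of_hasCompactSupport hφc hφs
  have i2 : Integrable fun x => φ x • gradient f x :=
    hgc.locallyIntegrable.integrable_smul_left_of_hasCompactSupport hφ.continuous hc
  have i3 : Integrable fun x => f x • φ x :=
    hf.continuous.locallyIntegrable.integrable_smul_right_of_hasCompactSupport hφ.continuous hc
  refine ext_inner_left ℝ fun v => ?_
  rw [inner_neg_right, ← integral_inner i1, ← integral_inner i2]
  simp only [real_inner_smul_right, inner_gradient_right, conj_trivial]
  have hdf : Differentiable ℝ f := hf.differentiable (by simp)
  have hdφ : Differentiable ℝ φ := hφ.differentiable (by simp)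
  rw [integral_mul_fderiv_eq_neg_fderiv_mul_of_integrable]
  · congr 1
    exact integral_congr_ae (Filter.Eventually.of_forall fun x => mul_comm _ _)
  · refine (i2.const_inner v).congr (Filter.Eventually.of_forall fun x => ?_)
    simp only [real_inner_smul_right, inner_gradient_right, conj_trivial]
    ring
  · refine (i1.const_inner v).congr (Filter.Eventually.of_forall fun x => ?_)
    simp only [real_inner_smul_right, inner_gradient_right, conj_trivial]
  · exact i3
  · exact fun x _ => hdf x
  · exact fun x _ => hdφ x

theorem HasWeakGradient.ae_eq {v : 𝔼 → ℝ} {G K : 𝔼 → 𝔼} (hG : HasWeakGradient v G)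
    (hK : HasWeakGradient v K) : ∀ᵐ x, G x = K x :=
  ae_eq_of_integral_contDiff_smul_eq hG.2.1 hK.2.1 fun φ hφ hc =>
    neg_injective ((hG.2.2 φ hφ hc).symm.trans (hK.2.2 φ hφ hc))

/-- For `C^1` functions the infimum over weak gradients is attained at the classical one, by
uniqueness of weak gradients. -/
theorem localPhase_eq_of_contDiff (p : ℝ) (w : 𝔼 → ℝ) {f : 𝔼 → ℝ} (hf : ContDiff ℝ 1 f) :
    localPhase p w f = ∫⁻ x in cube d 1, ENNReal.ofReal (1 / p * w x * ‖gradient f x‖ ^ p) := by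
  refine le_antisymm (iInf₂_le _ (hasWeakGradient_of_contDiff hf)) ?_
  refine le_iInf₂ fun G hG => le_of_eq (lintegral_congr_ae ?_)
  filter_upwards [ae_restrict_of_ae ((hasWeakGradient_of_contDiff hf).ae_eq hG)] with x hx
  rw [hx]

theorem integrable_tsum_of_summable_integral_norm {X F : Type*} [MeasurableSpace X]
    {μ : Measure X} [NormedAddCommGroup F] [NormedSpace ℝ F] [CompleteSpace F] {G : ℕ → X → F}
    (hG : ∀ k, Integrable (G k) μ) (hGs : Summable fun k => ∫ x, ‖G k x‖ ∂μ) :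
    Integrable (fun x => ∑' k, G k x) μ := by
  have hfin : ∫⁻ x, ∑' k, ‖G k x‖ₑ ∂μ ≠ ⊤ := by
    rw [lintegral_tsum fun k => (hG k).1.enorm]
    have e : ∀ k, ∫⁻ x, ‖G k x‖ₑ ∂μ = ENNReal.ofReal (∫ x, ‖G k x‖ ∂μ) := fun k => by
      rw [ofReal_integral_norm_eq_lintegral_enorm (hG k)]
    simp only [e]
    exact hGs.tsum_ofReal_ne_top
  have hae : ∀ᵐ x ∂μ, Summable fun k => G k x := by
    filter_upwards [ae_lt_top' (AEMeasurable.tsum fun k => (hG k).1.enorm) hfin] with x hx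
    exact (tsum_enorm_ne_top_iff_summable_norm.1 hx.ne).of_norm
  refine ⟨?_, ?_⟩
  · refine aestronglyMeasurable_of_tendsto_ae Filter.atTop
      (f := fun n x => ∑ k ∈ Finset.range n, G k x)
      (fun n => Finset.aestronglyMeasurable_fun_sum _ fun k _ => (hG k).1) ?_
    filter_upwards [hae] with x hx
    exact hx.hasSum.tendsto_sum_nat
  · refine lt_of_le_of_lt (lintegral_mono fun x => enorm_tsum_le_tsum_enorm) ?_
    exact hfin.lt_top

/-- Weak gradients may be computed termwise when both series converge in `L^1`; pointwise
summability makes the sum of the functions the expected one everywhere. -/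
theorem hasWeakGradient_tsum {f : ℕ → 𝔼 → ℝ} {G : ℕ → 𝔼 → 𝔼}
    (h : ∀ k, HasWeakGradient (f k) (G k)) (hf : ∀ k, Integrable (f k))
    (hG : ∀ k, Integrable (G k)) (hfs : Summable fun k => ∫ x, ‖f k x‖)
    (hGs : Summable fun k => ∫ x, ‖G k x‖) (hpt : ∀ x, Summable fun k => f k x) :
    HasWeakGradient (fun x => ∑' k, f k x) (fun x => ∑' k, G k x) := by
  refine ⟨(integrable_tsum_of_summable_integral_norm hf hfs).locallyIntegrable,
    (integrable_tsum_of_summable_integral_norm hG hGs).locallyIntegrable, fun φ hφ hc => ?_⟩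
  have hφc : Continuous (gradient φ) :=
    (InnerProductSpace.toDual ℝ 𝔼).symm.continuous.comp (hφ.continuous_fderiv (by simp))
  have hφs : HasCompactSupport (gradient φ) :=
    (hc.fderiv (𝕜 := ℝ)).comp_left (g := (InnerProductSpace.toDual ℝ 𝔼).symm) (by simp)
  obtain ⟨C₁, hC₁⟩ := hφs.exists_bound_of_continuous hφc
  obtain ⟨C₂, hC₂⟩ := hc.exists_bound_of_continuous hφ.continuous
  have i1 : ∀ k, Integrable fun x => f k x • gradient φ x := fun k =>
    (hf k).locallyIntegrable.integrable_smul_right_of_hasCompactSupport hφc hφs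
  have i2 : ∀ k, Integrable fun x => φ x • G k x := fun k =>
    (hG k).locallyIntegrable.integrable_smul_left_of_hasCompactSupport hφ.continuous hc
  have s1 : Summable fun k => ∫ x, ‖f k x • gradient φ x‖ := by
    refine Summable.of_nonneg_of_le (fun k => integral_nonneg fun x => norm_nonneg _)
      (fun k => ?_) (hfs.mul_left C₁)
    rw [← integral_const_mul]
    refine integral_mono (i1 k).norm ((hf k).norm.const_mul _) fun x => ?_
    simp only [norm_smul]
    rw [mul_comm]
    exact mul_le_mul_of_nonneg_right (hC₁ x) (norm_nonneg _)
  have s2 : Summable fun k => ∫ x, ‖φ x • G k x‖ := by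
    refine Summable.of_nonneg_of_le (fun k => integral_nonneg fun x => norm_nonneg _)
      (fun k => ?_) (hGs.mul_left C₂)
    rw [← integral_const_mul]
    refine integral_mono (i2 k).norm ((hG k).norm.const_mul _) fun x => ?_
    simp only [norm_smul]
    exact mul_le_mul_of_nonneg_right (hC₂ x) (norm_nonneg _)
  have e1 := (hasSum_integral_of_summable_integral_norm i1 s1).tsum_eq
  have e2 := (hasSum_integral_of_summable_integral_norm i2 s2).tsum_eq
  calc ∫ x, (∑' k, f k x) • gradient φ x = ∫ x, ∑' k, f k x • gradient φ x :=
        integral_congr_ae (Filter.Eventually.of_forall fun x => ((hpt x).tsum_smul_const _).symm)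
    _ = -∫ x, ∑' k, φ x • G k x := by
        rw [← e1, ← e2, ← tsum_neg]
        exact tsum_congr fun k => (h k).2.2 φ hφ hc
    _ = _ := by
        congr 1
        exact integral_congr_ae (Filter.Eventually.of_forall fun x => tsum_const_smul'' _)

/-! ### Energies of geometrically convergent series -/

/-- Hölder's inequality for series, with weights `w`. -/
theorem tsum_rpow_le {p : ℝ} (hp : 1 < p) {w : ℕ → ℝ≥0∞} (hw0 : ∀ k, w k ≠ 0)
    (hw : ∀ k, w k ≠ ⊤) (a : ℕ → ℝ≥0∞) :
    (∑' k, a k) ^ p ≤ (∑' k, w k) ^ (p - 1) * ∑' k, w k ^ (1 - p) * a k ^ p := by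
  have hp0 : 0 < p := by linarith
  have key : ∀ n, ∑ k ∈ Finset.range n, a k ≤
      (∑' k, w k) ^ (1 - p⁻¹) * (∑' k, w k ^ (1 - p) * a k ^ p) ^ p⁻¹ := by
    intro n
    have h := ENNReal.inner_le_weight_mul_Lp_of_nonneg (Finset.range n) hp.le w
      (fun k => (w k)⁻¹ * a k)
    have e1 : ∀ k, w k * ((w k)⁻¹ * a k) = a k := fun k => by
      rw [← mul_assoc, ENNReal.mul_inv_cancel (hw0 k) (hw k), one_mul]
    have e2 : ∀ k, w k * ((w k)⁻¹ * a k) ^ p = w k ^ (1 - p) * a k ^ p := fun k => by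
      rw [ENNReal.mul_rpow_of_nonneg _ _ hp0.le, ← mul_assoc, ENNReal.rpow_sub _ _ (hw0 k) (hw k),
        ENNReal.rpow_one, ENNReal.inv_rpow, div_eq_mul_inv]
    simp only [e1, e2] at h
    refine h.trans ?_
    have hp1 : 0 ≤ 1 - p⁻¹ := by
      rw [sub_nonneg]; exact inv_le_one_of_one_le₀ hp.le
    gcongr
    · exact ENNReal.sum_le_tsum _
    · exact ENNReal.sum_le_tsum _
  have h2 : ∑' k, a k ≤ (∑' k, w k) ^ (1 - p⁻¹) * (∑' k, w k ^ (1 - p) * a k ^ p) ^ p⁻¹ :=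
    ENNReal.tsum_le_of_sum_range_le key
  refine (ENNReal.rpow_le_rpow h2 hp0.le).trans_eq ?_
  rw [ENNReal.mul_rpow_of_nonneg _ _ hp0.le, ← ENNReal.rpow_mul, ← ENNReal.rpow_mul,
    inv_mul_cancel₀ hp0.ne', ENNReal.rpow_one]
  congr 2
  field_simp

/-- If the integrals of `a k ^ p` decay geometrically, then the sum of the `a k` is in `L^p`. -/
theorem lintegral_tsum_rpow_lt_top {X : Type*} [MeasurableSpace X] {μ : Measure X} {p : ℝ}
    (hp : 1 < p) {a : ℕ → X → ℝ≥0∞} (ha : ∀ k, AEMeasurable (a k) μ) {C r : ℝ}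
    (hr0 : 0 < r) (hr : r < 1)
    (h : ∀ k, ∫⁻ x, a k x ^ p ∂μ ≤ ENNReal.ofReal (C * r ^ k)) :
    ∫⁻ x, (∑' k, a k x) ^ p ∂μ < ⊤ := by
  -- the weights `θ ^ k` are chosen so that `θ ^ (1 - p) * r < 1`
  obtain ⟨r', hr1, hr2⟩ := exists_between hr
  have hr'0 : 0 < r' := hr0.trans hr1
  have hp1 : 0 < p - 1 := by linarith
  set θ : ℝ := r' ^ (p - 1)⁻¹ with hθ
  have hθ0 : 0 < θ := Real.rpow_pos_of_pos hr'0 _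
  have hθ1 : θ < 1 := Real.rpow_lt_one hr'0.le hr2 (inv_pos.2 hp1)
  have hθr : θ ^ (1 - p) * r < 1 := by
    rw [hθ, ← Real.rpow_mul hr'0.le, show (p - 1)⁻¹ * (1 - p) = -1 by field_simp; ring,
      Real.rpow_neg_one, inv_mul_lt_iff₀ hr'0, mul_one]
    exact hr1
  let w : ℕ → ℝ≥0∞ := fun k => ENNReal.ofReal (θ ^ k)
  have hw0 : ∀ k, w k ≠ 0 := fun k => by simp [w, hθ0]
  have hw : ∀ k, w k ≠ ⊤ := fun k => ENNReal.ofReal_ne_top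
  have hws : ∑' k, w k ≠ ⊤ := (summable_geometric_of_lt_one hθ0.le hθ1).tsum_ofReal_ne_top
  have e : ∀ k, w k ^ (1 - p) = ENNReal.ofReal ((θ ^ (1 - p)) ^ k) := fun k => by
    simp only [w]
    rw [ENNReal.ofReal_rpow_of_pos (by positivity), ← Real.rpow_natCast, ← Real.rpow_natCast,
      ← Real.rpow_mul hθ0.le, ← Real.rpow_mul hθ0.le, mul_comm]
  calc ∫⁻ x, (∑' k, a k x) ^ p ∂μ
      ≤ ∫⁻ x, (∑' k, w k) ^ (p - 1) * ∑' k, w k ^ (1 - p) * a k x ^ p ∂μ :=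
        lintegral_mono fun x => tsum_rpow_le hp hw0 hw _
    _ = (∑' k, w k) ^ (p - 1) * ∑' k, w k ^ (1 - p) * ∫⁻ x, a k x ^ p ∂μ := by
        rw [lintegral_const_mul' _ _ (ENNReal.rpow_ne_top_of_nonneg hp1.le hws),
          lintegral_tsum fun k => ((ha k).pow_const p).const_mul _]
        congr 1
        refine tsum_congr fun k => ?_
        rw [lintegral_const_mul'' _ ((ha k).pow_const p)]
    _ ≤ (∑' k, w k) ^ (p - 1) * ∑' k, ENNReal.ofReal (C * (θ ^ (1 - p) * r) ^ k) := by
        gcongr with k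
        calc _ ≤ ENNReal.ofReal ((θ ^ (1 - p)) ^ k) * ENNReal.ofReal (C * r ^ k) := by
              rw [e]; gcongr; exact h k
          _ = _ := by
              rw [← ENNReal.ofReal_mul (by positivity)]
              congr 1
              rw [mul_pow]; ring
    _ < ⊤ := by
        refine ENNReal.mul_lt_top (ENNReal.rpow_ne_top_of_nonneg hp1.le hws).lt_top ?_
        exact (((summable_geometric_of_lt_one (by positivity) hθr).mul_left
          C).tsum_ofReal_ne_top).lt_top

/-- A constant is moved inside the `p`-th power, so that energy densities become plain `p`-th
powers. -/
theorem ofReal_rpow_norm_eq {F : Type*} [SeminormedAddCommGroup F] {p c : ℝ} (hp : 1 < p)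
    (hc : 0 ≤ c) (b : F) :
    ENNReal.ofReal (c ^ p⁻¹ * ‖b‖) ^ p = ENNReal.ofReal (c * ‖b‖ ^ p) := by
  have hp0 : 0 < p := by linarith
  rw [ENNReal.ofReal_rpow_of_nonneg (by positivity) hp0.le,
    Real.mul_rpow (by positivity) (norm_nonneg _), ← Real.rpow_mul hc, inv_mul_cancel₀ hp0.ne',
    Real.rpow_one]

theorem ofReal_norm_tsum_rpow_le {F : Type*} [NormedAddCommGroup F] {p c : ℝ} (hp : 1 < p)
    (hc : 0 ≤ c) (b : ℕ → F) :
    ENNReal.ofReal (c * ‖∑' k, b k‖ ^ p) ≤ (∑' k, ENNReal.ofReal (c ^ p⁻¹ * ‖b k‖)) ^ p := by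
  rw [← ofReal_rpow_norm_eq hp hc]
  have hc' : 0 ≤ c ^ p⁻¹ := by positivity
  refine ENNReal.rpow_le_rpow ?_ (by linarith)
  simp only [ENNReal.ofReal_mul hc', ENNReal.tsum_mul_left]
  gcongr
  simp only [ofReal_norm]
  exact enorm_tsum_le_tsum_enorm

theorem nonlocalPhase_tsum_lt_top (s : ℝ) {p : ℝ} (hp : 1 < p) {u : ℕ → 𝔼 → ℝ}
    (hu : ∀ k, Measurable (u k)) (hpt : ∀ x, Summable fun k => u k x) {C r : ℝ}
    (hr0 : 0 < r) (hr : r < 1)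
    (h : ∀ k, nonlocalPhase s p (fun _ _ => 1) (u k) ≤ ENNReal.ofReal (C * r ^ k)) :
    nonlocalPhase s p (fun _ _ => 1) (fun x => ∑' k, u k x) < ⊤ := by
  have hm : Measurable fun x => ∑' k, u k x :=
    measurable_of_tendsto_metrizable (f := fun n x => ∑ k ∈ Finset.range n, u k x)
      (fun n => Finset.measurable_sum _ fun k _ => hu k)
      (tendsto_pi_nhds.2 fun x => (hpt x).hasSum.tendsto_sum_nat)
  rw [nonlocalPhase_eq_lintegral_prod s p measurable_const hm.aemeasurable]
  let c : 𝔼 × 𝔼 → ℝ := fun z => 1 / p * 1 / ‖z.1 - z.2‖ ^ ((d : ℝ) + s * p)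
  have hc0 : ∀ z, 0 ≤ c z := fun z => by positivity
  have hcm : Measurable c :=
    measurable_const.div ((measurable_fst.sub measurable_snd).norm.pow_const _)
  have e : ∀ (z : 𝔼 × 𝔼) (b : ℝ),
      1 / p * 1 * (|b| ^ p / ‖z.1 - z.2‖ ^ ((d : ℝ) + s * p)) = c z * ‖b‖ ^ p := fun z b => by
    simp only [c, Real.norm_eq_abs]; ring
  let a : ℕ → 𝔼 × 𝔼 → ℝ≥0∞ := fun k z =>
    ENNReal.ofReal (c z ^ p⁻¹ * ‖u k z.1 - u k z.2‖)
  have ham : ∀ k, Measurable (a k) := fun k =>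
    ((hcm.pow_const _).mul (((hu k).comp measurable_fst).sub
      ((hu k).comp measurable_snd)).norm).ennreal_ofReal
  refine lt_of_le_of_lt (lintegral_mono fun z => ?_)
    (lintegral_tsum_rpow_lt_top (C := C) hp (fun k => (ham k).aemeasurable) hr0 hr fun k => ?_)
  · rw [e, ← (hpt z.1).tsum_sub (hpt z.2)]
    exact ofReal_norm_tsum_rpow_le hp (hc0 z) _
  · refine le_trans (le_of_eq ?_) (h k)
    rw [nonlocalPhase_eq_lintegral_prod s p measurable_const (hu k).aemeasurable]
    refine lintegral_congr fun z => ?_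
    rw [e, ofReal_rpow_norm_eq hp (hc0 z)]

theorem lintegral_tsum_norm_rpow_lt_top {p : ℝ} (hp : 1 < p) {G : ℕ → 𝔼 → 𝔼}
    (hG : ∀ k, Measurable (G k)) {S : Set 𝔼} {C r : ℝ} (hr0 : 0 < r) (hr : r < 1)
    (h : ∀ k, ∫⁻ x in S, ENNReal.ofReal (1 / p * 1 * ‖G k x‖ ^ p) ≤ ENNReal.ofReal (C * r ^ k)) :
    ∫⁻ x in S, ENNReal.ofReal (1 / p * 1 * ‖∑' k, G k x‖ ^ p) < ⊤ := by
  have hc : 0 ≤ 1 / p * 1 := by positivity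
  refine lt_of_le_of_lt (lintegral_mono fun x => ofReal_norm_tsum_rpow_le hp hc _)
    (lintegral_tsum_rpow_lt_top (C := C) hp (fun k => Measurable.aemeasurable ?_) hr0 hr
      fun k => ?_)
  · exact ((hG k).norm.const_mul _).ennreal_ofReal
  · refine le_trans (le_of_eq (lintegral_congr fun x => ?_)) (h k)
    rw [ofReal_rpow_norm_eq hp hc]

/-! ### The Cantor set and its gap balls -/

/-- The sign `±1` attached to a letter. -/
noncomputable def sgn (b : Bool) : ℝ := if b then 1 else -1

theorem abs_sgn (b : Bool) : |sgn b| = 1 := by cases b <;> simp [sgn]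

/-- The centre of the interval of the `k`-th Cantor generation on `[-1, 1]` with contraction
ratio `l` which is addressed by the word `w`; this interval has radius `l ^ k`. -/
noncomputable def center (l : ℝ) {k : ℕ} (w : Fin k → Bool) : ℝ :=
  ∑ i, sgn (w i) * (1 - l) * l ^ (i : ℕ)

theorem center_cons (l : ℝ) {k : ℕ} (b : Bool) (w : Fin k → Bool) :
    center l (Fin.cons b w : Fin (k + 1) → Bool) = sgn b * (1 - l) + l * center l w := by
  simp only [center, Fin.sum_univ_succ, Fin.cons_zero, Fin.val_zero, pow_zero, mul_one,
    Fin.cons_succ, Fin.val_succ, Finset.mul_sum]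
  congr 1
  exact Finset.sum_congr rfl fun i _ => by ring

theorem center_snoc (l : ℝ) {k : ℕ} (w : Fin k → Bool) (b : Bool) :
    center l (Fin.snoc w b : Fin (k + 1) → Bool) = center l w + sgn b * (1 - l) * l ^ k := by
  simp [center, Fin.sum_univ_castSucc]

theorem abs_center_add_le {l : ℝ} (h0 : 0 < l) (h1 : l < 1 / 2) {k : ℕ} (w : Fin k → Bool) :
    |center l w| + l ^ k ≤ 1 := by
  induction k with
  | zero => simp [center]
  | succ k ih =>
    rw [← Fin.cons_self_tail w, center_cons]
    have h := ih (Fin.tail w)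
    have h2 := abs_add_le (sgn (w 0) * (1 - l)) (l * center l (Fin.tail w))
    rw [abs_mul, abs_mul, abs_sgn, abs_of_pos (by linarith : 0 < 1 - l), abs_of_pos h0] at h2
    have h3 := mul_le_mul_of_nonneg_left h h0.le
    rw [pow_succ]
    linarith

/-- The intervals of one generation do not overlap. -/
theorem two_mul_pow_le_abs_center_sub {l : ℝ} (h0 : 0 < l) (h1 : l < 1 / 2) {k : ℕ}
    {w w' : Fin k → Bool} (h : w ≠ w') : 2 * l ^ k ≤ |center l w - center l w'| := by
  induction k with
  | zero => exact absurd (Subsingleton.elim w w') h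
  | succ k ih =>
    rw [← Fin.cons_self_tail w, ← Fin.cons_self_tail w', center_cons, center_cons]
    by_cases hb : w 0 = w' 0
    · have ht : Fin.tail w ≠ Fin.tail w' := fun ht => h (by
        rw [← Fin.cons_self_tail w, ← Fin.cons_self_tail w', hb, ht])
      have h2 := ih ht
      rw [hb, show ∀ a b c : ℝ, a + l * b - (a + l * c) = l * (b - c) by intros; ring, abs_mul,
        abs_of_pos h0, pow_succ]
      nlinarith
    · have c1 := abs_center_add_le h0 h1 (Fin.tail w)
      have c2 := abs_center_add_le h0 h1 (Fin.tail w')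
      have hs : |sgn (w 0) - sgn (w' 0)| = 2 := by
        revert hb
        cases w 0 <;> cases w' 0 <;> simp [sgn] <;> norm_num
      have h3 : |sgn (w 0) * (1 - l) - sgn (w' 0) * (1 - l)| = 2 * (1 - l) := by
        rw [← sub_mul, abs_mul, hs, abs_of_pos (by linarith : 0 < 1 - l)]
      have h4 := abs_sub_abs_le_abs_sub (sgn (w 0) * (1 - l) - sgn (w' 0) * (1 - l))
        (l * center l (Fin.tail w') - l * center l (Fin.tail w))
      have h5 := abs_sub (l * center l (Fin.tail w')) (l * center l (Fin.tail w))
      rw [abs_mul, abs_mul, abs_of_pos h0] at h5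
      rw [show ∀ a b c e : ℝ, a + b - (c + e) = a - c - (e - b) by intros; ring]
      rw [pow_succ]
      nlinarith

/-- The ball around the gap which is removed from the interval addressed by `w`, centred on the
`i₀`-th coordinate axis and having this gap as a diameter. -/
def gapBall (l : ℝ) (i₀ : Fin d) {k : ℕ} (w : Fin k → Bool) : Set 𝔼 :=
  Metric.ball (EuclideanSpace.single i₀ (center l w)) (l ^ k * (1 - 2 * l))

/-- Projection along the `i₀`-th coordinate axis. -/
noncomputable def transverse (i₀ : Fin d) (x : 𝔼) : 𝔼 := x - EuclideanSpace.single i₀ (x i₀)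

theorem transverse_apply_self (i₀ : Fin d) (x : 𝔼) : transverse i₀ x i₀ = 0 := by
  simp [transverse]

theorem transverse_apply_of_ne {i₀ i : Fin d} (h : i ≠ i₀) (x : 𝔼) :
    transverse i₀ x i = x i := by
  simp [transverse, h]

theorem norm_transverse_le (i₀ : Fin d) (x : 𝔼) : ‖transverse i₀ x‖ ≤ ‖x‖ := by
  rw [EuclideanSpace.norm_eq, EuclideanSpace.norm_eq]
  refine Real.sqrt_le_sqrt (Finset.sum_le_sum fun i _ => ?_)
  by_cases h : i = i₀
  · subst h; rw [transverse_apply_self]; simp; positivity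
  · rw [transverse_apply_of_ne h]

theorem transverse_sub_single (i₀ : Fin d) (x : 𝔼) (t : ℝ) :
    transverse i₀ (x - EuclideanSpace.single i₀ t) = transverse i₀ x := by
  ext i
  by_cases h : i = i₀
  · subst h; simp [transverse_apply_self]
  · simp [transverse_apply_of_ne h, h]

theorem transverse_smul (i₀ : Fin d) (c : ℝ) (x : 𝔼) :
    transverse i₀ (c • x) = c • transverse i₀ x := by
  ext i
  by_cases h : i = i₀
  · subst h; simp [transverse_apply_self]
  · simp [transverse_apply_of_ne h]

theorem contDiff_transverse (i₀ : Fin d) : ContDiff ℝ ∞ (transverse i₀ : 𝔼 → 𝔼) := by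
  have : (transverse i₀ : 𝔼 → 𝔼) =
      fun x => x - (x i₀) • (EuclideanSpace.single i₀ (1 : ℝ) : 𝔼) := by
    ext x i
    simp [transverse]
  rw [this]
  fun_prop

/-- The inverse of the similarity of ratio `l` mapping the first Cantor generation to its half
with sign `b`. -/
noncomputable def expand (l : ℝ) (i₀ : Fin d) (b : Bool) (x : 𝔼) : 𝔼 :=
  l⁻¹ • (x - EuclideanSpace.single i₀ (sgn b * (1 - l)))

theorem expand_apply (l : ℝ) (i₀ : Fin d) (b : Bool) (x : 𝔼) :
    expand l i₀ b x i₀ = (x i₀ - sgn b * (1 - l)) / l := by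
  simp [expand]; ring

theorem transverse_expand (l : ℝ) (i₀ : Fin d) (b : Bool) (x : 𝔼) :
    transverse i₀ (expand l i₀ b x) = l⁻¹ • transverse i₀ x := by
  rw [expand, transverse_smul, transverse_sub_single]

theorem contDiff_expand (l : ℝ) (i₀ : Fin d) (b : Bool) :
    ContDiff ℝ ∞ (expand l i₀ b : 𝔼 → 𝔼) := by
  unfold expand; fun_prop

theorem mem_gapBall_cons {l : ℝ} (h0 : 0 < l) (i₀ : Fin d) {k : ℕ} (b : Bool)
    (w : Fin k → Bool) (x : 𝔼) :
    x ∈ gapBall l i₀ (Fin.cons b w : Fin (k + 1) → Bool) ↔ expand l i₀ b x ∈ gapBall l i₀ w := by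
  have e : expand l i₀ b x - EuclideanSpace.single i₀ (center l w) =
      l⁻¹ • (x - EuclideanSpace.single i₀ (center l (Fin.cons b w : Fin (k + 1) → Bool))) := by
    ext i
    by_cases h : i = i₀
    · subst h; simp [expand, center_cons]; field_simp; ring
    · simp [expand, h]
  rw [gapBall, gapBall, Metric.mem_ball, Metric.mem_ball, dist_eq_norm, dist_eq_norm, e, norm_smul,
    norm_inv, Real.norm_of_nonneg h0.le, inv_mul_lt_iff₀ h0, pow_succ]
  ring_nf

theorem abs_apply_le_norm (x : 𝔼) (i : Fin d) : |x i| ≤ ‖x‖ := by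
  simpa using PiLp.norm_apply_le x i

theorem abs_apply_sub_center_lt {l : ℝ} {i₀ : Fin d} {k : ℕ} {w : Fin k → Bool} {x : 𝔼}
    (hx : x ∈ gapBall l i₀ w) : |x i₀ - center l w| < l ^ k * (1 - 2 * l) := by
  rw [gapBall, Metric.mem_ball, dist_eq_norm] at hx
  refine lt_of_le_of_lt ?_ hx
  simpa using abs_apply_le_norm (x - EuclideanSpace.single i₀ (center l w)) i₀

theorem norm_transverse_lt_of_mem_gapBall {l : ℝ} {i₀ : Fin d} {k : ℕ} {w : Fin k → Bool} {x : 𝔼}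
    (hx : x ∈ gapBall l i₀ w) : ‖transverse i₀ x‖ < l ^ k * (1 - 2 * l) := by
  rw [gapBall, Metric.mem_ball, dist_eq_norm] at hx
  rw [← transverse_sub_single i₀ x (center l w)]
  exact (norm_transverse_le _ _).trans_lt hx

theorem disjoint_gapBall {l : ℝ} (h0 : 0 < l) (h1 : l < 1 / 2) (i₀ : Fin d) {k : ℕ}
    {w w' : Fin k → Bool} (h : w ≠ w') : Disjoint (gapBall l i₀ w) (gapBall l i₀ w') := by
  rw [Set.disjoint_left]
  intro x hx hx'
  have a := abs_apply_sub_center_lt hx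
  have b := abs_apply_sub_center_lt hx'
  have c := two_mul_pow_le_abs_center_sub h0 h1 h
  have e := abs_sub_le (center l w) (x i₀) (center l w')
  rw [abs_sub_comm (center l w) (x i₀)] at e
  have : 0 < l ^ k := by positivity
  nlinarith

theorem gapBall_subset_ball {l : ℝ} (h0 : 0 < l) (h1 : l < 1 / 2) (i₀ : Fin d) {k : ℕ}
    (w : Fin k → Bool) : gapBall l i₀ w ⊆ Metric.ball (0 : 𝔼) 1 := by
  refine Metric.ball_subset_ball' ?_
  rw [dist_zero_right, PiLp.norm_single, Real.norm_eq_abs]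
  have := abs_center_add_le h0 h1 w
  have : 0 < l ^ k := by positivity
  nlinarith

/-! ### Approximations of the Cantor function -/

/-- Smooth approximations of the Cantor function on `[-1, 1]`, which vanish to the left of this
interval and equal `1` to the right of it. Each step averages two copies scaled to the first two
intervals of the Cantor construction. -/
noncomputable def cantorApprox (l : ℝ) : ℕ → ℝ → ℝ
  | 0 => fun t => Real.smoothTransition ((t + 1) / 2)
  | k + 1 => fun t =>
      (cantorApprox l k ((t - sgn true * (1 - l)) / l) +
        cantorApprox l k ((t - sgn false * (1 - l)) / l)) / 2

theorem cantorApprox_succ (l : ℝ) (k : ℕ) (t : ℝ) : cantorApprox l (k + 1) t =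
    (cantorApprox l k ((t - sgn true * (1 - l)) / l) +
      cantorApprox l k ((t - sgn false * (1 - l)) / l)) / 2 := rfl

theorem contDiff_cantorApprox (l : ℝ) (k : ℕ) : ContDiff ℝ ∞ (cantorApprox l k) := by
  induction k with
  | zero =>
    exact Real.smoothTransition.contDiff.comp (by fun_prop : ContDiff ℝ ∞ fun t : ℝ => (t + 1) / 2)
  | succ k ih =>
    exact ((ih.comp ((contDiff_id.sub contDiff_const).div_const l)).add
      (ih.comp ((contDiff_id.sub contDiff_const).div_const l))).div_const 2

theorem cantorApprox_mem_Icc (l : ℝ) (k : ℕ) (t : ℝ) : cantorApprox l k t ∈ Icc (0 : ℝ) 1 := by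
  induction k generalizing t with
  | zero => exact ⟨Real.smoothTransition.nonneg _, Real.smoothTransition.le_one _⟩
  | succ k ih =>
    have a := ih ((t - sgn true * (1 - l)) / l)
    have b := ih ((t - sgn false * (1 - l)) / l)
    simp only [cantorApprox, mem_Icc] at *
    constructor <;> linarith

theorem cantorApprox_of_le {l : ℝ} (h0 : 0 < l) (h1 : l < 1 / 2) (k : ℕ) {t : ℝ} (ht : t ≤ -1) :
    cantorApprox l k t = 0 := by
  induction k generalizing t with
  | zero => exact Real.smoothTransition.zero_of_nonpos (by linarith)
  | succ k ih =>
    simp only [cantorApprox, sgn]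
    rw [ih (by rw [div_le_iff₀ h0]; norm_num; linarith),
      ih (by rw [div_le_iff₀ h0]; norm_num; linarith)]
    simp

theorem cantorApprox_of_ge {l : ℝ} (h0 : 0 < l) (h1 : l < 1 / 2) (k : ℕ) {t : ℝ} (ht : 1 ≤ t) :
    cantorApprox l k t = 1 := by
  induction k generalizing t with
  | zero => exact Real.smoothTransition.one_of_one_le (by linarith)
  | succ k ih =>
    simp only [cantorApprox, sgn]
    rw [ih (by rw [le_div_iff₀ h0]; norm_num; linarith),
      ih (by rw [le_div_iff₀ h0]; norm_num; linarith)]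
    simp

/-- After the generation in which a gap appears, the approximations are constant on it. -/
theorem exists_cantorApprox_eq_on_gap {l : ℝ} (h0 : 0 < l) (h1 : l < 1 / 2) {k : ℕ}
    (w : Fin k → Bool) :
    ∃ c, ∀ t, |t - center l w| < l ^ k * (1 - 2 * l) → cantorApprox l (k + 1) t = c := by
  induction k with
  | zero =>
    refine ⟨1 / 2, fun t ht => ?_⟩
    simp only [center, Finset.univ_eq_empty, Finset.sum_empty, sub_zero, pow_zero, one_mul,
      abs_lt] at ht
    rw [cantorApprox_succ, cantorApprox_of_le h0 h1 0 (by
        rw [div_le_iff₀ h0]; simp [sgn]; linarith [ht.2]),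
      cantorApprox_of_ge h0 h1 0 (by rw [le_div_iff₀ h0]; simp [sgn]; linarith [ht.1])]
    norm_num
  | succ k ih =>
    rw [← Fin.cons_self_tail w]
    generalize w 0 = b
    generalize Fin.tail w = w'
    obtain ⟨c, hc⟩ := ih w'
    have hw := abs_center_add_le h0 h1 w'
    have hlk : 0 < l ^ k := by positivity
    have hlk1 : 0 < l ^ (k + 1) := by positivity
    have hlkk : l ^ (k + 1) = l * l ^ k := by ring
    -- the branch through `b` sees the gap of the shorter word
    have hmain : ∀ t, |t - center l (Fin.cons b w' : Fin (k + 1) → Bool)| <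
        l ^ (k + 1) * (1 - 2 * l) →
        cantorApprox l (k + 1) ((t - sgn b * (1 - l)) / l) = c := by
      intro t ht
      refine hc _ ?_
      rw [show (t - sgn b * (1 - l)) / l - center l w' =
        (t - center l (Fin.cons b w' : Fin (k + 1) → Bool)) / l by
          rw [center_cons]; field_simp; ring, abs_div, abs_of_pos h0, div_lt_iff₀ h0]
      calc _ < _ := ht
        _ = _ := by ring
    have hb : ∀ t, |t - center l (Fin.cons b w' : Fin (k + 1) → Bool)| <
        l ^ (k + 1) * (1 - 2 * l) → |t - sgn b * (1 - l)| < l := by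
      intro t ht
      rw [center_cons] at ht
      have := abs_sub_le (t - sgn b * (1 - l)) (l * center l w') 0
      rw [sub_zero, sub_zero, abs_mul, abs_of_pos h0, sub_sub] at this
      have h6 := mul_le_mul_of_nonneg_left hw h0.le
      nlinarith
    cases b with
    | true =>
      refine ⟨(c + 1) / 2, fun t ht => ?_⟩
      rw [cantorApprox_succ, hmain t ht, cantorApprox_of_ge h0 h1]
      have := abs_lt.1 (hb t ht)
      simp only [sgn, if_true] at this
      rw [le_div_iff₀ h0]; simp [sgn]; linarith [this.1]
    | false =>
      refine ⟨(0 + c) / 2, fun t ht => ?_⟩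
      rw [cantorApprox_succ, hmain t ht, cantorApprox_of_le h0 h1]
      have := abs_lt.1 (hb t ht)
      simp [sgn] at this
      rw [div_le_iff₀ h0]; simp [sgn]; linarith [this.2]

/-! ### The competitor -/

/-- The `k`-th correction of the competitor: the difference of two consecutive approximations of
the Cantor function, cut off at distance of order `l ^ k` from the axis. -/
noncomputable def correction (l : ℝ) (i₀ : Fin d) : ℕ → 𝔼 → ℝ
  | 0 => fun x => (cantorApprox l 1 (x i₀) - cantorApprox l 0 (x i₀)) *
      Real.smoothTransition ((1 - ‖transverse i₀ x‖ ^ 2) / (1 - (1 - 2 * l) ^ 2))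
  | k + 1 => fun x =>
      (correction l i₀ k (expand l i₀ true x) + correction l i₀ k (expand l i₀ false x)) / 2

theorem correction_succ (l : ℝ) (i₀ : Fin d) (k : ℕ) (x : 𝔼) : correction l i₀ (k + 1) x =
    (correction l i₀ k (expand l i₀ true x) + correction l i₀ k (expand l i₀ false x)) / 2 := rfl

theorem contDiff_apply_coord (i₀ : Fin d) : ContDiff ℝ ∞ fun x : 𝔼 => x i₀ := by fun_prop

theorem contDiff_correction (l : ℝ) (i₀ : Fin d) (k : ℕ) :
    ContDiff ℝ ∞ (correction l i₀ k) := by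
  induction k with
  | zero =>
    refine ContDiff.mul (((contDiff_cantorApprox l 1).comp (contDiff_apply_coord i₀)).sub
      ((contDiff_cantorApprox l 0).comp (contDiff_apply_coord i₀))) ?_
    exact Real.smoothTransition.contDiff.comp
      ((contDiff_const.sub ((contDiff_transverse i₀).norm_sq ℝ)).div_const _)
  | succ k ih =>
    exact ((ih.comp (contDiff_expand l i₀ true)).add
      (ih.comp (contDiff_expand l i₀ false))).div_const 2

/-- The open cylinder of radius `1` around the segment of length `2` on the `i₀`-th axis. -/
def cylinder (i₀ : Fin d) : Set 𝔼 := {x | |x i₀| < 1 ∧ ‖transverse i₀ x‖ < 1}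

theorem cylinder_subset_cube (i₀ : Fin d) : cylinder i₀ ⊆ cube d 1 := by
  intro x hx i
  by_cases h : i = i₀
  · rw [h]; exact hx.1
  · rw [← transverse_apply_of_ne h]
    exact (abs_apply_le_norm _ _).trans_lt hx.2

theorem cylinder_subset_ball (i₀ : Fin d) : cylinder i₀ ⊆ Metric.ball (0 : 𝔼) 2 := by
  intro x hx
  have e : x = transverse i₀ x + EuclideanSpace.single i₀ (x i₀) := by simp [transverse]
  have h := norm_add_le (transverse i₀ x) (EuclideanSpace.single i₀ (x i₀))
  rw [← e, PiLp.norm_single, Real.norm_eq_abs] at h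
  rw [mem_ball_zero_iff]
  linarith [hx.1, hx.2]

theorem cylinder_of_expand {l : ℝ} (h0 : 0 < l) (h1 : l < 1 / 2) {i₀ : Fin d} {b : Bool} {x : 𝔼}
    (h : expand l i₀ b x ∈ cylinder i₀) : x ∈ cylinder i₀ := by
  obtain ⟨ha, ht⟩ := h
  rw [expand_apply, abs_div, abs_of_pos h0, div_lt_one h0] at ha
  rw [transverse_expand, norm_smul, norm_inv, Real.norm_of_nonneg h0.le,
    inv_mul_lt_iff₀ h0] at ht
  refine ⟨?_, by linarith⟩
  have := abs_sub_le (x i₀) (sgn b * (1 - l)) 0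
  rw [sub_zero, sub_zero, abs_mul, abs_sgn, abs_of_pos (by linarith : 0 < 1 - l)] at this
  linarith

theorem mem_cylinder_of_correction_ne_zero {l : ℝ} (h0 : 0 < l) (h1 : l < 1 / 2) {i₀ : Fin d}
    {k : ℕ} {x : 𝔼} (h : correction l i₀ k x ≠ 0) : x ∈ cylinder i₀ := by
  induction k generalizing x with
  | zero =>
    rw [correction, mul_ne_zero_iff] at h
    constructor
    · by_contra hc
      rw [not_lt, le_abs] at hc
      rcases hc with hc | hc
      · exact h.1 (by rw [cantorApprox_of_ge h0 h1 _ hc, cantorApprox_of_ge h0 h1 _ hc, sub_self])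
      · exact h.1 (by rw [cantorApprox_of_le h0 h1 _ (by linarith),
          cantorApprox_of_le h0 h1 _ (by linarith), sub_self])
    · by_contra hc
      rw [not_lt] at hc
      refine h.2 (Real.smoothTransition.zero_of_nonpos (div_nonpos_of_nonpos_of_nonneg ?_ ?_))
      · nlinarith
      · nlinarith
  | succ k ih =>
    rw [correction_succ] at h
    by_cases ht : correction l i₀ k (expand l i₀ true x) = 0
    · refine cylinder_of_expand h0 h1 (ih (x := expand l i₀ false x) fun hf => h ?_)
      rw [ht, hf]; norm_num
    · exact cylinder_of_expand h0 h1 (ih ht)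

/-- The two halves of a correction have disjoint supports, so that only one of them is seen near any
given point. -/
theorem eventually_correction_succ_eq {l : ℝ} (h0 : 0 < l) (h1 : l < 1 / 2) (i₀ : Fin d) (k : ℕ)
    (x : 𝔼) : ∃ b, ∀ᶠ y in nhds x,
      correction l i₀ (k + 1) y = correction l i₀ k (expand l i₀ b y) / 2 := by
  have hc : Continuous fun y : 𝔼 => y i₀ := (contDiff_apply_coord i₀).continuous
  rcases le_total 0 (x i₀) with hx | hx
  · refine ⟨true, ?_⟩
    have : ∀ᶠ y : 𝔼 in nhds x, -(1 - 2 * l) < y i₀ :=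
      hc.continuousAt.eventually (lt_mem_nhds (by linarith))
    filter_upwards [this] with y hy
    rw [correction_succ]
    suffices h : correction l i₀ k (expand l i₀ false y) = 0 by rw [h, add_zero]
    by_contra h
    have h' := (mem_cylinder_of_correction_ne_zero h0 h1 h).1
    rw [expand_apply, abs_lt, div_lt_one h0] at h'
    have := h'.2
    simp [sgn] at this
    linarith
  · refine ⟨false, ?_⟩
    have : ∀ᶠ y : 𝔼 in nhds x, y i₀ < 1 - 2 * l :=
      hc.continuousAt.eventually (gt_mem_nhds (by linarith))
    filter_upwards [this] with y hy
    rw [correction_succ]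
    suffices h : correction l i₀ k (expand l i₀ true y) = 0 by rw [h, zero_add]
    by_contra h
    have h' := (mem_cylinder_of_correction_ne_zero h0 h1 h).1
    rw [expand_apply, abs_lt, lt_div_iff₀ h0] at h'
    have := h'.1
    simp [sgn] at this
    linarith

theorem abs_correction_le {l : ℝ} (h0 : 0 < l) (h1 : l < 1 / 2) (i₀ : Fin d) (k : ℕ) (x : 𝔼) :
    |correction l i₀ k x| ≤ (1 / 2) ^ k := by
  induction k generalizing x with
  | zero =>
    rw [correction, abs_mul, pow_zero]
    have a := cantorApprox_mem_Icc l 1 (x i₀)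
    have b := cantorApprox_mem_Icc l 0 (x i₀)
    refine mul_le_one₀ (abs_le.2 ⟨by linarith [a.1, b.2], by linarith [a.2, b.1]⟩)
      (abs_nonneg _) ?_
    rw [abs_of_nonneg (Real.smoothTransition.nonneg _)]
    exact Real.smoothTransition.le_one _
  | succ k ih =>
    obtain ⟨b, hb⟩ := eventually_correction_succ_eq h0 h1 i₀ k x
    rw [hb.self_of_nhds, abs_div, abs_two, pow_succ]
    linarith [ih (expand l i₀ b x)]

theorem hasCompactSupport_correction {l : ℝ} (h0 : 0 < l) (h1 : l < 1 / 2) (i₀ : Fin d) (k : ℕ) :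
    HasCompactSupport (correction l i₀ k) := by
  refine HasCompactSupport.of_support_subset_isCompact (isCompact_closedBall (0 : 𝔼) 2) ?_
  intro x hx
  exact Metric.ball_subset_closedBall
    (cylinder_subset_ball i₀ (mem_cylinder_of_correction_ne_zero h0 h1 hx))

/-- Each generation halves the height and contracts by `l`, so that slopes grow by `(2 l)⁻¹`. -/
theorem exists_norm_fderiv_correction_le {l : ℝ} (h0 : 0 < l) (h1 : l < 1 / 2) (i₀ : Fin d) :
    ∃ L : ℝ, 0 ≤ L ∧ ∀ k x, ‖fderiv ℝ (correction l i₀ k) x‖ ≤ L * ((2 * l)⁻¹) ^ k := by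
  obtain ⟨L, hL⟩ := ((hasCompactSupport_correction h0 h1 i₀ 0).fderiv
    (𝕜 := ℝ)).exists_bound_of_continuous ((contDiff_correction l i₀ 0).continuous_fderiv (by simp))
  refine ⟨L, (norm_nonneg _).trans (hL 0), fun k => ?_⟩
  induction k with
  | zero => simpa using hL
  | succ k ih =>
    intro x
    obtain ⟨b, hb⟩ := eventually_correction_succ_eq h0 h1 i₀ k x
    have he : HasFDerivAt (expand l i₀ b) (l⁻¹ • ContinuousLinearMap.id ℝ 𝔼) x :=
      ((hasFDerivAt_id x).sub_const _).const_smul l⁻¹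
    have hd := (((contDiff_correction l i₀ k).differentiable (by simp)
      (expand l i₀ b x)).hasFDerivAt.comp x he).const_mul (1 / 2)
    have hd' : HasFDerivAt (correction l i₀ (k + 1)) ((1 / 2 : ℝ) •
        (fderiv ℝ (correction l i₀ k) (expand l i₀ b x)).comp
          (l⁻¹ • ContinuousLinearMap.id ℝ 𝔼)) x := by
      refine hd.congr_of_eventuallyEq ?_
      filter_upwards [hb] with y hy
      rw [hy, Function.comp_apply]; ring
    rw [hd'.fderiv, ContinuousLinearMap.comp_smul, ContinuousLinearMap.comp_id, norm_smul,
      norm_smul, norm_inv, Real.norm_of_nonneg h0.le, Real.norm_of_nonneg (by norm_num), pow_succ,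
      mul_inv]
    have := ih (expand l i₀ b x)
    calc 1 / 2 * (l⁻¹ * ‖fderiv ℝ (correction l i₀ k) (expand l i₀ b x)‖)
        ≤ 1 / 2 * (l⁻¹ * (L * (2 * l)⁻¹ ^ k)) := by gcongr
      _ = _ := by rw [mul_inv]; ring

/-- The support of the `k`-th correction consists of `2 ^ k` copies scaled by `l ^ k`. -/
theorem volume_tsupport_correction_le {l : ℝ} (h0 : 0 < l) (i₀ : Fin d) (k : ℕ) :
    volume (tsupport (correction l i₀ k)) ≤
      ENNReal.ofReal ((2 * l ^ d) ^ k) * volume (tsupport (correction l i₀ 0)) := by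
  induction k with
  | zero => simp
  | succ k ih =>
    have hce : ∀ b, Continuous (expand l i₀ b) := fun b => (contDiff_expand l i₀ b).continuous
    have hsub : tsupport (correction l i₀ (k + 1)) ⊆
        expand l i₀ true ⁻¹' tsupport (correction l i₀ k) ∪
          expand l i₀ false ⁻¹' tsupport (correction l i₀ k) := by
      refine closure_minimal ?_ (((isClosed_tsupport _).preimage (hce _)).union
        ((isClosed_tsupport _).preimage (hce _)))
      intro x hx
      by_contra hc
      simp only [mem_union, mem_preimage, not_or] at hc
      refine hx ?_
      rw [correction_succ, image_eq_zero_of_notMem_tsupport hc.1,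
        image_eq_zero_of_notMem_tsupport hc.2]
      norm_num
    have hvol : ∀ b, volume (expand l i₀ b ⁻¹' tsupport (correction l i₀ k)) =
        ENNReal.ofReal (l ^ d) * volume (tsupport (correction l i₀ k)) := by
      intro b
      have e : expand l i₀ b ⁻¹' tsupport (correction l i₀ k) =
          (fun x : 𝔼 => x - EuclideanSpace.single i₀ (sgn b * (1 - l))) ⁻¹'
            ((fun x : 𝔼 => l⁻¹ • x) ⁻¹' tsupport (correction l i₀ k)) := rfl
      simp only [sub_eq_add_neg] at e
      rw [e, measure_preimage_add_right, Measure.addHaar_preimage_smul _ (inv_ne_zero h0.ne'),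
        finrank_euclideanSpace_fin, inv_pow, inv_inv, abs_of_pos (by positivity)]
    calc _ ≤ _ := measure_mono hsub
      _ ≤ _ := measure_union_le _ _
      _ = ENNReal.ofReal (2 * l ^ d) * volume (tsupport (correction l i₀ k)) := by
        rw [hvol, hvol, ← add_mul, ← ENNReal.ofReal_add (by positivity) (by positivity)]
        ring_nf
      _ ≤ ENNReal.ofReal (2 * l ^ d) * (ENNReal.ofReal ((2 * l ^ d) ^ k) *
          volume (tsupport (correction l i₀ 0))) := by gcongr
      _ = _ := by
        rw [← mul_assoc, ← ENNReal.ofReal_mul (by positivity), pow_succ]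
        ring_nf

/-- Near the axis the cut-off is not seen, so that sums of corrections telescope. -/
theorem correction_eq_sub {l : ℝ} (h0 : 0 < l) (h1 : l < 1 / 2) (i₀ : Fin d) {k : ℕ} {x : 𝔼}
    (h : ‖transverse i₀ x‖ ≤ l ^ k * (1 - 2 * l)) :
    correction l i₀ k x = cantorApprox l (k + 1) (x i₀) - cantorApprox l k (x i₀) := by
  induction k generalizing x with
  | zero =>
    rw [pow_zero, one_mul] at h
    simp only [correction]
    rw [Real.smoothTransition.one_of_one_le, mul_one]
    have : 0 < 1 - (1 - 2 * l) ^ 2 := by nlinarith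
    rw [le_div_iff₀ this, one_mul]
    have := norm_nonneg (transverse i₀ x)
    gcongr
  | succ k ih =>
    have hb : ∀ b, ‖transverse i₀ (expand l i₀ b x)‖ ≤ l ^ k * (1 - 2 * l) := by
      intro b
      rw [transverse_expand, norm_smul, norm_inv, Real.norm_of_nonneg h0.le, inv_mul_le_iff₀ h0]
      calc _ ≤ _ := h
        _ = _ := by ring
    rw [correction_succ, ih (hb _), ih (hb _), cantorApprox_succ l (k + 1) (x i₀),
      cantorApprox_succ l k (x i₀),
      expand_apply, expand_apply]
    ring

/-- Corrections of later generations are supported near the remaining intervals, hence away from the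
gap balls of earlier ones. -/
theorem correction_eq_zero_of_mem_gapBall {l : ℝ} (h0 : 0 < l) (h1 : l < 1 / 2) {i₀ : Fin d}
    {k : ℕ} {w : Fin k → Bool} {x : 𝔼} (hx : x ∈ gapBall l i₀ w) (m : ℕ) :
    correction l i₀ (m + k + 1) x = 0 := by
  induction k generalizing x with
  | zero =>
    have h := abs_apply_sub_center_lt hx
    simp only [center, Finset.univ_eq_empty, Finset.sum_empty, sub_zero, pow_zero, one_mul,
      abs_lt] at h
    have hz : ∀ b, correction l i₀ m (expand l i₀ b x) = 0 := by
      intro b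
      by_contra hc
      have h' := (mem_cylinder_of_correction_ne_zero h0 h1 hc).1
      rw [expand_apply, abs_div, abs_of_pos h0, div_lt_one h0, abs_lt] at h'
      cases b
      · simp [sgn] at h'; linarith
      · simp [sgn] at h'; linarith
    rw [Nat.add_zero, correction_succ, hz, hz]
    norm_num
  | succ k ih =>
    rw [← Fin.cons_self_tail w] at hx
    rw [← add_assoc, correction_succ, add_assoc]
    have hx' := (mem_gapBall_cons h0 i₀ _ _ _).1 hx
    have hz := ih hx'
    have ho : correction l i₀ (m + (k + 1)) (expand l i₀ (!(w 0)) x) = 0 := by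
      by_contra hc
      have h' := (mem_cylinder_of_correction_ne_zero h0 h1 hc).1
      rw [expand_apply, abs_div, abs_of_pos h0, div_lt_one h0, abs_lt] at h'
      have h2 := abs_apply_sub_center_lt hx'
      have h3 := abs_center_add_le h0 h1 (Fin.tail w)
      have h4 : |expand l i₀ (w 0) x i₀| < 1 := by
        have := abs_sub_le (expand l i₀ (w 0) x i₀) (center l (Fin.tail w)) 0
        rw [sub_zero, sub_zero] at this
        have : 0 < l ^ k := by positivity
        nlinarith
      rw [expand_apply, abs_div, abs_of_pos h0, div_lt_one h0, abs_lt] at h4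
      revert h4 h'
      cases w 0
      · simp [sgn]; intros; linarith
      · simp [sgn]; intros; linarith
    rw [add_assoc] at hz
    cases hw : w 0
    · rw [hw] at hz ho
      simp only [Bool.not_false] at ho
      rw [ho, hz]; norm_num
    · rw [hw] at hz ho
      simp only [Bool.not_true] at ho
      rw [ho, hz]; norm_num

/-- The boundary datum: a smooth transition from `0` to `1` along the `i₀`-th axis, cut off
outside the unit ball. -/
noncomputable def datum (i₀ : Fin d) (x : 𝔼) : ℝ :=
  Real.smoothTransition (2 - ‖x‖ ^ 2) * Real.smoothTransition ((x i₀ + 1) / 2)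

theorem contDiff_datum (i₀ : Fin d) : ContDiff ℝ ∞ (datum i₀ : 𝔼 → ℝ) :=
  (Real.smoothTransition.contDiff.comp (contDiff_const.sub (contDiff_norm_sq ℝ))).mul
    (Real.smoothTransition.contDiff.comp
      (((contDiff_apply_coord i₀).add contDiff_const).div_const 2))

theorem datum_eq_zero (i₀ : Fin d) {x : 𝔼} (hx : 2 ≤ ‖x‖) : datum i₀ x = 0 := by
  rw [datum, Real.smoothTransition.zero_of_nonpos (by nlinarith), zero_mul]

theorem datum_eq (l : ℝ) (i₀ : Fin d) {x : 𝔼} (hx : ‖x‖ ≤ 1) :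
    datum i₀ x = cantorApprox l 0 (x i₀) := by
  rw [datum, Real.smoothTransition.one_of_one_le (by nlinarith [norm_nonneg x]), one_mul]
  rfl

theorem hasCompactSupport_datum (i₀ : Fin d) : HasCompactSupport (datum i₀ : 𝔼 → ℝ) := by
  refine HasCompactSupport.of_support_subset_isCompact (isCompact_closedBall (0 : 𝔼) 2) ?_
  intro x hx
  rw [mem_closedBall_zero_iff]
  by_contra hc
  exact hx (datum_eq_zero i₀ (not_le.1 hc).le)

theorem ball_subset_cube_three : Metric.ball (0 : 𝔼) 2 ⊆ cube d 3 := by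
  intro x hx i
  rw [mem_ball_zero_iff] at hx
  linarith [abs_apply_le_norm x i]

theorem isBoundaryDatum_datum (i₀ : Fin d) : IsBoundaryDatum (datum i₀ : 𝔼 → ℝ) := by
  refine ⟨contDiff_datum i₀, fun x hx => datum_eq_zero i₀ ?_⟩
  by_contra hc
  exact hx (ball_subset_cube_three (by rw [mem_ball_zero_iff]; linarith))

/-- On a gap ball, the datum and the corrections add up to a constant after finitely many terms. -/
theorem exists_datum_add_sum_correction_eq {l : ℝ} (h0 : 0 < l) (h1 : l < 1 / 2) (i₀ : Fin d)
    {k : ℕ} (w : Fin k → Bool) : ∃ c, ∀ x ∈ gapBall l i₀ w,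
      datum i₀ x + ∑ j ∈ Finset.range (k + 1), correction l i₀ j x = c := by
  obtain ⟨c, hc⟩ := exists_cantorApprox_eq_on_gap h0 h1 w
  refine ⟨c, fun x hx => ?_⟩
  have hx1 := mem_ball_zero_iff.1 (gapBall_subset_ball h0 h1 i₀ w hx)
  have e : ∀ j ∈ Finset.range (k + 1), correction l i₀ j x =
      cantorApprox l (j + 1) (x i₀) - cantorApprox l j (x i₀) := by
    intro j hj
    refine correction_eq_sub h0 h1 i₀ ((norm_transverse_lt_of_mem_gapBall hx).le.trans ?_)
    have : 0 ≤ 1 - 2 * l := by linarith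
    have : l ^ k ≤ l ^ j := pow_le_pow_of_le_one h0.le (by linarith)
      (Nat.lt_succ_iff.1 (Finset.mem_range.1 hj))
    gcongr
  rw [Finset.sum_congr rfl e, Finset.sum_range_sub (fun j => cantorApprox l j (x i₀)),
    datum_eq l i₀ hx1.le, add_sub_cancel, hc _ (abs_apply_sub_center_lt hx)]

theorem summable_correction {l : ℝ} (h0 : 0 < l) (h1 : l < 1 / 2) (i₀ : Fin d) (x : 𝔼) :
    Summable fun k => correction l i₀ k x :=
  Summable.of_norm_bounded (summable_geometric_of_lt_one (by norm_num) (by norm_num))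
    fun k => abs_correction_le h0 h1 i₀ k x

/-- The competitor: on the axis it is the Cantor function of the coordinate `i₀`, and it is
constant on every gap ball. -/
noncomputable def competitor (l : ℝ) (i₀ : Fin d) : 𝔼 → ℝ :=
  datum i₀ + fun x => ∑' k, correction l i₀ k x

theorem tsum_eq_sum_on_gapBall {F : Type*} [NormedAddCommGroup F] {k : ℕ} {a : ℕ → F}
    (h : ∀ m, a (m + k + 1) = 0) : ∑' j, a j = ∑ j ∈ Finset.range (k + 1), a j := by
  refine tsum_eq_sum fun j hj => ?_
  rw [Finset.mem_range, not_lt] at hj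
  obtain ⟨m, rfl⟩ := Nat.exists_eq_add_of_le hj
  rw [show k + 1 + m = m + k + 1 by ring]
  exact h m

theorem exists_competitor_eq {l : ℝ} (h0 : 0 < l) (h1 : l < 1 / 2) (i₀ : Fin d)
    {k : ℕ} (w : Fin k → Bool) : ∃ c, ∀ x ∈ gapBall l i₀ w, competitor l i₀ x = c := by
  obtain ⟨c, hc⟩ := exists_datum_add_sum_correction_eq h0 h1 i₀ w
  refine ⟨c, fun x hx => ?_⟩
  rw [← hc x hx, competitor, Pi.add_apply,
    tsum_eq_sum_on_gapBall fun m => correction_eq_zero_of_mem_gapBall h0 h1 hx m]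

/-- The termwise gradient of the competitor. -/
noncomputable def competitorGradient (l : ℝ) (i₀ : Fin d) : 𝔼 → 𝔼 :=
  gradient (datum i₀) + fun x => ∑' k, gradient (correction l i₀ k) x

theorem competitorGradient_eq_zero {l : ℝ} (h0 : 0 < l) (h1 : l < 1 / 2) {i₀ : Fin d}
    {k : ℕ} {w : Fin k → Bool} {x : 𝔼} (hx : x ∈ gapBall l i₀ w) :
    competitorGradient l i₀ x = 0 := by
  obtain ⟨c, hc⟩ := exists_datum_add_sum_correction_eq h0 h1 i₀ w
  have hopen : gapBall l i₀ w ∈ nhds x := Metric.isOpen_ball.mem_nhds hx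
  have hz : ∀ m, gradient (correction l i₀ (m + k + 1)) x = 0 := by
    intro m
    have : correction l i₀ (m + k + 1) =ᶠ[nhds x] fun _ => (0 : ℝ) := by
      filter_upwards [hopen] with y hy
      exact correction_eq_zero_of_mem_gapBall h0 h1 hy m
    rw [this.gradient_eq]
    exact gradient_fun_const x 0
  have hd : DifferentiableAt ℝ (datum i₀) x := (contDiff_datum i₀).differentiable (by simp) x
  have hd' : ∀ j, DifferentiableAt ℝ (correction l i₀ j) x := fun j =>
    (contDiff_correction l i₀ j).differentiable (by simp) x
  have hconst : (fun y => datum i₀ y + ∑ j ∈ Finset.range (k + 1), correction l i₀ j y)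
      =ᶠ[nhds x] fun _ => c := by
    filter_upwards [hopen] with y hy
    exact hc y hy
  have h2 := hconst.fderiv_eq (𝕜 := ℝ)
  rw [fderiv_fun_add hd (DifferentiableAt.fun_sum fun j _ => hd' j),
    fderiv_fun_sum fun j _ => hd' j, fderiv_const_apply] at h2
  rw [competitorGradient, Pi.add_apply, tsum_eq_sum_on_gapBall hz]
  simp only [gradient]
  rw [← map_sum (InnerProductSpace.toDual ℝ 𝔼).symm, ← map_add, h2, map_zero]

/-! ### Energy of the competitor -/

/-- The ratio by which the `W^{s,p}` energies of consecutive corrections decay: there are twice as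
many pieces, of half the height, at scale `l` instead of `1`. -/
noncomputable def energyRatio (d : ℕ) (s p l : ℝ) : ℝ :=
  2 * l ^ d * ((1 / 2) ^ p * l ^ (-(s * p)))

theorem energyRatio_pos (d : ℕ) (s p : ℝ) {l : ℝ} (h0 : 0 < l) : 0 < energyRatio d s p l := by
  unfold energyRatio; positivity

theorem energyRatio_pow (d : ℕ) (s p : ℝ) {l : ℝ} (h0 : 0 < l) (k : ℕ) :
    (((1 / 2 : ℝ) ^ k) ^ p * (l ^ k) ^ (-(s * p))) * (2 * l ^ d) ^ k = energyRatio d s p l ^ k := by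
  unfold energyRatio
  rw [mul_pow _ (_ * _), mul_pow ((1 / 2 : ℝ) ^ p), ← Real.rpow_natCast_mul (by norm_num),
    ← Real.rpow_mul_natCast (by norm_num), ← Real.rpow_natCast_mul h0.le,
    ← Real.rpow_mul_natCast h0.le, mul_comm (k : ℝ) p, mul_comm (k : ℝ)]
  ring

theorem norm_gradient (f : 𝔼 → ℝ) (x : 𝔼) : ‖gradient f x‖ = ‖fderiv ℝ f x‖ := by
  rw [← toDual_gradient, LinearIsometryEquiv.norm_map]

theorem continuous_gradient {f : 𝔼 → ℝ} (hf : ContDiff ℝ 1 f) : Continuous (gradient f) :=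
  (InnerProductSpace.toDual ℝ 𝔼).symm.continuous.comp (hf.continuous_fderiv (by simp))

theorem gradient_eq_zero_of_notMem_tsupport {f : 𝔼 → ℝ} {x : 𝔼} (hx : x ∉ tsupport f) :
    gradient f x = 0 := by
  rw [← norm_eq_zero, norm_gradient, norm_eq_zero]
  by_contra h
  exact hx (support_fderiv_subset ℝ h)

theorem abs_sub_le_min_of_bounds {f : 𝔼 → ℝ} (hf : Differentiable ℝ f) {M L A l : ℝ} (hl : 0 < l)
    (hM : ∀ x, |f x| ≤ M) (hL : ∀ x, ‖fderiv ℝ f x‖ ≤ L) (h1 : 2 * M ≤ A) (h2 : L * l ≤ A)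
    (x y : 𝔼) : |f x - f y| ≤ A * min 1 (‖x - y‖ / l) := by
  have hA : 0 ≤ A := by
    have := (abs_nonneg _).trans (hM 0)
    linarith
  rw [mul_min_of_nonneg _ _ hA, mul_one]
  refine le_min ?_ ?_
  · have := abs_sub (f x) (f y)
    linarith [hM x, hM y]
  · have h3 := convex_univ.norm_image_sub_le_of_norm_fderiv_le (𝕜 := ℝ)
      (fun z _ => hf z) (fun z _ => hL z) (mem_univ y) (mem_univ x)
    rw [Real.norm_eq_abs] at h3
    refine h3.trans ?_
    rw [mul_div_assoc', le_div_iff₀ hl]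
    calc L * ‖x - y‖ * l = L * l * ‖x - y‖ := by ring
      _ ≤ _ := by gcongr

theorem nonlocalPhase_lt_top_of_contDiff (hd : 1 ≤ d) {s p : ℝ} (hs : 0 < s) (hs1 : s < 1)
    (hp : 1 < p) {k : 𝔼 → 𝔼 → ℝ} {B : ℝ} (hk0 : ∀ x y, 0 ≤ k x y) (hkB : ∀ x y, k x y ≤ B)
    {f : 𝔼 → ℝ} (hf : ContDiff ℝ 1 f) (hc : HasCompactSupport f) :
    nonlocalPhase s p k f < ⊤ := by
  obtain ⟨M, hM⟩ := hc.exists_bound_of_continuous hf.continuous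
  obtain ⟨L, hL⟩ := (hc.fderiv (𝕜 := ℝ)).exists_bound_of_continuous
    (hf.continuous_fderiv (by simp))
  have hM0 := (norm_nonneg _).trans (hM 0)
  refine (nonlocalPhase_le_of_support hd hs hs1 hp hk0 hkB (isClosed_tsupport f).measurableSet
    (fun x hx => image_eq_zero_of_notMem_tsupport hx) (A := max (2 * M) L)
    (le_max_of_le_left (by positivity)) one_pos (abs_sub_le_min_of_bounds
      (hf.differentiable (by simp)) one_pos hM hL (le_max_left _ _)
      (by rw [mul_one]; exact le_max_right _ _))).trans_lt ?_
  exact ENNReal.mul_lt_top ENNReal.ofReal_lt_top hc.measure_lt_top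

theorem lintegral_gradient_le (p : ℝ) (hp : 1 < p) {f w : 𝔼 → ℝ} {L B : ℝ}
    (hL : ∀ x, ‖gradient f x‖ ≤ L) (hw : ∀ x, 0 ≤ w x) (hwB : ∀ x, w x ≤ B) (S : Set 𝔼) :
    ∫⁻ x in S, ENNReal.ofReal (1 / p * w x * ‖gradient f x‖ ^ p) ≤
      ENNReal.ofReal (1 / p * B * L ^ p) * volume (tsupport f) := by
  have hm : MeasurableSet (tsupport f) := (isClosed_tsupport f).measurableSet
  have hp0 : 0 < p := by linarith
  have hB : 0 ≤ B := (hw 0).trans (hwB 0)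
  calc _ ≤ ∫⁻ x, ENNReal.ofReal (1 / p * w x * ‖gradient f x‖ ^ p) := setLIntegral_le_lintegral _ _
    _ ≤ ∫⁻ x, (tsupport f).indicator (fun _ => ENNReal.ofReal (1 / p * B * L ^ p)) x := by
      refine lintegral_mono fun x => ?_
      by_cases hx : x ∈ tsupport f
      · rw [indicator_of_mem hx]
        refine ENNReal.ofReal_le_ofReal ?_
        have := hL x
        have := hwB x
        gcongr
      · rw [gradient_eq_zero_of_notMem_tsupport hx]
        simp [Real.zero_rpow hp0.ne']
    _ = _ := by rw [lintegral_indicator hm]; simp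

theorem localPhase_lt_top_of_contDiff {p : ℝ} (hp : 1 < p) {w : 𝔼 → ℝ} {B : ℝ}
    (hw : ∀ x, 0 ≤ w x) (hwB : ∀ x, w x ≤ B) {f : 𝔼 → ℝ} (hf : ContDiff ℝ 1 f)
    (hc : HasCompactSupport f) : localPhase p w f < ⊤ := by
  obtain ⟨L, hL⟩ := (hc.fderiv (𝕜 := ℝ)).exists_bound_of_continuous
    (hf.continuous_fderiv (by simp))
  rw [localPhase_eq_of_contDiff p w hf]
  refine (lintegral_gradient_le p hp (L := L) (fun x => ?_) hw hwB _).trans_lt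
    (ENNReal.mul_lt_top ENNReal.ofReal_lt_top hc.measure_lt_top)
  rw [norm_gradient]; exact hL x

theorem volume_tsupport_correction_ne_top {l : ℝ} (h0 : 0 < l) (h1 : l < 1 / 2) (i₀ : Fin d)
    (k : ℕ) : volume (tsupport (correction l i₀ k)) ≠ ⊤ :=
  (hasCompactSupport_correction h0 h1 i₀ k).measure_lt_top.ne

theorem exists_nonlocalPhase_correction_le (hd : 1 ≤ d) {s p : ℝ} (hs : 0 < s) (hs1 : s < 1)
    (hp : 1 < p) {l : ℝ} (h0 : 0 < l) (h1 : l < 1 / 2) (i₀ : Fin d) :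
    ∃ C, ∀ k, nonlocalPhase s p (fun _ _ => 1) (correction l i₀ k) ≤
      ENNReal.ofReal (C * energyRatio d s p l ^ k) := by
  obtain ⟨L, hL0, hL⟩ := exists_norm_fderiv_correction_le h0 h1 i₀
  set A : ℝ := max 2 L with hA
  have hA0 : 0 ≤ A := hL0.trans (le_max_right _ _)
  set V : ℝ := (volume (tsupport (correction l i₀ 0))).toReal with hV
  set I : ℝ := ∫ z : 𝔼, gagliardoProfile d s p ‖z‖ with hI
  have hI0 : 0 ≤ I := integral_nonneg fun z => gagliardoProfile_nonneg s p (norm_nonneg _)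
  refine ⟨2 / p * A ^ p * I * V, fun k => ?_⟩
  have hlip := abs_sub_le_min_of_bounds (A := A * (1 / 2) ^ k)
    ((contDiff_correction l i₀ k).differentiable (by simp)) (pow_pos h0 k)
    (abs_correction_le h0 h1 i₀ k) (hL k) (by gcongr; exact le_max_left _ _) (by
      rw [mul_inv, mul_pow, mul_assoc, mul_assoc, ← mul_pow, inv_mul_cancel₀ h0.ne', one_pow,
        mul_one, ← one_div]
      gcongr
      exact le_max_right _ _)
  refine (nonlocalPhase_le_of_support hd hs hs1 hp (fun _ _ => zero_le_one) (fun _ _ => le_rfl)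
    (isClosed_tsupport _).measurableSet (fun x hx => image_eq_zero_of_notMem_tsupport hx)
    (by positivity) (pow_pos h0 k) hlip).trans ?_
  refine (mul_le_mul_right (volume_tsupport_correction_le h0 i₀ k) _).trans (le_of_eq ?_)
  rw [← ENNReal.ofReal_toReal (volume_tsupport_correction_ne_top h0 h1 i₀ 0), ← hV, ← hI,
    ← ENNReal.ofReal_mul (by positivity), ← ENNReal.ofReal_mul (by positivity),
    ← energyRatio_pow d s p h0]
  congr 1
  rw [Real.mul_rpow hA0 (by positivity)]
  ring

theorem exists_lintegral_gradient_correction_le {p : ℝ} (hp : 1 < p) {l : ℝ} (h0 : 0 < l)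
    (h1 : l < 1 / 2) (i₀ : Fin d) (S : Set 𝔼) :
    ∃ C, ∀ k, ∫⁻ x in S, ENNReal.ofReal (1 / p * 1 * ‖gradient (correction l i₀ k) x‖ ^ p) ≤
      ENNReal.ofReal (C * energyRatio d 1 p l ^ k) := by
  obtain ⟨L, hL0, hL⟩ := exists_norm_fderiv_correction_le h0 h1 i₀
  set V : ℝ := (volume (tsupport (correction l i₀ 0))).toReal with hV
  refine ⟨1 / p * 1 * L ^ p * V, fun k => ?_⟩
  refine (lintegral_gradient_le p hp (w := fun _ => 1) (B := 1) (L := L * (2 * l)⁻¹ ^ k)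
    (fun x => ?_) (fun _ => zero_le_one) (fun _ => le_rfl) S).trans ?_
  · rw [norm_gradient]; exact hL k x
  refine (mul_le_mul_right (volume_tsupport_correction_le h0 i₀ k) _).trans (le_of_eq ?_)
  rw [← ENNReal.ofReal_toReal (volume_tsupport_correction_ne_top h0 h1 i₀ 0), ← hV,
    ← ENNReal.ofReal_mul (by positivity), ← ENNReal.ofReal_mul (by positivity),
    ← energyRatio_pow d 1 p h0]
  congr 1
  have e : (L * (2 * l)⁻¹ ^ k) ^ p = L ^ p * (((1 / 2 : ℝ) ^ k) ^ p * (l ^ k) ^ (-(1 * p))) := by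
    rw [Real.mul_rpow hL0 (by positivity), mul_inv, mul_pow,
      Real.mul_rpow (by positivity) (by positivity), one_mul, Real.rpow_neg (by positivity),
      ← Real.inv_rpow (by positivity), inv_pow l, one_div]
  rw [e]
  ring

theorem integral_norm_le_of_bound {F : Type*} [NormedAddCommGroup F] {f : 𝔼 → F} {S : Set 𝔼}
    (hS : MeasurableSet S) (hSf : volume S ≠ ⊤) {M : ℝ} (h : ∀ x, ‖f x‖ ≤ M)
    (h0 : ∀ x, x ∉ S → f x = 0) : ∫ x, ‖f x‖ ≤ M * (volume S).toReal := by
  have hM : 0 ≤ M := (norm_nonneg _).trans (h 0)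
  calc ∫ x, ‖f x‖ ≤ ∫ x, S.indicator (fun _ => M) x := by
        refine integral_mono_of_nonneg (Filter.Eventually.of_forall fun x => norm_nonneg _)
          ((integrable_indicator_iff hS).2 (integrableOn_const hSf))
          (Filter.Eventually.of_forall fun x => ?_)
        by_cases hx : x ∈ S
        · simpa [hx] using h x
        · simp [hx, h0 x hx]
    _ = _ := by
      rw [integral_indicator hS, setIntegral_const, smul_eq_mul, mul_comm]; rfl

theorem integrable_correction {l : ℝ} (h0 : 0 < l) (h1 : l < 1 / 2) (i₀ : Fin d) (k : ℕ) :
    Integrable (correction l i₀ k) :=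
  (contDiff_correction l i₀ k).continuous.integrable_of_hasCompactSupport
    (hasCompactSupport_correction h0 h1 i₀ k)

theorem volume_toReal_tsupport_correction_le {l : ℝ} (h0 : 0 < l) (h1 : l < 1 / 2) (i₀ : Fin d)
    (k : ℕ) : (volume (tsupport (correction l i₀ k))).toReal ≤
      (2 * l ^ d) ^ k * (volume (tsupport (correction l i₀ 0))).toReal := by
  have := ENNReal.toReal_mono (ENNReal.mul_ne_top ENNReal.ofReal_ne_top
    (volume_tsupport_correction_ne_top h0 h1 i₀ 0)) (volume_tsupport_correction_le h0 i₀ k)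
  rwa [ENNReal.toReal_mul, ENNReal.toReal_ofReal (by positivity)] at this

theorem summable_integral_norm_correction (hd : 1 ≤ d) {l : ℝ} (h0 : 0 < l) (h1 : l < 1 / 2)
    (i₀ : Fin d) : Summable fun k => ∫ x, ‖correction l i₀ k x‖ := by
  have hl : l ^ d < 1 := pow_lt_one₀ h0.le (by linarith) (by omega)
  refine Summable.of_nonneg_of_le (fun k => integral_nonneg fun x => norm_nonneg _) (fun k => ?_)
    ((summable_geometric_of_lt_one (by positivity) hl).mul_right
      (volume (tsupport (correction l i₀ 0))).toReal)
  refine (integral_norm_le_of_bound (isClosed_tsupport _).measurableSet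
    (volume_tsupport_correction_ne_top h0 h1 i₀ k) (abs_correction_le h0 h1 i₀ k)
    fun x hx => image_eq_zero_of_notMem_tsupport hx).trans ?_
  refine (mul_le_mul_of_nonneg_left (volume_toReal_tsupport_correction_le h0 h1 i₀ k)
    (by positivity)).trans (le_of_eq ?_)
  rw [← mul_assoc, ← mul_pow]
  ring_nf

theorem summable_integral_norm_gradient_correction (hd : 2 ≤ d) {l : ℝ} (h0 : 0 < l)
    (h1 : l < 1 / 2) (i₀ : Fin d) :
    Summable fun k => ∫ x, ‖gradient (correction l i₀ k) x‖ := by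
  obtain ⟨L, hL0, hL⟩ := exists_norm_fderiv_correction_le h0 h1 i₀
  have hl : l ^ (d - 1) < 1 := pow_lt_one₀ h0.le (by linarith) (by omega)
  refine Summable.of_nonneg_of_le (fun k => integral_nonneg fun x => norm_nonneg _) (fun k => ?_)
    ((summable_geometric_of_lt_one (by positivity) hl).mul_right
      (L * (volume (tsupport (correction l i₀ 0))).toReal))
  refine (integral_norm_le_of_bound (M := L * (2 * l)⁻¹ ^ k) (isClosed_tsupport _).measurableSet
    (volume_tsupport_correction_ne_top h0 h1 i₀ k) (fun x => ?_)
    fun x hx => gradient_eq_zero_of_notMem_tsupport hx).trans ?_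
  · rw [norm_gradient]; exact hL k x
  refine (mul_le_mul_of_nonneg_left (volume_toReal_tsupport_correction_le h0 h1 i₀ k)
    (by positivity)).trans (le_of_eq ?_)
  have e : (2 * l)⁻¹ * (2 * l ^ d) = l ^ (d - 1) := by
    obtain ⟨m, rfl⟩ := Nat.exists_eq_add_of_le' (show 1 ≤ d by omega)
    rw [Nat.add_sub_cancel, pow_succ]
    field_simp
  rw [← e, mul_pow _ (2 * l ^ d)]
  ring

theorem hasWeakGradient_tsum_correction (hd : 2 ≤ d) {l : ℝ} (h0 : 0 < l) (h1 : l < 1 / 2)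
    (i₀ : Fin d) : HasWeakGradient (fun x => ∑' k, correction l i₀ k x)
      (fun x => ∑' k, gradient (correction l i₀ k) x) := by
  have hC : ∀ k, ContDiff ℝ 1 (correction l i₀ k) := fun k =>
    (contDiff_correction l i₀ k).of_le (by simp)
  refine hasWeakGradient_tsum (fun k => hasWeakGradient_of_contDiff (hC k))
    (integrable_correction h0 h1 i₀) (fun k => ?_)
    (summable_integral_norm_correction (by omega) h0 h1 i₀)
    (summable_integral_norm_gradient_correction hd h0 h1 i₀) (summable_correction h0 h1 i₀)
  refine (continuous_gradient (hC k)).integrable_of_hasCompactSupport ?_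
  exact ((hasCompactSupport_correction h0 h1 i₀ k).fderiv (𝕜 := ℝ)).comp_left
    (g := (InnerProductSpace.toDual ℝ 𝔼).symm) (by simp)

theorem contDiff_one_datum (i₀ : Fin d) : ContDiff ℝ 1 (datum i₀ : 𝔼 → ℝ) :=
  (contDiff_datum i₀).of_le (by simp)

theorem hasWeakGradient_competitor (hd : 2 ≤ d) {l : ℝ} (h0 : 0 < l) (h1 : l < 1 / 2)
    (i₀ : Fin d) : HasWeakGradient (competitor l i₀) (competitorGradient l i₀) :=
  (hasWeakGradient_of_contDiff (contDiff_one_datum i₀)).add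
    (hasWeakGradient_tsum_correction hd h0 h1 i₀)

theorem nonlocalPhase_tsum_correction_lt_top (hd : 1 ≤ d) {s p : ℝ} (hs : 0 < s) (hs1 : s < 1)
    (hp : 1 < p) {l : ℝ} (h0 : 0 < l) (h1 : l < 1 / 2) (hr : energyRatio d s p l < 1)
    (i₀ : Fin d) :
    nonlocalPhase s p (fun _ _ => 1) (fun x => ∑' k, correction l i₀ k x) < ⊤ := by
  obtain ⟨C, hC⟩ := exists_nonlocalPhase_correction_le hd hs hs1 hp h0 h1 i₀
  exact nonlocalPhase_tsum_lt_top s hp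
    (fun k => (contDiff_correction l i₀ k).continuous.measurable) (summable_correction h0 h1 i₀)
    (energyRatio_pos d s p h0) hr hC

theorem localPhase_tsum_correction_lt_top (hd : 2 ≤ d) {p : ℝ} (hp : 1 < p) {l : ℝ} (h0 : 0 < l)
    (h1 : l < 1 / 2) (hr : energyRatio d 1 p l < 1) (i₀ : Fin d) :
    localPhase p (fun _ => 1) (fun x => ∑' k, correction l i₀ k x) < ⊤ := by
  obtain ⟨C, hC⟩ := exists_lintegral_gradient_correction_le hp h0 h1 i₀ (cube d 1)
  refine (iInf₂_le _ (hasWeakGradient_tsum_correction hd h0 h1 i₀)).trans_lt ?_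
  exact lintegral_tsum_norm_rpow_lt_top hp (fun k => (continuous_gradient
    ((contDiff_correction l i₀ k).of_le (by simp))).measurable) (energyRatio_pos d 1 p h0) hr hC

theorem nonlocalPhase_competitor_eq_zero {l : ℝ} (h0 : 0 < l) (h1 : l < 1 / 2) (i₀ : Fin d)
    (t : ℝ) {q : ℝ} (hq : 1 < q) {a : 𝔼 → 𝔼 → ℝ}
    (ha : ∀ x y, a x y ≠ 0 → ∃ (k : ℕ) (w : Fin k → Bool), x ∈ gapBall l i₀ w ∧
      y ∈ gapBall l i₀ w) : nonlocalPhase t q a (competitor l i₀) = 0 := by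
  have : ∀ x y, ENNReal.ofReal (1 / q * a x y *
      (|competitor l i₀ x - competitor l i₀ y| ^ q / ‖x - y‖ ^ ((d : ℝ) + t * q))) = 0 := by
    intro x y
    by_cases hxy : a x y = 0
    · simp [hxy]
    · obtain ⟨k, w, hx, hy⟩ := ha x y hxy
      obtain ⟨c, hc⟩ := exists_competitor_eq h0 h1 i₀ w
      rw [hc x hx, hc y hy]
      simp [Real.zero_rpow (by linarith : q ≠ 0)]
  simp only [nonlocalPhase, this, lintegral_zero]

theorem localPhase_competitor_eq_zero (hd : 2 ≤ d) {l : ℝ} (h0 : 0 < l) (h1 : l < 1 / 2)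
    (i₀ : Fin d) {q : ℝ} (hq : 1 < q) {a : 𝔼 → ℝ}
    (ha : ∀ x, a x ≠ 0 → ∃ (k : ℕ) (w : Fin k → Bool), x ∈ gapBall l i₀ w) :
    localPhase q a (competitor l i₀) = 0 := by
  have : ∀ x, ENNReal.ofReal (1 / q * a x * ‖competitorGradient l i₀ x‖ ^ q) = 0 := by
    intro x
    by_cases hx : a x = 0
    · simp [hx]
    · obtain ⟨k, w, hw⟩ := ha x hx
      rw [competitorGradient_eq_zero h0 h1 hw]
      simp [Real.zero_rpow (by linarith : q ≠ 0)]
  refine le_antisymm ((iInf₂_le _ (hasWeakGradient_competitor hd h0 h1 i₀)).trans ?_) zero_le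
  simp only [this, lintegral_zero, le_refl]

theorem aemeasurable_competitor (hd : 2 ≤ d) {l : ℝ} (h0 : 0 < l) (h1 : l < 1 / 2)
    (i₀ : Fin d) : AEMeasurable (competitor l i₀) :=
  (hasWeakGradient_competitor hd h0 h1 i₀).1.aestronglyMeasurable.aemeasurable

/-- The competitor is admissible as soon as the corrections have finite first energy and the second
phase is finite on the datum and vanishes on the competitor. -/
theorem competitor_mem_W (hd : 2 ≤ d) {l : ℝ} (h0 : 0 < l) (h1 : l < 1 / 2) (i₀ : Fin d)
    {P Q : (𝔼 → ℝ) → ℝ≥0∞} {K : ℝ≥0∞} (hK : K ≠ ⊤)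
    (hadd : ∀ f g : 𝔼 → ℝ, AEMeasurable f → AEMeasurable g → Q (f + g) ≤ K * (Q f + Q g))
    (hP : P (fun x => ∑' k, correction l i₀ k x) < ⊤)
    (hQ0 : Q (competitor l i₀) = 0) (hQ : Q (-datum i₀) < ⊤) :
    competitor l i₀ ∈ W (fun f => P f + Q f) (datum i₀) := by
  have e : competitor l i₀ - datum i₀ = fun x => ∑' k, correction l i₀ k x := by
    rw [competitor, add_sub_cancel_left]
  refine ⟨?_, ?_, Filter.Eventually.of_forall fun x hx => ?_⟩
  · rw [e]; exact (hasWeakGradient_tsum_correction hd h0 h1 i₀).1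
  · refine ENNReal.add_lt_top.2 ⟨by rw [e]; exact hP, ?_⟩
    rw [sub_eq_add_neg]
    refine (hadd _ _ (aemeasurable_competitor hd h0 h1 i₀)
      (contDiff_datum i₀).continuous.neg.measurable.aemeasurable).trans_lt ?_
    rw [hQ0, zero_add]
    exact ENNReal.mul_lt_top hK.lt_top hQ
  · have hz : ∀ k, correction l i₀ k x = 0 := by
      intro k
      by_contra hc
      exact hx (cylinder_subset_cube i₀ (mem_cylinder_of_correction_ne_zero h0 h1 hc))
    rw [e]
    simp [hz]

/-! ### Oscillation along chains of balls -/

/-- Jensen's inequality for the `q`-th power and subprobability measures. -/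
theorem lintegral_rpow_le {X : Type*} [MeasurableSpace X] {μ : Measure X} (hμ : μ univ ≤ 1)
    {q : ℝ} (hq : 1 < q) {f : X → ℝ≥0∞} (hf : AEMeasurable f μ) :
    (∫⁻ x, f x ∂μ) ^ q ≤ ∫⁻ x, f x ^ q ∂μ := by
  have hq0 : 0 < q := by linarith
  have h := ENNReal.lintegral_mul_le_Lp_mul_Lq μ (Real.HolderConjugate.conjExponent hq) hf
    (aemeasurable_const (b := (1 : ℝ≥0∞)))
  simp only [Pi.mul_apply, mul_one, ENNReal.one_rpow, lintegral_const, one_mul] at h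
  have h2 : μ univ ^ (1 / q.conjExponent) ≤ 1 :=
    ENNReal.rpow_le_one hμ (one_div_nonneg.2 (Real.HolderConjugate.conjExponent hq).symm.nonneg)
  have h3 : ∫⁻ x, f x ∂μ ≤ (∫⁻ x, f x ^ q ∂μ) ^ (1 / q) :=
    h.trans ((mul_le_mul_right h2 _).trans_eq (mul_one _))
  refine (ENNReal.rpow_le_rpow h3 hq0.le).trans_eq ?_
  rw [← ENNReal.rpow_mul, one_div_mul_cancel hq0.ne', ENNReal.rpow_one]

theorem enorm_integral_sub_integral_rpow_le {X : Type*} [MeasurableSpace X] {μ ν : Measure X}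
    [IsProbabilityMeasure μ] [IsProbabilityMeasure ν] {q : ℝ} (hq : 1 < q) {f : X → ℝ}
    (hfm : Measurable f) (hf : Integrable f μ) (hf' : Integrable f ν) :
    ‖∫ x, f x ∂μ - ∫ x, f x ∂ν‖ₑ ^ q ≤ ∫⁻ x, ∫⁻ y, ‖f x - f y‖ₑ ^ q ∂ν ∂μ := by
  have hm : Measurable fun z : X × X => ‖f z.1 - f z.2‖ₑ :=
    ((hfm.comp measurable_fst).sub (hfm.comp measurable_snd)).enorm
  have e : ∫ x, f x ∂μ - ∫ x, f x ∂ν = ∫ x, ∫ y, (f x - f y) ∂ν ∂μ := by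
    have : ∀ x, ∫ y, (f x - f y) ∂ν = f x - ∫ y, f y ∂ν := fun x => by
      rw [integral_sub (integrable_const _) hf']; simp
    simp only [this]
    rw [integral_sub hf (integrable_const _)]; simp
  rw [e]
  calc _ ≤ (∫⁻ x, ∫⁻ y, ‖f x - f y‖ₑ ∂ν ∂μ) ^ q := by
        refine ENNReal.rpow_le_rpow ?_ (by linarith)
        refine (enorm_integral_le_lintegral_enorm _).trans (lintegral_mono fun x => ?_)
        exact enorm_integral_le_lintegral_enorm _
    _ ≤ ∫⁻ x, (∫⁻ y, ‖f x - f y‖ₑ ∂ν) ^ q ∂μ :=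
        lintegral_rpow_le prob_le_one hq (hm.lintegral_prod_right').aemeasurable
    _ ≤ _ := lintegral_mono fun x => lintegral_rpow_le prob_le_one hq
        (hm.comp (measurable_const.prodMk measurable_id)).aemeasurable

/-- Averages over two subsets `A`, `B` of `S` differ by at most the mean oscillation. -/
theorem enorm_average_sub_average_rpow_le {q : ℝ} (hq : 1 < q) {ψ : 𝔼 → ℝ} (hψ : Continuous ψ)
    {c c' z : 𝔼} {r r' ρ : ℝ} (hr : 0 < r) (hr' : 0 < r')
    (hA : Metric.ball c r ⊆ Metric.ball z ρ) (hB : Metric.ball c' r' ⊆ Metric.ball z ρ) :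
    ‖(⨍ x in Metric.ball c r, ψ x) - ⨍ x in Metric.ball c' r', ψ x‖ₑ ^ q ≤
      (volume (Metric.ball c r))⁻¹ * ((volume (Metric.ball c' r'))⁻¹ *
        ∫⁻ x in Metric.ball z ρ, ∫⁻ y in Metric.ball z ρ, ‖ψ x - ψ y‖ₑ ^ q) := by
  have hA0 : volume (Metric.ball c r) ≠ 0 := (Metric.measure_ball_pos volume c hr).ne'
  have hB0 : volume (Metric.ball c' r') ≠ 0 := (Metric.measure_ball_pos volume c' hr').ne'
  have hA1 : volume (Metric.ball c r) ≠ ⊤ := measure_ball_lt_top.ne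
  have hB1 : volume (Metric.ball c' r') ≠ ⊤ := measure_ball_lt_top.ne
  have hint : ∀ (c : 𝔼) (r : ℝ), Integrable ψ (volume.restrict (Metric.ball c r)) := fun c r =>
    (hψ.continuousOn.integrableOn_compact (isCompact_closedBall c r)).mono_set
      Metric.ball_subset_closedBall
  have pA : IsProbabilityMeasure
      ((volume (Metric.ball c r))⁻¹ • (volume : Measure 𝔼).restrict (Metric.ball c r)) :=
    ⟨by simp [ENNReal.inv_mul_cancel hA0 hA1]⟩
  have pB : IsProbabilityMeasure
      ((volume (Metric.ball c' r'))⁻¹ • (volume : Measure 𝔼).restrict (Metric.ball c' r')) :=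
    ⟨by simp [ENNReal.inv_mul_cancel hB0 hB1]⟩
  have h := enorm_integral_sub_integral_rpow_le hq hψ.measurable
    ((hint c r).smul_measure (ENNReal.inv_ne_top.2 hA0))
    ((hint c' r').smul_measure (ENNReal.inv_ne_top.2 hB0))
  simp only [average, Measure.restrict_apply_univ]
  refine h.trans ?_
  simp only [lintegral_smul_measure, smul_eq_mul]
  rw [lintegral_const_mul' _ _ (ENNReal.inv_ne_top.2 hB0)]
  gcongr

/-- Averages over the balls of radii `R 2 ^ (-j) / 2` in a nontangential cone with vertex `z`
converge to `ψ z`, and the differences of consecutive averages are summable. The hypothesis concerns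
balls of radius `3 r / 4` around points at distance `r` from `z`, so the vertex may lie on the
boundary of the region where the oscillation is controlled. -/
theorem exists_chain_bound (hd : 1 ≤ d) {q τ : ℝ} (hq : 1 < q) (hτ : 0 < τ) :
    ∃ C : ℝ, 0 ≤ C ∧ ∀ (ψ : 𝔼 → ℝ), Continuous ψ → ∀ (z e : 𝔼), ‖e‖ = 1 → ∀ (R F : ℝ),
      0 < R → 0 ≤ F →
      (∀ r, 0 < r → r ≤ R → ∫⁻ x in Metric.ball (z + r • e) (3 / 4 * r),
        ∫⁻ y in Metric.ball (z + r • e) (3 / 4 * r), ‖ψ x - ψ y‖ₑ ^ q ≤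
          ENNReal.ofReal (F * r ^ (2 * (d : ℝ) + τ * q))) →
      |(⨍ x in Metric.ball (z + R • e) (R / 2), ψ x) - ψ z| ≤ C * (F ^ (1 / q) * R ^ τ) := by
  have hq0 : 0 < q := by linarith
  have : Nontrivial 𝔼 := nontrivial_euclideanSpace hd
  set V : ℝ := (volume (Metric.ball (0 : 𝔼) 1)).toReal with hV
  have hV0 : 0 < V := ENNReal.toReal_pos (Metric.measure_ball_pos volume _ one_pos).ne'
    measure_ball_lt_top.ne
  have hvol : ∀ (c : 𝔼) (r : ℝ), 0 < r →
      (volume (Metric.ball c r))⁻¹ = ENNReal.ofReal ((r ^ d * V)⁻¹) := fun c r hr => by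
    rw [Measure.addHaar_ball_of_pos _ _ hr, finrank_euclideanSpace_fin,
      ENNReal.ofReal_inv_of_pos (by positivity), ENNReal.ofReal_mul (by positivity),
      ENNReal.ofReal_toReal measure_ball_lt_top.ne]
  have h2τ : (2 : ℝ) ^ (-τ) < 1 := Real.rpow_lt_one_of_one_lt_of_neg one_lt_two (by linarith)
  set κ : ℝ := (8 ^ d / V ^ 2) ^ (1 / q)
  have hκ : 0 ≤ κ := by positivity
  refine ⟨κ / (1 - 2 ^ (-τ)), div_nonneg hκ (by linarith), ?_⟩
  intro ψ hψ z e he R F hR hF h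
  let r : ℕ → ℝ := fun j => R * (1 / 2) ^ j
  have hr : ∀ j, 0 < r j := fun j => by positivity
  have hr1 : ∀ j, r (j + 1) = r j / 2 := fun j => by simp only [r, pow_succ]; ring
  have hrR : ∀ j, r j ≤ R := fun j =>
    mul_le_of_le_one_right hR.le (pow_le_one₀ (by norm_num) (by norm_num))
  let m : ℕ → ℝ := fun j => ⨍ x in Metric.ball (z + r j • e) (r j / 2), ψ x
  have hstep : ∀ j, dist (m j) (m (j + 1)) ≤ κ * (F ^ (1 / q) * R ^ τ) * (2 ^ (-τ)) ^ j := by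
    intro j
    have hrj := hr j
    have hB : Metric.ball (z + r (j + 1) • e) (r (j + 1) / 2) ⊆
        Metric.ball (z + r j • e) (3 / 4 * r j) := by
      refine Metric.ball_subset_ball' ?_
      rw [dist_eq_norm, hr1, show z + (r j / 2) • e - (z + r j • e) = (-(r j / 2)) • e by
        module, norm_smul, he, Real.norm_eq_abs, abs_neg, abs_of_pos (by linarith)]
      linarith
    have h1 := enorm_average_sub_average_rpow_le hq hψ (half_pos (hr j)) (half_pos (hr (j + 1)))
      (Metric.ball_subset_ball (by linarith)) hB
    rw [hvol _ _ (half_pos (hr j)), hvol _ _ (half_pos (hr (j + 1)))] at h1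
    have h2 := h1.trans (mul_le_mul_right (mul_le_mul_right (h (r j) (hr j) (hrR j)) _) _)
    rw [← ENNReal.ofReal_mul (by positivity), ← ENNReal.ofReal_mul (by positivity),
      ← ofReal_norm, ENNReal.ofReal_rpow_of_nonneg (norm_nonneg _) hq0.le,
      ENNReal.ofReal_le_ofReal_iff (by positivity)] at h2
    have e1 : ((r j / 2) ^ d * V)⁻¹ * (((r (j + 1) / 2) ^ d * V)⁻¹ *
        (F * r j ^ (2 * (d : ℝ) + τ * q))) = 8 ^ d / V ^ 2 * (F * (r j ^ τ) ^ q) := by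
      rw [hr1, Real.rpow_add hrj, Real.rpow_mul hrj.le τ q, two_mul, Real.rpow_add hrj,
        Real.rpow_natCast, div_pow, div_pow, div_pow,
        show (8 : ℝ) ^ d = 2 ^ d * 2 ^ d * 2 ^ d by rw [← mul_pow, ← mul_pow]; norm_num]
      have : r j ^ d ≠ 0 := by positivity
      field_simp
    rw [e1] at h2
    have h3 := Real.rpow_le_rpow (by positivity) h2 (one_div_nonneg.2 hq0.le)
    rw [← Real.rpow_mul (norm_nonneg _), mul_one_div_cancel hq0.ne', Real.rpow_one,
      Real.mul_rpow (by positivity) (by positivity), Real.mul_rpow hF (by positivity),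
      ← Real.rpow_mul (by positivity) q, mul_one_div_cancel hq0.ne', Real.rpow_one] at h3
    rw [dist_eq_norm]
    refine h3.trans (le_of_eq ?_)
    have e2 : ((1 : ℝ) / 2) ^ τ = 2 ^ (-τ) := by
      rw [one_div, Real.inv_rpow zero_le_two, Real.rpow_neg zero_le_two]
    simp only [r]
    rw [Real.mul_rpow hR.le (by positivity), ← Real.rpow_natCast_mul (by norm_num),
      mul_comm (j : ℝ) τ, Real.rpow_mul_natCast (by norm_num), e2]
    ring
  have hlim : Filter.Tendsto m Filter.atTop (nhds (ψ z)) := by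
    rw [Metric.tendsto_atTop]
    intro ε hε
    obtain ⟨δ, hδ, hψδ⟩ := Metric.continuous_iff.1 hψ z (ε / 2) (half_pos hε)
    have hr0 : Filter.Tendsto (fun j => 3 / 2 * r j) Filter.atTop (nhds 0) := by
      have := ((tendsto_pow_atTop_nhds_zero_of_lt_one (r := (1 / 2 : ℝ)) (by norm_num)
        (by norm_num)).const_mul R).const_mul (3 / 2)
      simpa only [mul_zero] using this
    obtain ⟨N, hN⟩ := (Filter.eventually_atTop.1 (hr0.eventually (gt_mem_nhds hδ)))
    refine ⟨N, fun j hj => ?_⟩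
    have hrj := hr j
    have hsub : ∀ x ∈ Metric.ball (z + r j • e) (r j / 2), ‖ψ x - ψ z‖ ≤ ε / 2 := by
      intro x hx
      rw [← dist_eq_norm]
      refine (hψδ x (lt_of_lt_of_le ?_ (hN j hj).le)).le
      have := dist_triangle x (z + r j • e) z
      have h5 : dist (z + r j • e) z = r j := by
        rw [dist_eq_norm, add_sub_cancel_left, norm_smul, he, Real.norm_of_nonneg hrj.le, mul_one]
      rw [Metric.mem_ball] at hx
      linarith
    have hA0 : volume (Metric.ball (z + r j • e) (r j / 2)) ≠ 0 :=
      (Metric.measure_ball_pos volume _ (half_pos hrj)).ne'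
    have hA1 : volume (Metric.ball (z + r j • e) (r j / 2)) ≠ ⊤ := measure_ball_lt_top.ne
    have hint : IntegrableOn ψ (Metric.ball (z + r j • e) (r j / 2)) :=
      (hψ.continuousOn.integrableOn_compact (isCompact_closedBall _ _)).mono_set
        Metric.ball_subset_closedBall
    have h6 : m j - ψ z = ⨍ x in Metric.ball (z + r j • e) (r j / 2), (ψ x - ψ z) := by
      simp only [m]
      rw [setAverage_eq, setAverage_eq, integral_sub hint (integrableOn_const hA1),
        setIntegral_const, smul_sub, smul_smul, inv_mul_cancel₀, one_smul]
      exact (ENNReal.toReal_pos hA0 hA1).ne'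
    rw [dist_eq_norm, h6, setAverage_eq, norm_smul]
    have h7 := norm_setIntegral_le_of_norm_le_const hA1.lt_top hsub
    have hv : 0 < volume.real (Metric.ball (z + r j • e) (r j / 2)) := ENNReal.toReal_pos hA0 hA1
    rw [norm_inv, Real.norm_of_nonneg hv.le, inv_mul_lt_iff₀ hv]
    nlinarith
  have hfin := dist_le_of_le_geometric_of_tendsto₀ _ _ h2τ hstep hlim
  rw [Real.dist_eq] at hfin
  have hm0 : m 0 = ⨍ x in Metric.ball (z + R • e) (R / 2), ψ x := by simp [m, r]
  rw [← hm0]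
  refine hfin.trans (le_of_eq ?_)
  ring

/-- Morrey-type bound for the increment across a diameter of a ball, for an oscillation hypothesis
which may degenerate towards the boundary. -/
theorem exists_diameter_bound (hd : 1 ≤ d) {q τ : ℝ} (hq : 1 < q) (hτ : 0 < τ) :
    ∃ C : ℝ, 0 ≤ C ∧ ∀ (ψ : 𝔼 → ℝ), Continuous ψ → ∀ (m e : 𝔼), ‖e‖ = 1 → ∀ (R F : ℝ),
      0 < R → 0 ≤ F →
      (∀ z r, 0 < r → Metric.ball z r ⊆ Metric.ball m R → ∫⁻ x in Metric.ball z (3 / 4 * r),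
        ∫⁻ y in Metric.ball z (3 / 4 * r), ‖ψ x - ψ y‖ₑ ^ q ≤
          ENNReal.ofReal (F * r ^ (2 * (d : ℝ) + τ * q))) →
      |ψ (m + R • e) - ψ (m - R • e)| ≤ C * (F ^ (1 / q) * R ^ τ) := by
  obtain ⟨C, hC, h⟩ := exists_chain_bound hd hq hτ
  refine ⟨2 * C, by positivity, fun ψ hψ m e he R F hR hF ho => ?_⟩
  have hsub : ∀ e' : 𝔼, ‖e'‖ = 1 → ∀ r, 0 < r → r ≤ R →
      Metric.ball (m - R • e' + r • e') r ⊆ Metric.ball m R := by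
    intro e' he' r hr hrR
    refine Metric.ball_subset_ball' ?_
    rw [dist_eq_norm, show m - R • e' + r • e' - m = (-(R - r)) • e' by module, norm_smul, he',
      norm_neg, Real.norm_of_nonneg (by linarith)]
    linarith
  have h1 := h ψ hψ (m - R • e) e he R F hR hF fun r hr hrR =>
    ho _ r hr (hsub e he r hr hrR)
  have he' : ‖-e‖ = 1 := by rw [norm_neg, he]
  have h2 := h ψ hψ (m - R • -e) (-e) he' R F hR hF fun r hr hrR =>
    ho _ r hr (hsub (-e) he' r hr hrR)
  rw [sub_add_cancel] at h1 h2
  rw [smul_neg, sub_neg_eq_add] at h2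
  have h3 := abs_sub_le (ψ (m + R • e)) (⨍ x in Metric.ball m (R / 2), ψ x) (ψ (m - R • e))
  rw [abs_sub_comm] at h2
  linarith

/-! ### The Poincaré inequality on balls -/

theorem lintegral_comp_smul_add {g : 𝔼 → ℝ≥0∞} (hg : Measurable g) {ρ : ℝ} (hρ : ρ ≠ 0) (c : 𝔼) :
    ∫⁻ y, g (ρ • y + c) = ENNReal.ofReal |(ρ ^ d)⁻¹| * ∫⁻ y, g y := by
  have hg' : Measurable fun y => g (y + c) := hg.comp (measurable_id.add_const c)
  have h := lintegral_map (μ := volume) hg'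
    (measurable_const_smul ρ : Measurable fun y : 𝔼 => ρ • y)
  rw [Measure.map_addHaar_smul volume hρ, lintegral_smul_measure, finrank_euclideanSpace_fin,
    lintegral_add_right_eq_self g c] at h
  exact h.symm

/-- Only the half of the segment from `x` to `y` that ends at `y` is used: there
`y ↦ ρ • y + (1 - ρ) • x` has Jacobian `ρ ^ d ≥ 2 ^ (-d)`, which keeps the change of variables in
`lintegral_ball_oscillation_le` bounded. -/
theorem enorm_sub_midpoint_rpow_le {q : ℝ} (hq : 1 < q) {ψ : 𝔼 → ℝ} (hψ : ContDiff ℝ 1 ψ)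
    (x y : 𝔼) : ‖ψ y - ψ (midpoint ℝ x y)‖ₑ ^ q ≤
      ENNReal.ofReal (‖y - x‖ ^ q) *
        ∫⁻ ρ in Ioc (1 / 2 : ℝ) 1, ‖gradient ψ (ρ • y + (1 - ρ) • x)‖ₑ ^ q := by
  have hq0 : 0 < q := by linarith
  let γ : ℝ → 𝔼 := fun ρ => ρ • y + (1 - ρ) • x
  have hγ : ∀ ρ, HasDerivAt γ (y - x) ρ := by
    intro ρ
    have h1 := ((hasDerivAt_id ρ).smul_const y).add
      (((hasDerivAt_const ρ (1 : ℝ)).sub (hasDerivAt_id ρ)).smul_const x)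
    refine h1.congr_deriv ?_
    simp only [one_smul, zero_sub, neg_smul]
    abel
  have hγc : Continuous γ := continuous_iff_continuousAt.2 fun ρ => (hγ ρ).continuousAt
  have hgc := continuous_gradient hψ
  have hd : ∀ ρ, HasDerivAt (fun ρ => ψ (γ ρ)) (fderiv ℝ ψ (γ ρ) (y - x)) ρ := fun ρ =>
    ((hψ.differentiable (by simp) (γ ρ)).hasFDerivAt).comp_hasDerivAt ρ (hγ ρ)
  have hdc : Continuous fun ρ => fderiv ℝ ψ (γ ρ) (y - x) :=
    ((hψ.continuous_fderiv (by simp)).comp hγc).clm_apply continuous_const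
  have hftc := intervalIntegral.integral_eq_sub_of_hasDerivAt (a := 1 / 2) (b := 1)
    (fun ρ _ => hd ρ) (hdc.intervalIntegrable _ _)
  have e1 : γ 1 = y := by simp [γ]
  have e2 : γ (1 / 2) = midpoint ℝ x y := by
    rw [midpoint_eq_smul_add]
    simp only [γ, smul_add]
    norm_num
    abel
  rw [e1, e2, intervalIntegral.integral_of_le (by norm_num)] at hftc
  rw [← hftc]
  have hm : Measurable fun ρ => ‖gradient ψ (γ ρ)‖ₑ := (hgc.comp hγc).measurable.enorm
  calc _ ≤ (∫⁻ ρ in Ioc (1 / 2 : ℝ) 1, ‖fderiv ℝ ψ (γ ρ) (y - x)‖ₑ) ^ q :=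
        ENNReal.rpow_le_rpow (enorm_integral_le_lintegral_enorm _) hq0.le
    _ ≤ (∫⁻ ρ in Ioc (1 / 2 : ℝ) 1, ENNReal.ofReal ‖y - x‖ * ‖gradient ψ (γ ρ)‖ₑ) ^ q := by
        refine ENNReal.rpow_le_rpow (lintegral_mono fun ρ => ?_) hq0.le
        rw [← ofReal_norm, ← ofReal_norm, ← ENNReal.ofReal_mul (norm_nonneg _), norm_gradient]
        refine ENNReal.ofReal_le_ofReal ?_
        rw [mul_comm]
        exact ContinuousLinearMap.le_opNorm _ _
    _ = ENNReal.ofReal (‖y - x‖ ^ q) *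
        (∫⁻ ρ in Ioc (1 / 2 : ℝ) 1, ‖gradient ψ (γ ρ)‖ₑ) ^ q := by
        rw [lintegral_const_mul _ hm, ENNReal.mul_rpow_of_nonneg _ _ hq0.le,
          ENNReal.ofReal_rpow_of_nonneg (norm_nonneg _) hq0.le]
    _ ≤ _ := by
        gcongr
        refine lintegral_rpow_le ?_ hq hm.aemeasurable
        rw [Measure.restrict_apply_univ, Real.volume_Ioc]
        exact ENNReal.ofReal_le_one.2 (by norm_num)

/-- A Poincaré inequality on balls, with a double integral as the measure of oscillation. -/
theorem lintegral_ball_oscillation_le {q : ℝ} (hq : 1 < q) {ψ : 𝔼 → ℝ} (hψ : ContDiff ℝ 1 ψ)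
    (z : 𝔼) {r : ℝ} (hr : 0 < r) :
    ∫⁻ x in Metric.ball z r, ∫⁻ y in Metric.ball z r, ‖ψ x - ψ y‖ₑ ^ q ≤
      ENNReal.ofReal (2 ^ q * (2 * r) ^ q * 2 ^ d) * volume (Metric.ball z r) *
        ∫⁻ x in Metric.ball z r, ‖gradient ψ x‖ₑ ^ q := by
  have hq0 : 0 < q := by linarith
  set B := Metric.ball z r with hB
  have hBm : MeasurableSet B := measurableSet_ball
  set I := ∫⁻ x in B, ‖gradient ψ x‖ₑ ^ q with hI
  have hgc := continuous_gradient hψ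
  let h : 𝔼 → 𝔼 → ℝ≥0∞ := fun x y =>
    ∫⁻ ρ in Ioc (1 / 2 : ℝ) 1, ‖gradient ψ (ρ • y + (1 - ρ) • x)‖ₑ ^ q
  have hm3 : Measurable fun v : (𝔼 × 𝔼) × ℝ =>
      ‖gradient ψ (v.2 • v.1.2 + (1 - v.2) • v.1.1)‖ₑ ^ q := by
    refine Measurable.pow_const (Continuous.measurable ?_).enorm q
    exact hgc.comp (by fun_prop)
  have hhm : Measurable fun v : 𝔼 × 𝔼 => h v.1 v.2 := hm3.lintegral_prod_right'
  have hinner : ∀ x ∈ B, ∫⁻ y in B, h x y ≤ ENNReal.ofReal (2 ^ d) * I := by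
    intro x hx
    have hF : ∀ ρ ∈ Ioc (1 / 2 : ℝ) 1, ∫⁻ y in B, ‖gradient ψ (ρ • y + (1 - ρ) • x)‖ₑ ^ q ≤
        ENNReal.ofReal (2 ^ d) * I := by
      intro ρ hρ
      have hρ0 : 0 < ρ := by linarith [hρ.1]
      let g : 𝔼 → ℝ≥0∞ := B.indicator fun y => ‖gradient ψ y‖ₑ ^ q
      have hg : Measurable g := (hgc.measurable.enorm.pow_const q).indicator hBm
      calc ∫⁻ y in B, ‖gradient ψ (ρ • y + (1 - ρ) • x)‖ₑ ^ q
          ≤ ∫⁻ y in B, g (ρ • y + (1 - ρ) • x) := by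
            refine setLIntegral_mono' hBm fun y hy => le_of_eq ?_
            have : ρ • y + (1 - ρ) • x ∈ B :=
              convex_ball z r hy hx hρ0.le (by linarith [hρ.2]) (by ring)
            simp only [g, indicator_of_mem this]
        _ ≤ ∫⁻ y, g (ρ • y + (1 - ρ) • x) := setLIntegral_le_lintegral _ _
        _ = ENNReal.ofReal |(ρ ^ d)⁻¹| * I := by
            rw [lintegral_comp_smul_add hg hρ0.ne', lintegral_indicator hBm]
        _ ≤ _ := by
            gcongr
            rw [abs_of_pos (by positivity), ← inv_pow]
            refine pow_le_pow_left₀ (by positivity) ?_ d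
            rw [inv_le_comm₀ hρ0 two_pos]
            linarith [hρ.1]
    calc ∫⁻ y in B, h x y = ∫⁻ ρ in Ioc (1 / 2 : ℝ) 1,
          ∫⁻ y in B, ‖gradient ψ (ρ • y + (1 - ρ) • x)‖ₑ ^ q := by
          have hcomp : Measurable fun v : 𝔼 × ℝ =>
              ‖gradient ψ (v.2 • v.1 + (1 - v.2) • x)‖ₑ ^ q := by
            refine Measurable.pow_const (Continuous.measurable ?_).enorm q
            exact hgc.comp (by fun_prop)
          exact lintegral_lintegral_swap hcomp.aemeasurable
      _ ≤ ∫⁻ ρ in Ioc (1 / 2 : ℝ) 1, ENNReal.ofReal (2 ^ d) * I :=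
          setLIntegral_mono' measurableSet_Ioc hF
      _ = ENNReal.ofReal (2 ^ d) * I * ENNReal.ofReal (1 / 2) := by
          rw [setLIntegral_const, Real.volume_Ioc]; norm_num
      _ ≤ ENNReal.ofReal (2 ^ d) * I * 1 :=
          mul_le_mul_right (ENNReal.ofReal_le_one.2 (by norm_num)) _
      _ = _ := mul_one _
  have hH : ∫⁻ x in B, ∫⁻ y in B, h x y ≤ ENNReal.ofReal (2 ^ d) * I * volume B := by
    rw [← setLIntegral_const]
    exact setLIntegral_mono' hBm hinner
  have hpt : ∀ x ∈ B, ∀ y ∈ B, ‖ψ x - ψ y‖ₑ ^ q ≤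
      ENNReal.ofReal (2 ^ (q - 1) * (2 * r) ^ q) * (h x y + h y x) := by
    intro x hx y hy
    have hxy : ‖y - x‖ ≤ 2 * r := by
      have := dist_triangle_right y x z
      rw [dist_eq_norm] at this
      rw [hB, Metric.mem_ball] at hx hy
      linarith
    have hxy' : ‖x - y‖ ≤ 2 * r := by rwa [norm_sub_rev]
    have e : ψ x - ψ y = (ψ x - ψ (midpoint ℝ y x)) + -(ψ y - ψ (midpoint ℝ x y)) := by
      rw [midpoint_comm]; ring
    calc ‖ψ x - ψ y‖ₑ ^ q
        ≤ (‖ψ x - ψ (midpoint ℝ y x)‖ₑ + ‖ψ y - ψ (midpoint ℝ x y)‖ₑ) ^ q := by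
          refine ENNReal.rpow_le_rpow ?_ hq0.le
          rw [e]
          exact (enorm_add_le _ _).trans (by rw [enorm_neg])
      _ ≤ 2 ^ (q - 1) * (‖ψ x - ψ (midpoint ℝ y x)‖ₑ ^ q +
          ‖ψ y - ψ (midpoint ℝ x y)‖ₑ ^ q) := ENNReal.rpow_add_le_mul_rpow_add_rpow _ _ hq.le
      _ ≤ 2 ^ (q - 1) * (ENNReal.ofReal ((2 * r) ^ q) * h y x +
          ENNReal.ofReal ((2 * r) ^ q) * h x y) := by
          gcongr
          · refine (enorm_sub_midpoint_rpow_le hq hψ y x).trans ?_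
            gcongr
          · refine (enorm_sub_midpoint_rpow_le hq hψ x y).trans ?_
            gcongr
      _ = _ := by
          rw [← mul_add, ← mul_assoc, add_comm (h y x), ENNReal.ofReal_mul (by positivity),
            ← ENNReal.ofReal_rpow_of_pos two_pos, ENNReal.ofReal_ofNat]
  calc ∫⁻ x in B, ∫⁻ y in B, ‖ψ x - ψ y‖ₑ ^ q
      ≤ ∫⁻ x in B, ∫⁻ y in B,
          ENNReal.ofReal (2 ^ (q - 1) * (2 * r) ^ q) * (h x y + h y x) :=
        setLIntegral_mono' hBm fun x hx => setLIntegral_mono' hBm fun y hy => hpt x hx y hy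
    _ = ENNReal.ofReal (2 ^ (q - 1) * (2 * r) ^ q) *
        ((∫⁻ x in B, ∫⁻ y in B, h x y) + ∫⁻ x in B, ∫⁻ y in B, h y x) := by
        simp only [lintegral_const_mul' _ _ ENNReal.ofReal_ne_top]
        congr 1
        rw [← lintegral_add_left hhm.lintegral_prod_right']
        refine lintegral_congr fun x => ?_
        exact lintegral_add_left (hhm.comp (measurable_const.prodMk measurable_id)) _
    _ = ENNReal.ofReal (2 ^ (q - 1) * (2 * r) ^ q) * (2 * ∫⁻ x in B, ∫⁻ y in B, h x y) := by
        have hsw : ∫⁻ x in B, ∫⁻ y in B, h y x = ∫⁻ x in B, ∫⁻ y in B, h x y :=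
          (lintegral_lintegral_swap hhm.aemeasurable).symm
        rw [hsw, two_mul (∫⁻ x in B, ∫⁻ y in B, h x y)]
    _ ≤ ENNReal.ofReal (2 ^ (q - 1) * (2 * r) ^ q) *
        (ENNReal.ofReal 2 * (ENNReal.ofReal (2 ^ d) * I * volume B)) := by
        rw [ENNReal.ofReal_ofNat]; gcongr
    _ = _ := by
        have e : ENNReal.ofReal (2 ^ q * (2 * r) ^ q * 2 ^ d) =
            ENNReal.ofReal (2 ^ (q - 1) * (2 * r) ^ q) *
              (ENNReal.ofReal 2 * ENNReal.ofReal (2 ^ d)) := by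
          rw [← ENNReal.ofReal_mul two_pos.le, ← ENNReal.ofReal_mul (by positivity)]
          congr 1
          rw [Real.rpow_sub two_pos, Real.rpow_one]
          ring
        rw [e]
        ring

/-! ### Lower bounds for smooth functions -/

/-- The segment `[-1, 1]` is the union of the gaps of the first `n` generations and the remaining
`2 ^ n` intervals. -/
theorem abs_sub_le_sum_gaps (l : ℝ) (f : ℝ → ℝ) (n : ℕ) :
    |f 1 - f (-1)| ≤
      (∑ k ∈ Finset.range n, ∑ w : Fin k → Bool,
        |f (center l w + l ^ k * (1 - 2 * l)) - f (center l w - l ^ k * (1 - 2 * l))|) +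
      ∑ w : Fin n → Bool, |f (center l w + l ^ n) - f (center l w - l ^ n)| := by
  induction n with
  | zero => simp [center]
  | succ n ih =>
    refine ih.trans ?_
    rw [Finset.sum_range_succ, add_assoc]
    gcongr
    rw [← (Fin.snocEquiv fun _ : Fin (n + 1) => Bool).sum_comp, Fintype.sum_prod_type,
      Finset.sum_comm, ← Finset.sum_add_distrib]
    refine Finset.sum_le_sum fun w _ => ?_
    have hs : ∀ b, (Fin.snocEquiv fun _ : Fin (n + 1) => Bool) (b, w) =
      (Fin.snoc w b : Fin (n + 1) → Bool) := fun b => rfl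
    simp only [Fintype.sum_bool, hs, center_snoc, sgn, if_true, Bool.false_eq_true, if_false]
    rw [show center l w + 1 * (1 - l) * l ^ n + l ^ (n + 1) = center l w + l ^ n by ring,
      show center l w + 1 * (1 - l) * l ^ n - l ^ (n + 1) =
        center l w + l ^ n * (1 - 2 * l) by ring,
      show center l w + -1 * (1 - l) * l ^ n + l ^ (n + 1) =
        center l w - l ^ n * (1 - 2 * l) by ring,
      show center l w + -1 * (1 - l) * l ^ n - l ^ (n + 1) = center l w - l ^ n by ring]
    have h1 := abs_sub_le (f (center l w + l ^ n)) (f (center l w + l ^ n * (1 - 2 * l)))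
      (f (center l w - l ^ n))
    have h2 := abs_sub_le (f (center l w + l ^ n * (1 - 2 * l)))
      (f (center l w - l ^ n * (1 - 2 * l))) (f (center l w - l ^ n))
    linarith

/-- The remainder in `abs_sub_le_sum_gaps` vanishes in the limit for Lipschitz functions, since the
Cantor set has length zero. -/
theorem abs_sub_le_of_gap_bound {l : ℝ} (h0 : 0 < l) (h1 : l < 1 / 2) {f : ℝ → ℝ} {L : ℝ}
    (hL : ∀ x ∈ Icc (-1 : ℝ) 1, ∀ y ∈ Icc (-1 : ℝ) 1, |f x - f y| ≤ L * |x - y|) {D θ : ℝ}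
    (hD : 0 ≤ D) (hθ0 : 0 ≤ θ) (hθ : θ < 1)
    (hgap : ∀ k, ∑ w : Fin k → Bool,
      |f (center l w + l ^ k * (1 - 2 * l)) - f (center l w - l ^ k * (1 - 2 * l))| ≤ D * θ ^ k) :
    |f 1 - f (-1)| ≤ D / (1 - θ) := by
  have hn : ∀ n : ℕ, |f 1 - f (-1)| ≤ D / (1 - θ) + 2 * L * (2 * l) ^ n := by
    intro n
    refine (abs_sub_le_sum_gaps l f n).trans (add_le_add ?_ ?_)
    · calc _ ≤ ∑ k ∈ Finset.range n, D * θ ^ k := Finset.sum_le_sum fun k _ => hgap k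
        _ ≤ ∑' k, D * θ ^ k :=
          ((summable_geometric_of_lt_one hθ0 hθ).mul_left D).sum_le_tsum _
            fun k _ => by positivity
        _ = _ := by rw [tsum_mul_left, tsum_geometric_of_lt_one hθ0 hθ, div_eq_mul_inv]
    · calc _ ≤ ∑ _w : Fin n → Bool, L * (2 * l ^ n) := by
            refine Finset.sum_le_sum fun w _ => ?_
            have hc := abs_center_add_le h0 h1 w
            have hc' := abs_le.1 (le_sub_iff_add_le.2 hc)
            have hln : 0 < l ^ n := by positivity
            refine (hL _ ⟨by linarith, by linarith⟩ _ ⟨by linarith, by linarith⟩).trans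
              (le_of_eq ?_)
            rw [show center l w + l ^ n - (center l w - l ^ n) = 2 * l ^ n by ring,
              abs_of_pos (by positivity)]
        _ = _ := by simp [mul_pow]; ring
  have ht : Filter.Tendsto (fun n : ℕ => D / (1 - θ) + 2 * L * (2 * l) ^ n) Filter.atTop
      (nhds (D / (1 - θ) + 2 * L * 0)) :=
    tendsto_const_nhds.add ((tendsto_pow_atTop_nhds_zero_of_lt_one (by positivity)
      (by linarith)).const_mul _)
  rw [mul_zero, add_zero] at ht
  exact ge_of_tendsto' ht hn

/-- Hölder's inequality for finite sums. -/
theorem sum_rpow_one_div_le {ι : Type*} (s : Finset ι) {q : ℝ} (hq : 1 < q) {F : ι → ℝ}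
    (hF : ∀ i, 0 ≤ F i) :
    ∑ i ∈ s, F i ^ (1 / q) ≤ (s.card : ℝ) ^ (1 - 1 / q) * (∑ i ∈ s, F i) ^ (1 / q) := by
  have hq0 : 0 < q := by linarith
  have h := Real.rpow_sum_le_const_mul_sum_rpow_of_nonneg s (f := fun i => F i ^ (1 / q)) hq.le
    fun i _ => Real.rpow_nonneg (hF i) _
  simp only [← Real.rpow_mul (hF _), one_div_mul_cancel hq0.ne', Real.rpow_one] at h
  have hS : 0 ≤ ∑ i ∈ s, F i ^ (1 / q) := Finset.sum_nonneg fun i _ => Real.rpow_nonneg (hF i) _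
  have h2 := Real.rpow_le_rpow (by positivity) h (one_div_nonneg.2 hq0.le)
  rw [← Real.rpow_mul hS, mul_one_div_cancel hq0.ne', Real.rpow_one,
    Real.mul_rpow (by positivity) (Finset.sum_nonneg fun i _ => hF i),
    ← Real.rpow_mul (by positivity)] at h2
  rwa [show (q - 1) * (1 / q) = 1 - 1 / q by field_simp] at h2

theorem exists_lipschitz_on_axis (i₀ : Fin d) {ψ : 𝔼 → ℝ} (hψ : ContDiff ℝ 1 ψ) :
    ∃ L : ℝ, ∀ x ∈ Icc (-1 : ℝ) 1, ∀ y ∈ Icc (-1 : ℝ) 1,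
      |ψ (EuclideanSpace.single i₀ x) - ψ (EuclideanSpace.single i₀ y)| ≤ L * |x - y| := by
  have hs : (fun t : ℝ => (EuclideanSpace.single i₀ t : 𝔼)) =
      fun t => t • (EuclideanSpace.single i₀ (1 : ℝ) : 𝔼) := by
    ext t i; simp
  have hf : ContDiff ℝ 1 fun t : ℝ => ψ (EuclideanSpace.single i₀ t) := by
    have hs' : ContDiff ℝ 1 fun t : ℝ => (EuclideanSpace.single i₀ t : 𝔼) := by
      rw [hs]; fun_prop
    exact hψ.comp hs'
  obtain ⟨L, hL⟩ := isCompact_Icc.exists_bound_of_continuousOn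
    (hf.continuous_deriv (by simp)).continuousOn (s := Icc (-1 : ℝ) 1)
  refine ⟨L, fun x hx y hy => ?_⟩
  exact (convex_Icc (-1 : ℝ) 1).norm_image_sub_le_of_norm_deriv_le
    (fun z _ => hf.differentiable (by simp) z) hL hy hx

/-- If the oscillation of `ψ` on balls inside the gap balls is controlled by an energy which is
additive over each generation, then the increment of `ψ` across the whole Cantor set is controlled
by this energy. -/
theorem exists_axis_bound (hd : 1 ≤ d) {q τ l : ℝ} (hq : 1 < q) (hτ : 0 < τ) (h0 : 0 < l)
    (h1 : l < 1 / 2) (hθ : 2 ^ (1 - 1 / q) * l ^ τ < 1) (i₀ : Fin d) :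
    ∃ C : ℝ, 0 ≤ C ∧ ∀ (ψ : 𝔼 → ℝ), ContDiff ℝ 1 ψ → ∀ (E : ℝ)
      (F : (k : ℕ) → (Fin k → Bool) → ℝ), (∀ k w, 0 ≤ F k w) → (∀ k, ∑ w, F k w ≤ E) →
      (∀ k (w : Fin k → Bool) z r, 0 < r → Metric.ball z r ⊆ gapBall l i₀ w →
        ∫⁻ x in Metric.ball z (3 / 4 * r), ∫⁻ y in Metric.ball z (3 / 4 * r),
          ‖ψ x - ψ y‖ₑ ^ q ≤ ENNReal.ofReal (F k w * r ^ (2 * (d : ℝ) + τ * q))) →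
      |ψ (EuclideanSpace.single i₀ 1) - ψ (EuclideanSpace.single i₀ (-1))| ≤
        C * E ^ (1 / q) := by
  obtain ⟨C, hC, h⟩ := exists_diameter_bound hd hq hτ
  have hq0 : 0 < q := by linarith
  set θ : ℝ := 2 ^ (1 - 1 / q) * l ^ τ with hθdef
  have hθ0 : 0 ≤ θ := by positivity
  refine ⟨C / (1 - θ), div_nonneg hC (by linarith), fun ψ hψ E F hF hFE ho => ?_⟩
  obtain ⟨L, hL⟩ := exists_lipschitz_on_axis i₀ hψ
  have hE : 0 ≤ E := (Finset.sum_nonneg fun w _ => hF 0 w).trans (hFE 0)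
  have hgap : ∀ k, ∑ w : Fin k → Bool,
      |ψ (EuclideanSpace.single i₀ (center l w + l ^ k * (1 - 2 * l))) -
        ψ (EuclideanSpace.single i₀ (center l w - l ^ k * (1 - 2 * l)))| ≤
      C * E ^ (1 / q) * θ ^ k := by
    intro k
    have hlk : 0 < l ^ k := by positivity
    have hR : 0 < l ^ k * (1 - 2 * l) := mul_pos hlk (by linarith)
    have hRl : l ^ k * (1 - 2 * l) ≤ l ^ k := mul_le_of_le_one_right hlk.le (by linarith)
    have h2 : ∀ w : Fin k → Bool,
        |ψ (EuclideanSpace.single i₀ (center l w + l ^ k * (1 - 2 * l))) -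
          ψ (EuclideanSpace.single i₀ (center l w - l ^ k * (1 - 2 * l)))| ≤
        C * (F k w ^ (1 / q) * (l ^ k) ^ τ) := by
      intro w
      have h3 := h ψ hψ.continuous (EuclideanSpace.single i₀ (center l w))
        (EuclideanSpace.single i₀ 1) (by simp) _ _ hR (hF k w) (ho k w)
      have ea : ∀ a b : ℝ, (EuclideanSpace.single i₀ a : 𝔼) + b • EuclideanSpace.single i₀ 1 =
          EuclideanSpace.single i₀ (a + b) := by
        intro a b; ext i; by_cases hi : i = i₀ <;> simp [hi]
      have es : ∀ a b : ℝ, (EuclideanSpace.single i₀ a : 𝔼) - b • EuclideanSpace.single i₀ 1 =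
          EuclideanSpace.single i₀ (a - b) := by
        intro a b; ext i; by_cases hi : i = i₀ <;> simp [hi]
      rw [ea, es] at h3
      refine h3.trans ?_
      have := hF k w
      gcongr
    calc _ ≤ ∑ w : Fin k → Bool, C * (F k w ^ (1 / q) * (l ^ k) ^ τ) :=
          Finset.sum_le_sum fun w _ => h2 w
      _ = C * (l ^ k) ^ τ * ∑ w : Fin k → Bool, F k w ^ (1 / q) := by
          rw [Finset.mul_sum]
          exact Finset.sum_congr rfl fun w _ => by ring
      _ ≤ C * (l ^ k) ^ τ * (((2 : ℝ) ^ k) ^ (1 - 1 / q) * E ^ (1 / q)) := by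
          gcongr
          refine (sum_rpow_one_div_le _ hq (hF k)).trans ?_
          have hcard : ((Finset.univ : Finset (Fin k → Bool)).card : ℝ) = 2 ^ k := by simp
          rw [hcard]
          have := Finset.sum_nonneg fun w (_ : w ∈ Finset.univ) => hF k w
          gcongr
          exact hFE k
      _ = _ := by
          rw [hθdef, mul_pow, ← Real.rpow_natCast_mul h0.le, ← Real.rpow_natCast_mul two_pos.le,
            mul_comm (k : ℝ), mul_comm (k : ℝ), Real.rpow_mul_natCast h0.le,
            Real.rpow_mul_natCast two_pos.le]
          ring
  refine (abs_sub_le_of_gap_bound h0 h1 hL (by positivity) hθ0 hθ hgap).trans (le_of_eq ?_)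
  ring

theorem sum_lintegral_gapBall_le {l : ℝ} (h0 : 0 < l) (h1 : l < 1 / 2) (i₀ : Fin d) (k : ℕ)
    {S : Set 𝔼} (hS : ∀ w : Fin k → Bool, gapBall l i₀ w ⊆ S) (g : 𝔼 → ℝ≥0∞) :
    ∑ w : Fin k → Bool, ∫⁻ x in gapBall l i₀ w, g x ≤ ∫⁻ x in S, g x := by
  have hm : ∀ w : Fin k → Bool, MeasurableSet (gapBall l i₀ w) := fun w => measurableSet_ball
  rw [← tsum_fintype (L := .unconditional _), ← lintegral_iUnion hm
    (fun w w' hw => disjoint_gapBall h0 h1 i₀ hw)]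
  exact lintegral_mono_set (iUnion_subset hS)

/-- Passage from an increment bound to a lower bound of the energy. -/
theorem ofReal_le_of_one_le_mul_rpow {q C c : ℝ} (hq : 1 < q) (hC : 0 ≤ C) (hc : 0 < c)
    {E : ℝ≥0∞} (h : E ≠ ⊤ → 1 ≤ C * (c * E.toReal) ^ (1 / q)) :
    ENNReal.ofReal ((C + 1)⁻¹ ^ q / c) ≤ E := by
  by_cases hE : E = ⊤
  · simp [hE]
  have hq0 : 0 < q := by linarith
  refine (ENNReal.ofReal_le_iff_le_toReal hE).2 ?_
  have hX : 0 ≤ c * E.toReal := by positivity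
  have h2 : (C + 1)⁻¹ ≤ (c * E.toReal) ^ (1 / q) := by
    rw [inv_le_iff_one_le_mul₀ (by linarith)]
    have : 0 ≤ (c * E.toReal) ^ (1 / q) := by positivity
    linarith [h hE]
  have h3 := Real.rpow_le_rpow (by positivity) h2 hq0.le
  rw [← Real.rpow_mul hX, one_div_mul_cancel hq0.ne', Real.rpow_one] at h3
  rw [div_le_iff₀ hc]
  linarith

/-- Lower bound for the nonlocal phase when the weight on each gap ball dominates the `α`-th power
of the distance to its complement. -/
theorem exists_nonlocalPhase_lower_bound (hd : 1 ≤ d) {t q α l : ℝ} (hq : 1 < q)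
    (ht : 0 < t) (hτ : 0 < t - (d + α) / q) (h0 : 0 < l) (h1 : l < 1 / 2)
    (hθ : 2 ^ (1 - 1 / q) * l ^ (t - (d + α) / q) < 1) (i₀ : Fin d) {a : 𝔼 → 𝔼 → ℝ}
    (ha : ∀ (k : ℕ) (w : Fin k → Bool) x y r, 0 < r → Metric.ball x r ⊆ gapBall l i₀ w →
      Metric.ball y r ⊆ gapBall l i₀ w → r ^ α ≤ a x y) :
    ∃ c : ℝ, 0 < c ∧ ∀ ψ : 𝔼 → ℝ, ContDiff ℝ 1 ψ →
      |ψ (EuclideanSpace.single i₀ 1) - ψ (EuclideanSpace.single i₀ (-1))| = 1 →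
      ENNReal.ofReal c ≤ nonlocalPhase t q a ψ := by
  obtain ⟨C, hC, h⟩ := exists_axis_bound hd hq hτ h0 h1 hθ i₀
  have hq0 : 0 < q := by linarith
  set c₀ : ℝ := q * 4 ^ α * (3 / 2) ^ ((d : ℝ) + t * q) with hc₀def
  have hc₀ : 0 < c₀ := by positivity
  refine ⟨(C + 1)⁻¹ ^ q / c₀, by positivity, fun ψ hψ h1' => ?_⟩
  refine ofReal_le_of_one_le_mul_rpow hq hC hc₀ fun hfin => ?_
  let f : 𝔼 → 𝔼 → ℝ≥0∞ := fun x y => ENNReal.ofReal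
    (1 / q * a x y * (|ψ x - ψ y| ^ q / ‖x - y‖ ^ ((d : ℝ) + t * q)))
  let e : (k : ℕ) → (Fin k → Bool) → ℝ≥0∞ := fun k w =>
    ∫⁻ x in gapBall l i₀ w, ∫⁻ y in gapBall l i₀ w, f x y
  have hsum : ∀ k, ∑ w, e k w ≤ nonlocalPhase t q a ψ := by
    intro k
    calc ∑ w, e k w ≤ ∑ w : Fin k → Bool, ∫⁻ x in gapBall l i₀ w, ∫⁻ y, f x y :=
          Finset.sum_le_sum fun w _ => lintegral_mono fun x => setLIntegral_le_lintegral _ _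
      _ ≤ ∫⁻ x in univ, ∫⁻ y, f x y :=
          sum_lintegral_gapBall_le h0 h1 i₀ k (fun w => subset_univ _) _
      _ = _ := by rw [setLIntegral_univ]; rfl
  have hefin : ∀ k w, e k w ≠ ⊤ := fun k w => ne_top_of_le_ne_top hfin
    ((Finset.single_le_sum (f := e k) (fun _ _ => zero_le) (Finset.mem_univ w)).trans (hsum k))
  refine h1'.symm.le.trans (h ψ hψ _ (fun k w => c₀ * (e k w).toReal)
    (fun k w => by positivity) (fun k => ?_) ?_)
  · rw [← Finset.mul_sum, ← ENNReal.toReal_sum fun w _ => hefin k w]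
    gcongr
    exact hsum k
  intro k w z r hr hball
  have hsub : Metric.ball z (3 / 4 * r) ⊆ gapBall l i₀ w :=
    (Metric.ball_subset_ball (by linarith)).trans hball
  have hpt : ∀ x ∈ Metric.ball z (3 / 4 * r), ∀ y ∈ Metric.ball z (3 / 4 * r),
      ‖ψ x - ψ y‖ₑ ^ q ≤ ENNReal.ofReal (c₀ * r ^ (2 * (d : ℝ) + (t - (d + α) / q) * q)) *
        f x y := by
    intro x hx y hy
    have hx' : Metric.ball x (r / 4) ⊆ gapBall l i₀ w := by
      refine (Metric.ball_subset_ball' ?_).trans hball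
      rw [Metric.mem_ball] at hx; linarith
    have hy' : Metric.ball y (r / 4) ⊆ gapBall l i₀ w := by
      refine (Metric.ball_subset_ball' ?_).trans hball
      rw [Metric.mem_ball] at hy; linarith
    have hw := ha k w x y (r / 4) (by positivity) hx' hy'
    by_cases hxy : x = y
    · simp [hxy, hq0]
    have hn : 0 < ‖x - y‖ := norm_pos_iff.2 (sub_ne_zero.2 hxy)
    have hn2 : ‖x - y‖ ≤ 3 / 2 * r := by
      have := dist_triangle_right x y z
      rw [dist_eq_norm] at this
      rw [Metric.mem_ball] at hx hy
      linarith
    have hexp : 0 ≤ (d : ℝ) + t * q := by positivity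
    rw [← ofReal_norm, ENNReal.ofReal_rpow_of_nonneg (norm_nonneg _) hq0.le,
      ← ENNReal.ofReal_mul (by positivity)]
    refine ENNReal.ofReal_le_ofReal ?_
    have e1 : c₀ * r ^ (2 * (d : ℝ) + (t - (d + α) / q) * q) * (1 / q * (r / 4) ^ α) =
        (3 / 2 * r) ^ ((d : ℝ) + t * q) := by
      rw [show 2 * (d : ℝ) + (t - (d + α) / q) * q = (d + t * q) - α by field_simp; ring,
        Real.rpow_sub hr, Real.div_rpow hr.le (by norm_num), Real.mul_rpow (by norm_num) hr.le,
        hc₀def]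
      have : r ^ α ≠ 0 := by positivity
      have : (4 : ℝ) ^ α ≠ 0 := by positivity
      field_simp
    calc ‖ψ x - ψ y‖ ^ q
        = ‖x - y‖ ^ ((d : ℝ) + t * q) * (|ψ x - ψ y| ^ q / ‖x - y‖ ^ ((d : ℝ) + t * q)) := by
          rw [Real.norm_eq_abs]
          have : ‖x - y‖ ^ ((d : ℝ) + t * q) ≠ 0 := by positivity
          field_simp
      _ ≤ (3 / 2 * r) ^ ((d : ℝ) + t * q) *
          (|ψ x - ψ y| ^ q / ‖x - y‖ ^ ((d : ℝ) + t * q)) := by gcongr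
      _ = c₀ * r ^ (2 * (d : ℝ) + (t - (d + α) / q) * q) * (1 / q * (r / 4) ^ α *
          (|ψ x - ψ y| ^ q / ‖x - y‖ ^ ((d : ℝ) + t * q))) := by rw [← e1]; ring
      _ ≤ _ := by gcongr
  calc ∫⁻ x in Metric.ball z (3 / 4 * r), ∫⁻ y in Metric.ball z (3 / 4 * r), ‖ψ x - ψ y‖ₑ ^ q
      ≤ ∫⁻ x in Metric.ball z (3 / 4 * r), ∫⁻ y in Metric.ball z (3 / 4 * r),
          ENNReal.ofReal (c₀ * r ^ (2 * (d : ℝ) + (t - (d + α) / q) * q)) * f x y :=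
        setLIntegral_mono' measurableSet_ball fun x hx =>
          setLIntegral_mono' measurableSet_ball fun y hy => hpt x hx y hy
    _ = ENNReal.ofReal (c₀ * r ^ (2 * (d : ℝ) + (t - (d + α) / q) * q)) *
        ∫⁻ x in Metric.ball z (3 / 4 * r), ∫⁻ y in Metric.ball z (3 / 4 * r), f x y := by
        simp only [lintegral_const_mul' _ _ ENNReal.ofReal_ne_top]
    _ ≤ ENNReal.ofReal (c₀ * r ^ (2 * (d : ℝ) + (t - (d + α) / q) * q)) * e k w := by
        gcongr
        exact (lintegral_mono_set hsub).trans (lintegral_mono fun x => lintegral_mono_set hsub)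
    _ = _ := by
        rw [← ENNReal.ofReal_toReal (hefin k w), ← ENNReal.ofReal_mul (by positivity),
          ENNReal.toReal_ofReal (by positivity)]
        congr 1
        ring

/-- Lower bound for the local phase, for weights as in `exists_nonlocalPhase_lower_bound`. -/
theorem exists_localPhase_lower_bound (hd : 1 ≤ d) {q α l : ℝ} (hq : 1 < q)
    (hτ : 0 < 1 - (d + α) / q) (h0 : 0 < l) (h1 : l < 1 / 2)
    (hθ : 2 ^ (1 - 1 / q) * l ^ (1 - (d + α) / q) < 1) (i₀ : Fin d) {a : 𝔼 → ℝ}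
    (ha : ∀ (k : ℕ) (w : Fin k → Bool) x r, 0 < r → Metric.ball x r ⊆ gapBall l i₀ w →
      r ^ α ≤ a x) :
    ∃ c : ℝ, 0 < c ∧ ∀ ψ : 𝔼 → ℝ, ContDiff ℝ 1 ψ →
      |ψ (EuclideanSpace.single i₀ 1) - ψ (EuclideanSpace.single i₀ (-1))| = 1 →
      ENNReal.ofReal c ≤ localPhase q a ψ := by
  obtain ⟨C, hC, h⟩ := exists_axis_bound hd hq hτ h0 h1 hθ i₀
  have hq0 : 0 < q := by linarith
  have : Nontrivial 𝔼 := nontrivial_euclideanSpace hd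
  set V : ℝ := (volume (Metric.ball (0 : 𝔼) 1)).toReal with hV
  have hV0 : 0 < V := ENNReal.toReal_pos (Metric.measure_ball_pos volume _ one_pos).ne'
    measure_ball_lt_top.ne
  set c₀ : ℝ := 2 ^ q * (3 / 2) ^ q * 2 ^ d * (3 / 4) ^ d * V * q * 4 ^ α with hc₀def
  have hc₀ : 0 < c₀ := by positivity
  refine ⟨(C + 1)⁻¹ ^ q / c₀, by positivity, fun ψ hψ h1' => ?_⟩
  refine ofReal_le_of_one_le_mul_rpow hq hC hc₀ fun hfin => ?_
  rw [localPhase_eq_of_contDiff q a hψ] at hfin ⊢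
  let f : 𝔼 → ℝ≥0∞ := fun x => ENNReal.ofReal (1 / q * a x * ‖gradient ψ x‖ ^ q)
  let e : (k : ℕ) → (Fin k → Bool) → ℝ≥0∞ := fun k w => ∫⁻ x in gapBall l i₀ w, f x
  have hsum : ∀ k, ∑ w, e k w ≤ ∫⁻ x in cube d 1, f x := fun k =>
    sum_lintegral_gapBall_le h0 h1 i₀ k (fun w x hx i =>
      (abs_apply_le_norm x i).trans_lt
        (mem_ball_zero_iff.1 (gapBall_subset_ball h0 h1 i₀ w hx))) _
  have hefin : ∀ k w, e k w ≠ ⊤ := fun k w => ne_top_of_le_ne_top hfin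
    ((Finset.single_le_sum (f := e k) (fun _ _ => zero_le) (Finset.mem_univ w)).trans (hsum k))
  refine h1'.symm.le.trans (h ψ hψ _ (fun k w => c₀ * (e k w).toReal)
    (fun k w => by positivity) (fun k => ?_) ?_)
  · rw [← Finset.mul_sum, ← ENNReal.toReal_sum fun w _ => hefin k w]
    gcongr
    exact hsum k
  intro k w z r hr hball
  have hsub : Metric.ball z (3 / 4 * r) ⊆ gapBall l i₀ w :=
    (Metric.ball_subset_ball (by linarith)).trans hball
  have hpt : ∀ x ∈ Metric.ball z (3 / 4 * r), ‖gradient ψ x‖ₑ ^ q ≤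
      ENNReal.ofReal (q * (r / 4) ^ (-α)) * f x := by
    intro x hx
    have hx' : Metric.ball x (r / 4) ⊆ gapBall l i₀ w := by
      refine (Metric.ball_subset_ball' ?_).trans hball
      rw [Metric.mem_ball] at hx; linarith
    have hw := ha k w x (r / 4) (by positivity) hx'
    rw [← ofReal_norm, ENNReal.ofReal_rpow_of_nonneg (norm_nonneg _) hq0.le,
      ← ENNReal.ofReal_mul (by positivity)]
    refine ENNReal.ofReal_le_ofReal ?_
    have hr4 : 0 < (r / 4) ^ α := by positivity
    calc ‖gradient ψ x‖ ^ q = q * (r / 4) ^ (-α) *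
          (1 / q * (r / 4) ^ α * ‖gradient ψ x‖ ^ q) := by
          rw [Real.rpow_neg (by positivity)]; field_simp
      _ ≤ _ := by gcongr
  have hI : ∫⁻ x in Metric.ball z (3 / 4 * r), ‖gradient ψ x‖ₑ ^ q ≤
      ENNReal.ofReal (q * (r / 4) ^ (-α)) * e k w := by
    calc _ ≤ ∫⁻ x in Metric.ball z (3 / 4 * r), ENNReal.ofReal (q * (r / 4) ^ (-α)) * f x :=
          setLIntegral_mono' measurableSet_ball hpt
      _ = ENNReal.ofReal (q * (r / 4) ^ (-α)) * ∫⁻ x in Metric.ball z (3 / 4 * r), f x :=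
          lintegral_const_mul' _ _ ENNReal.ofReal_ne_top
      _ ≤ _ := by gcongr; exact lintegral_mono_set hsub
  have hr34 : 0 < 3 / 4 * r := by positivity
  refine (lintegral_ball_oscillation_le hq hψ z hr34).trans ?_
  refine (mul_le_mul_right hI _).trans (le_of_eq ?_)
  rw [Measure.addHaar_ball_of_pos _ _ hr34, finrank_euclideanSpace_fin,
    ← ENNReal.ofReal_toReal (measure_ball_lt_top (μ := volume) (x := (0 : 𝔼)) (r := 1)).ne, ← hV,
    ← ENNReal.ofReal_toReal (hefin k w), ← ENNReal.ofReal_mul (by positivity),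
    ← ENNReal.ofReal_mul (by positivity), ← ENNReal.ofReal_mul (by positivity),
    ← ENNReal.ofReal_mul (by positivity), ENNReal.toReal_ofReal (by positivity)]
  congr 1
  rw [show 2 * (d : ℝ) + (1 - (d + α) / q) * q = q + d - α by field_simp; ring,
    Real.rpow_sub hr, Real.rpow_add hr, Real.rpow_natCast, hc₀def,
    show 2 * (3 / 4 * r) = 3 / 2 * r by ring, Real.mul_rpow (by norm_num) hr.le,
    Real.rpow_neg (by positivity), Real.div_rpow hr.le (by norm_num), mul_pow]
  have : r ^ α ≠ 0 := by positivity
  have : (4 : ℝ) ^ α ≠ 0 := by positivity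
  field_simp

/-! ### Powers of the distance to a complement as weights -/

/-- The weight `dist(x, Kᶜ)^β`. It vanishes off `K` (for `β > 0`) and is globally `β`-Hölder. -/
noncomputable def distWeight {X : Type*} [PseudoMetricSpace X] (K : Set X) (β : ℝ) (x : X) : ℝ :=
  Metric.infDist x Kᶜ ^ β

section DistWeight

variable {X : Type*} [PseudoMetricSpace X] {K : Set X} {β : ℝ}

theorem distWeight_nonneg (K : Set X) (β : ℝ) (x : X) : 0 ≤ distWeight K β x :=
  Real.rpow_nonneg Metric.infDist_nonneg _

theorem distWeight_eq_zero (hβ : 0 < β) {x : X} (hx : x ∉ K) : distWeight K β x = 0 := by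
  rw [distWeight, Metric.infDist_zero_of_mem (mem_compl hx), Real.zero_rpow hβ.ne']

theorem continuous_distWeight (hβ : 0 ≤ β) : Continuous (distWeight K β) :=
  (Metric.continuous_infDist_pt _).rpow_const fun _ => Or.inr hβ

theorem rpow_le_distWeight (hβ : 0 ≤ β) (hK : Kᶜ.Nonempty) {x : X} {r : ℝ} (hr : 0 ≤ r)
    (h : Metric.ball x r ⊆ K) : r ^ β ≤ distWeight K β x := by
  refine Real.rpow_le_rpow hr ((Metric.le_infDist hK).2 fun y hy => ?_) hβ
  by_contra hc
  exact hy (h (by rw [Metric.mem_ball']; exact not_le.1 hc))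

theorem abs_rpow_sub_rpow_le {a b : ℝ} (ha : 0 ≤ a) (hb : 0 ≤ b) (hβ : 0 ≤ β) (hβ1 : β ≤ 1) :
    |a ^ β - b ^ β| ≤ |a - b| ^ β := by
  have key : ∀ {x y : ℝ}, 0 ≤ x → 0 ≤ y → x ^ β - y ^ β ≤ |x - y| ^ β := by
    intro x y hx hy
    have h1 := Real.rpow_add_le_add_rpow hy (abs_nonneg (x - y)) hβ hβ1
    have h2 : x ^ β ≤ (y + |x - y|) ^ β :=
      Real.rpow_le_rpow hx (by linarith [le_abs_self (x - y)]) hβ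
    linarith
  rw [abs_sub_le_iff]
  exact ⟨key ha hb, abs_sub_comm a b ▸ key hb ha⟩

/-- On bounded sets the weight has every Hölder exponent up to `β`. -/
theorem isHolderClass_distWeight (hβ : 0 < β) (hβ1 : β ≤ 1) {α M : ℝ} (hα : α ≤ β) (hM : 0 ≤ M)
    {S : Set X} (hS : Bornology.IsBounded S) :
    IsHolderClass α S fun x => M * distWeight K β x := by
  refine ⟨((continuous_distWeight hβ.le).const_mul M).continuousOn,
    HolderOnWith.exists_holderOnWith_of_le (r := β.toNNReal) ⟨M.toNNReal, fun x _ y _ => ?_⟩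
      (Real.toNNReal_le_toNNReal hα) hS⟩
  rw [edist_dist, edist_dist, Real.coe_toNNReal _ hβ.le,
    ENNReal.ofReal_rpow_of_nonneg dist_nonneg hβ.le, ← ENNReal.ofReal.eq_1,
    ← ENNReal.ofReal_mul hM]
  refine ENNReal.ofReal_le_ofReal ?_
  rw [Real.dist_eq, ← mul_sub, abs_mul, abs_of_nonneg hM]
  refine mul_le_mul_of_nonneg_left ?_ hM
  refine (abs_rpow_sub_rpow_le Metric.infDist_nonneg Metric.infDist_nonneg hβ.le hβ1).trans ?_
  refine Real.rpow_le_rpow (abs_nonneg _) ?_ hβ.le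
  have := (Metric.lipschitz_infDist_pt Kᶜ).dist_le_mul x y
  rwa [Real.dist_eq, NNReal.coe_one, one_mul] at this

end DistWeight

theorem compl_nonempty_of_subset_ball {E : Type*} [NormedAddCommGroup E] [NormedSpace ℝ E]
    [Nontrivial E] {K : Set E} (hK : K ⊆ Metric.ball 0 1) : Kᶜ.Nonempty := by
  obtain ⟨z, hz⟩ := NormedSpace.exists_lt_norm ℝ E 1
  exact ⟨z, fun h => by linarith [mem_ball_zero_iff.1 (hK h)]⟩

theorem exists_distWeight_le {E : Type*} [NormedAddCommGroup E] [NormedSpace ℝ E]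
    [Nontrivial E] {K : Set E} (hK : K ⊆ Metric.ball 0 1) {β : ℝ} (hβ : 0 < β) :
    ∃ B : ℝ, ∀ x, distWeight K β x ≤ B := by
  obtain ⟨z, hz⟩ := compl_nonempty_of_subset_ball hK
  refine ⟨(1 + ‖z‖) ^ β, fun x => ?_⟩
  by_cases hx : x ∈ K
  · refine Real.rpow_le_rpow Metric.infDist_nonneg ((Metric.infDist_le_dist_of_mem hz).trans ?_)
      hβ.le
    rw [dist_eq_norm]
    linarith [norm_sub_le x z, mem_ball_zero_iff.1 (hK hx)]
  · rw [distWeight_eq_zero hβ hx]; positivity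

/-! ### The weights supported by the gap balls -/

/-- The union of the gap balls of all generations. -/
def gapSet (l : ℝ) (i₀ : Fin d) : Set 𝔼 := ⋃ (k : ℕ) (w : Fin k → Bool), gapBall l i₀ w

/-- The pairs of points lying in a common gap ball. -/
def gapPairSet (l : ℝ) (i₀ : Fin d) : Set (𝔼 × 𝔼) :=
  ⋃ (k : ℕ) (w : Fin k → Bool), gapBall l i₀ w ×ˢ gapBall l i₀ w

theorem mem_gapSet {l : ℝ} {i₀ : Fin d} {x : 𝔼} :
    x ∈ gapSet l i₀ ↔ ∃ (k : ℕ) (w : Fin k → Bool), x ∈ gapBall l i₀ w := by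
  simp [gapSet]

theorem mem_gapPairSet {l : ℝ} {i₀ : Fin d} {z : 𝔼 × 𝔼} : z ∈ gapPairSet l i₀ ↔
    ∃ (k : ℕ) (w : Fin k → Bool), z.1 ∈ gapBall l i₀ w ∧ z.2 ∈ gapBall l i₀ w := by
  simp [gapPairSet]

theorem gapSet_subset_ball {l : ℝ} (h0 : 0 < l) (h1 : l < 1 / 2) (i₀ : Fin d) :
    gapSet l i₀ ⊆ Metric.ball 0 1 :=
  iUnion₂_subset fun _ w => gapBall_subset_ball h0 h1 i₀ w

theorem gapPairSet_subset_ball {l : ℝ} (h0 : 0 < l) (h1 : l < 1 / 2) (i₀ : Fin d) :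
    gapPairSet l i₀ ⊆ Metric.ball 0 1 := by
  refine iUnion₂_subset fun _ w => ?_
  rw [show (0 : 𝔼 × 𝔼) = (0, 0) from rfl, ← ball_prod_same]
  exact prod_mono (gapBall_subset_ball h0 h1 i₀ w) (gapBall_subset_ball h0 h1 i₀ w)

theorem distWeight_gapPairSet_symm (l : ℝ) (i₀ : Fin d) (β : ℝ) (x y : 𝔼) :
    distWeight (gapPairSet l i₀) β (x, y) = distWeight (gapPairSet l i₀) β (y, x) := by
  have hi : Isometry (Prod.swap : 𝔼 × 𝔼 → 𝔼 × 𝔼) :=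
    Isometry.of_dist_eq fun a b => by simp [Prod.dist_eq, max_comm]
  have hK : Prod.swap '' (gapPairSet l i₀)ᶜ = (gapPairSet l i₀)ᶜ := by
    rw [image_swap_eq_preimage_swap]
    ext z
    simp [mem_gapPairSet, and_comm]
  unfold distWeight
  conv_rhs => rw [← hK]
  exact congrArg (· ^ β) (Metric.infDist_image hi (x := (x, y))).symm

theorem isBounded_closure_cube : Bornology.IsBounded (closure (cube d 1)) := by
  refine (isBounded_iff_forall_norm_le.2 ⟨√d, fun x hx => ?_⟩).closure
  rw [EuclideanSpace.norm_eq]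
  refine Real.sqrt_le_sqrt ?_
  calc ∑ i, ‖x i‖ ^ 2 ≤ ∑ _i : Fin d, (1 : ℝ) := Finset.sum_le_sum fun i _ => by
        have := hx i
        rw [Real.norm_eq_abs]
        nlinarith [abs_nonneg (x i)]
    _ = d := by simp

theorem notMem_ball_of_notMem_cube_three {x : 𝔼} (hx : x ∉ cube d 3) :
    x ∉ Metric.ball (0 : 𝔼) 1 :=
  fun h => hx (ball_subset_cube_three (Metric.ball_subset_ball one_le_two h))

theorem isPointWeight_distWeight (hd : 1 ≤ d) {l : ℝ} (h0 : 0 < l) (h1 : l < 1 / 2) (i₀ : Fin d)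
    {α β M : ℝ} (hβ : 0 < β) (hβ1 : β ≤ 1) (hα : α ≤ β) (hM : 0 ≤ M) :
    IsPointWeight α fun x => M * distWeight (gapSet l i₀) β x := by
  have := nontrivial_euclideanSpace hd
  have hK := gapSet_subset_ball h0 h1 i₀
  refine ⟨fun x => mul_nonneg hM (distWeight_nonneg _ _ _), ?_,
    ((continuous_distWeight hβ.le).const_mul M).measurable, fun x hx => ?_,
    isHolderClass_distWeight hβ hβ1 hα hM isBounded_closure_cube⟩
  · obtain ⟨B, hB⟩ := exists_distWeight_le hK hβ
    exact ⟨M * B, fun x => mul_le_mul_of_nonneg_left (hB x) hM⟩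
  · rw [distWeight_eq_zero hβ fun h => notMem_ball_of_notMem_cube_three hx (hK h), mul_zero]

theorem isPairWeight_distWeight (hd : 1 ≤ d) {l : ℝ} (h0 : 0 < l) (h1 : l < 1 / 2) (i₀ : Fin d)
    {α β M : ℝ} (hβ : 0 < β) (hβ1 : β ≤ 1) (hα : α ≤ β) (hM : 0 ≤ M) :
    IsPairWeight α fun x y => M * distWeight (gapPairSet l i₀) β (x, y) := by
  have := nontrivial_euclideanSpace hd
  have hK := gapPairSet_subset_ball h0 h1 i₀
  refine ⟨fun x y => mul_nonneg hM (distWeight_nonneg _ _ _), ?_,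
    ((continuous_distWeight hβ.le).const_mul M).measurable,
    fun x y => by rw [distWeight_gapPairSet_symm], fun x y hxy => ?_,
    isHolderClass_distWeight hβ hβ1 hα hM (isBounded_closure_cube.prod isBounded_closure_cube)⟩
  · obtain ⟨B, hB⟩ := exists_distWeight_le hK hβ
    exact ⟨M * B, fun x y => mul_le_mul_of_nonneg_left (hB (x, y)) hM⟩
  · have hn : (x, y) ∉ gapPairSet l i₀ := fun h => by
      have hb := hK h
      rw [show (0 : 𝔼 × 𝔼) = (0, 0) from rfl, ← ball_prod_same] at hb
      exact hxy.elim (fun hx => notMem_ball_of_notMem_cube_three hx hb.1)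
        fun hy => notMem_ball_of_notMem_cube_three hy hb.2
    rw [distWeight_eq_zero hβ hn, mul_zero]

theorem rpow_le_distWeight_gapSet (hd : 1 ≤ d) {l : ℝ} (h0 : 0 < l) (h1 : l < 1 / 2)
    (i₀ : Fin d) {β : ℝ} (hβ : 0 < β) (k : ℕ) (w : Fin k → Bool) (x : 𝔼) (r : ℝ) (hr : 0 < r)
    (hx : Metric.ball x r ⊆ gapBall l i₀ w) : r ^ β ≤ distWeight (gapSet l i₀) β x := by
  have := nontrivial_euclideanSpace hd
  exact rpow_le_distWeight hβ.le (compl_nonempty_of_subset_ball (gapSet_subset_ball h0 h1 i₀))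
    hr.le fun y hy => mem_gapSet.2 ⟨k, w, hx hy⟩

theorem rpow_le_distWeight_gapPairSet (hd : 1 ≤ d) {l : ℝ} (h0 : 0 < l) (h1 : l < 1 / 2)
    (i₀ : Fin d) {β : ℝ} (hβ : 0 < β) (k : ℕ) (w : Fin k → Bool) (x y : 𝔼) (r : ℝ) (hr : 0 < r)
    (hx : Metric.ball x r ⊆ gapBall l i₀ w) (hy : Metric.ball y r ⊆ gapBall l i₀ w) :
    r ^ β ≤ distWeight (gapPairSet l i₀) β (x, y) := by
  have := nontrivial_euclideanSpace hd
  refine rpow_le_distWeight hβ.le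
    (compl_nonempty_of_subset_ball (gapPairSet_subset_ball h0 h1 i₀)) hr.le fun z hz => ?_
  rw [← ball_prod_same] at hz
  exact mem_gapPairSet.2 ⟨k, w, hx hz.1, hy hz.2⟩

/-! ### The gap -/

theorem abs_datum_add_test_sub_eq_one {l : ℝ} (h0 : 0 < l) (h1 : l < 1 / 2) (i₀ : Fin d)
    {φ : 𝔼 → ℝ} (hφ : IsTest φ) :
    |(datum i₀ + φ) (EuclideanSpace.single i₀ 1) -
      (datum i₀ + φ) (EuclideanSpace.single i₀ (-1))| = 1 := by
  have hz : ∀ t : ℝ, 1 ≤ |t| → φ (EuclideanSpace.single i₀ t) = 0 := fun t ht => by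
    refine image_eq_zero_of_notMem_tsupport fun h => ?_
    have := hφ.2.2 h i₀
    simp at this
    linarith
  simp only [Pi.add_apply]
  rw [hz 1 (by simp), hz (-1) (by simp), datum_eq l i₀ (by simp), datum_eq l i₀ (by simp),
    cantorApprox_of_ge h0 h1 0 (by simp), cantorApprox_of_le h0 h1 0 (by simp)]
  simp

/-- A second phase that vanishes on the competitor but is bounded below on functions with unit
increment along the axis produces a gap, once it is multiplied by a large constant. -/
theorem exists_lavrentievGap (hd : 2 ≤ d) {l : ℝ} (h0 : 0 < l) (h1 : l < 1 / 2) (i₀ : Fin d)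
    {P Q : (𝔼 → ℝ) → ℝ≥0∞} {p q : ℝ} (hq : 1 < q)
    (hPadd : ∀ f g : 𝔼 → ℝ, AEMeasurable f → AEMeasurable g →
      P (f + g) ≤ ENNReal.ofReal (2 ^ (p - 1)) * (P f + P g))
    (hQadd : ∀ f g : 𝔼 → ℝ, AEMeasurable f → AEMeasurable g →
      Q (f + g) ≤ ENNReal.ofReal (2 ^ (q - 1)) * (Q f + Q g))
    (hQdiv : ∀ (f : 𝔼 → ℝ) (l : ℝ), l ≠ 0 →
      Q f ≤ ENNReal.ofReal (|l| ^ q) * Q (fun x => f x / l))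
    (hPd : P (datum i₀) < ⊤) (hP : P (fun x => ∑' k, correction l i₀ k x) < ⊤)
    (hQd : Q (-datum i₀) < ⊤) (hQ0 : Q (competitor l i₀) = 0) {c : ℝ} (hc : 0 < c)
    (hlow : ∀ ψ : 𝔼 → ℝ, ContDiff ℝ 1 ψ →
      |ψ (EuclideanSpace.single i₀ 1) - ψ (EuclideanSpace.single i₀ (-1))| = 1 →
      ENNReal.ofReal c ≤ Q ψ) :
    ∃ M : ℝ, 0 < M ∧ LavrentievGap fun f => P f + ENNReal.ofReal M * Q f := by
  set K : ℝ≥0∞ := ENNReal.ofReal (2 ^ (q - 1)) with hKdef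
  have hK : K ≠ ⊤ := ENNReal.ofReal_ne_top
  have hK0 : K ≠ 0 := by
    simp only [hKdef, ne_eq, ENNReal.ofReal_eq_zero, not_le]; positivity
  have hPv : P (competitor l i₀) < ⊤ := by
    have hm : AEMeasurable fun x => ∑' k, correction l i₀ k x := by
      have := (aemeasurable_competitor hd h0 h1 i₀).sub
        (contDiff_datum i₀).continuous.measurable.aemeasurable
      rwa [competitor, add_sub_cancel_left] at this
    exact (hPadd _ _ (contDiff_datum i₀).continuous.measurable.aemeasurable hm).trans_lt
      (ENNReal.mul_lt_top ENNReal.ofReal_lt_top (ENNReal.add_lt_top.2 ⟨hPd, hP⟩))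
  -- large enough for `M * c` to exceed `K` times the energy of the competitor
  set M : ℝ := ((K * P (competitor l i₀)).toReal + 1) / c with hMdef
  have hM : 0 < M := by positivity
  have hadd : ∀ f g : 𝔼 → ℝ, AEMeasurable f → AEMeasurable g →
      ENNReal.ofReal M * Q (f + g) ≤
        K * (ENNReal.ofReal M * Q f + ENNReal.ofReal M * Q g) := fun f g hf hg => by
    rw [← mul_add, mul_left_comm]
    gcongr
    exact hQadd f g hf hg
  refine ⟨M, hM, lavrentievGap_of_lower_bound (Q := fun f => ENNReal.ofReal M * Q f)
    (c := ENNReal.ofReal (M * c)) hq hK0 hK hadd (fun f l hl => ?_)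
    (isBoundaryDatum_datum i₀) (fun φ hφ => ?_) (competitor_mem_W hd h0 h1 i₀ hK hadd hP
      (by simp only [hQ0, mul_zero]) (ENNReal.mul_lt_top ENNReal.ofReal_lt_top hQd)) ?_⟩
  · rw [mul_left_comm]
    gcongr
    exact hQdiv f l hl
  · rw [ENNReal.ofReal_mul hM.le]
    gcongr
    exact hlow _ (((contDiff_datum i₀).add hφ.1).of_le (by simp))
      (abs_datum_add_test_sub_eq_one h0 h1 i₀ hφ)
  · have hfin : K * P (competitor l i₀) ≠ ⊤ := (ENNReal.mul_lt_top hK.lt_top hPv).ne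
    rw [hQ0, mul_zero, add_zero, ENNReal.lt_ofReal_iff_toReal_lt hfin, hMdef,
      div_mul_cancel₀ _ hc.ne']
    linarith

/-- Choice of the Hölder exponent `β` of the weight and of the contraction ratio `l = 2^(-1/D)`,
where the dimension `D < 1` of the Cantor set lies strictly between the two sides of the
condition on the exponents. -/
theorem exists_parameters (hd : 2 ≤ d) {p q s t α : ℝ} (hp : 1 < p) (hq : 1 < q) (hs1 : s ≤ 1)
    (hα : α ∈ Icc (0 : ℝ) 1) (hsuper : 0 < s - d / p)
    (hcond : p / (p - 1) * (s - d / p) < q / (q - 1) * (t - (d + α) / q)) :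
    ∃ β l : ℝ, 0 < β ∧ β ≤ 1 ∧ α ≤ β ∧ 0 < l ∧ l < 1 / 2 ∧ 0 < t - (d + β) / q ∧
      energyRatio d s p l < 1 ∧ 2 ^ (1 - 1 / q) * l ^ (t - (d + β) / q) < 1 := by
  have hp1 : 0 < p - 1 := by linarith
  have hq1 : 0 < q - 1 := by linarith
  have hp0 : 0 < p := by linarith
  have hq0 : 0 < q := by linarith
  have hd' : (2 : ℝ) ≤ d := by exact_mod_cast hd
  set X := p / (p - 1) * (s - d / p) with hX
  have hX0 : 0 < X := by positivity
  have hXp : X * (p - 1) = s * p - d := by rw [hX]; field_simp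
  have hX1 : X < 1 := by nlinarith
  -- the condition is open in the exponent, so that `α = 0` may be replaced by a positive one
  obtain ⟨β, hβ0, hβ1, hαβ, hβ⟩ : ∃ β : ℝ, 0 < β ∧ β ≤ 1 ∧ α ≤ β ∧
      X < q / (q - 1) * (t - (d + β) / q) := by
    rcases hα.1.eq_or_lt with h | h
    · set Y := q / (q - 1) * (t - (d + α) / q) with hY
      refine ⟨min 1 ((Y - X) * (q - 1) / 2), lt_min one_pos ?_, min_le_left _ _, ?_, ?_⟩
      · have := sub_pos.2 hcond
        positivity
      · rw [← h]
        have := sub_pos.2 hcond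
        positivity
      · have e : ∀ b : ℝ, q / (q - 1) * (t - (d + b) / q) = Y - b / (q - 1) := fun b => by
          rw [hY, ← h]; field_simp; ring
        rw [e]
        have h2 : min 1 ((Y - X) * (q - 1) / 2) / (q - 1) ≤ (Y - X) / 2 := by
          rw [div_le_iff₀ hq1]
          exact (min_le_right _ _).trans (le_of_eq (by ring))
        linarith
    · exact ⟨α, h, hα.2, le_rfl, hcond⟩
  obtain ⟨D, hXD, hD⟩ := exists_between (lt_min hX1 hβ)
  obtain ⟨hD1, hDY⟩ := lt_min_iff.1 hD
  have hD0 : 0 < D := hX0.trans hXD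
  set τ := t - (d + β) / q with hτ
  have hDτ : D * (q - 1) < q * τ := by
    rw [div_mul_eq_mul_div, lt_div_iff₀ hq1] at hDY
    exact hDY
  have hτ0 : 0 < τ := by
    have : 0 < D * (q - 1) := by positivity
    exact (mul_pos_iff_of_pos_left hq0).1 (this.trans hDτ)
  have h2 : (1 : ℝ) < 2 := one_lt_two
  refine ⟨β, 2 ^ (-1 / D), hβ0, hβ1, hαβ, by positivity, ?_, hτ0, ?_, ?_⟩
  · rw [one_div, ← Real.rpow_neg_one]
    refine Real.rpow_lt_rpow_of_exponent_lt h2 ?_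
    rw [div_lt_iff₀ hD0]; linarith
  · have e : energyRatio d s p (2 ^ (-1 / D)) = 2 ^ (1 - p + (s * p - d) / D) := by
      rw [energyRatio, one_div, Real.inv_rpow two_pos.le, ← Real.rpow_neg two_pos.le,
        ← Real.rpow_mul_natCast two_pos.le, ← Real.rpow_mul two_pos.le]
      nth_rewrite 1 [← Real.rpow_one 2]
      rw [← Real.rpow_add two_pos, ← Real.rpow_add two_pos, ← Real.rpow_add two_pos]
      congr 1
      field_simp
      ring
    rw [e]
    refine Real.rpow_lt_one_of_one_lt_of_neg h2 ?_
    have : (s * p - d) / D < p - 1 := by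
      rw [div_lt_iff₀ hD0, ← hXp]
      nlinarith
    linarith
  · rw [← Real.rpow_mul two_pos.le, ← Real.rpow_add two_pos]
    refine Real.rpow_lt_one_of_one_lt_of_neg h2 ?_
    have : 1 - 1 / q < τ / D := by
      rw [lt_div_iff₀ hD0]
      have : (1 - 1 / q) * q = q - 1 := by field_simp
      nlinarith
    have e : -1 / D * τ = -(τ / D) := by ring
    linarith

/-- The gap for a given first phase and the weighted nonlocal second phase. -/
theorem exists_isPairWeight_lavrentievGap (hd : 2 ≤ d) {l : ℝ} (h0 : 0 < l) (h1 : l < 1 / 2)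
    (i₀ : Fin d) {P : (𝔼 → ℝ) → ℝ≥0∞} {p q t α β : ℝ} (hq : 1 < q) (ht : 0 < t) (ht1 : t < 1)
    (hβ : 0 < β) (hβ1 : β ≤ 1) (hα : α ≤ β) (hτ : 0 < t - (d + β) / q)
    (hθ : 2 ^ (1 - 1 / q) * l ^ (t - (d + β) / q) < 1)
    (hPadd : ∀ f g : 𝔼 → ℝ, AEMeasurable f → AEMeasurable g →
      P (f + g) ≤ ENNReal.ofReal (2 ^ (p - 1)) * (P f + P g))
    (hPd : P (datum i₀) < ⊤) (hP : P (fun x => ∑' k, correction l i₀ k x) < ⊤) :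
    ∃ a : 𝔼 → 𝔼 → ℝ, IsPairWeight α a ∧ LavrentievGap fun v => P v + nonlocalPhase t q a v := by
  have hd1 : 1 ≤ d := by omega
  let a : 𝔼 → 𝔼 → ℝ := fun x y => distWeight (gapPairSet l i₀) β (x, y)
  have hw : IsPairWeight α a := by
    simpa only [one_mul] using isPairWeight_distWeight hd1 h0 h1 i₀ hβ hβ1 hα zero_le_one
  have hsupp : ∀ x y, a x y ≠ 0 → ∃ (k : ℕ) (w : Fin k → Bool), x ∈ gapBall l i₀ w ∧
      y ∈ gapBall l i₀ w := fun x y hxy => by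
    have hm : (x, y) ∈ gapPairSet l i₀ := not_imp_comm.1 (distWeight_eq_zero hβ) hxy
    rwa [mem_gapPairSet] at hm
  obtain ⟨B, hB⟩ := hw.bounded
  obtain ⟨c, hc, hlow⟩ := exists_nonlocalPhase_lower_bound (a := a) hd1 hq ht hτ h0 h1 hθ i₀
    (rpow_le_distWeight_gapPairSet hd1 h0 h1 i₀ hβ)
  obtain ⟨M, hM, hgap⟩ := exists_lavrentievGap (Q := nonlocalPhase t q a) hd h0 h1 i₀ hq hPadd
    (fun f g hf hg => nonlocalPhase_add_le t hq hw.measurable hw.nonneg hf hg)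
    (fun f l hl => (nonlocalPhase_div t a f hl).le) hPd hP
    (nonlocalPhase_lt_top_of_contDiff hd1 ht ht1 hq hw.nonneg hB (contDiff_one_datum i₀).neg
      (hasCompactSupport_datum i₀).neg)
    (nonlocalPhase_competitor_eq_zero h0 h1 i₀ t hq hsupp) hc hlow
  refine ⟨fun x y => M * a x y, isPairWeight_distWeight hd1 h0 h1 i₀ hβ hβ1 hα hM.le, ?_⟩
  have e : ∀ v, nonlocalPhase t q (fun x y => M * a x y) v =
      ENNReal.ofReal M * nonlocalPhase t q a v := fun v => nonlocalPhase_const_mul t q a v hM.le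
  change LavrentievGap fun v => P v + nonlocalPhase t q (fun x y => M * a x y) v
  simpa only [e] using hgap

/-- The gap for a given first phase and the weighted local second phase. -/
theorem exists_isPointWeight_lavrentievGap (hd : 2 ≤ d) {l : ℝ} (h0 : 0 < l) (h1 : l < 1 / 2)
    (i₀ : Fin d) {P : (𝔼 → ℝ) → ℝ≥0∞} {p q α β : ℝ} (hq : 1 < q)
    (hβ : 0 < β) (hβ1 : β ≤ 1) (hα : α ≤ β) (hτ : 0 < 1 - (d + β) / q)
    (hθ : 2 ^ (1 - 1 / q) * l ^ (1 - (d + β) / q) < 1)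
    (hPadd : ∀ f g : 𝔼 → ℝ, AEMeasurable f → AEMeasurable g →
      P (f + g) ≤ ENNReal.ofReal (2 ^ (p - 1)) * (P f + P g))
    (hPd : P (datum i₀) < ⊤) (hP : P (fun x => ∑' k, correction l i₀ k x) < ⊤) :
    ∃ a : 𝔼 → ℝ, IsPointWeight α a ∧ LavrentievGap fun v => P v + localPhase q a v := by
  have hd1 : 1 ≤ d := by omega
  have hw := isPointWeight_distWeight hd1 h0 h1 i₀ hβ hβ1 hα zero_le_one
  simp only [one_mul] at hw
  obtain ⟨B, hB⟩ := hw.bounded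
  obtain ⟨c, hc, hlow⟩ := exists_localPhase_lower_bound hd1 hq hτ h0 h1 hθ i₀
    (rpow_le_distWeight_gapSet hd1 h0 h1 i₀ hβ)
  obtain ⟨M, hM, hgap⟩ := exists_lavrentievGap hd h0 h1 i₀ hq hPadd
    (fun f g _ _ => localPhase_add_le hq hw.measurable hw.nonneg f g)
    (fun f l hl => localPhase_div_le _ f hl) hPd hP
    (localPhase_lt_top_of_contDiff hq hw.nonneg hB (contDiff_one_datum i₀).neg
      (hasCompactSupport_datum i₀).neg)
    (localPhase_competitor_eq_zero hd h0 h1 i₀ hq fun x hx => by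
      by_contra h
      exact hx (distWeight_eq_zero hβ fun hm => h (mem_gapSet.1 hm))) hc hlow
  refine ⟨_, isPointWeight_distWeight hd1 h0 h1 i₀ hβ hβ1 hα hM.le, ?_⟩
  simpa only [localPhase_const_mul q _ _ hM] using hgap

end NonlocalGap

theorem theorem5p1 (d : ℕ) (hd : 2 ≤ d) (p q s t α : ℝ)
    (hp : 1 < p) (hq : 1 < q) (hs : 0 < s) (ht : 0 < t) (hα : α ∈ Set.Icc (0 : ℝ) 1)
    (hsuper : 0 < s - d / p)
    (hcond : p / (p - 1) * (s - d / p) < q / (q - 1) * (t - (d + α) / q)) :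
    -- both phases nonlocal
    (s < 1 → t < 1 →
      ∃ a : EuclideanSpace ℝ (Fin d) → EuclideanSpace ℝ (Fin d) → ℝ,
        NonlocalGap.IsPairWeight α a ∧
        NonlocalGap.LavrentievGap (NonlocalGap.energyNonlocal s p t q a)) ∧
    -- nonlocal first phase, local second phase
    (s < 1 → t = 1 →
      ∃ a : EuclideanSpace ℝ (Fin d) → ℝ,
        NonlocalGap.IsPointWeight α a ∧
        NonlocalGap.LavrentievGap (NonlocalGap.energyNonlocalLocal s p q a)) ∧
    -- local first phase, nonlocal second phase
    (s = 1 → t < 1 →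
      ∃ a : EuclideanSpace ℝ (Fin d) → EuclideanSpace ℝ (Fin d) → ℝ,
        NonlocalGap.IsPairWeight α a ∧
        NonlocalGap.LavrentievGap (NonlocalGap.energyLocalNonlocal p t q a)) := by
  have hd1 : 1 ≤ d := by omega
  let i₀ : Fin d := ⟨0, by omega⟩
  have hadd : ∀ f g : EuclideanSpace ℝ (Fin d) → ℝ, AEMeasurable f → AEMeasurable g →
      NonlocalGap.nonlocalPhase s p (fun _ _ => 1) (f + g) ≤ ENNReal.ofReal (2 ^ (p - 1)) *
        (NonlocalGap.nonlocalPhase s p (fun _ _ => 1) f +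
          NonlocalGap.nonlocalPhase s p (fun _ _ => 1) g) := fun f g hf hg =>
    NonlocalGap.nonlocalPhase_add_le s hp measurable_const (fun _ _ => zero_le_one) hf hg
  have hdatum : s < 1 → NonlocalGap.nonlocalPhase s p (fun _ _ => 1) (NonlocalGap.datum i₀) < ⊤ :=
    fun hs1 => NonlocalGap.nonlocalPhase_lt_top_of_contDiff hd1 hs hs1 hp
      (fun _ _ => zero_le_one) (fun _ _ => le_rfl) (NonlocalGap.contDiff_one_datum i₀)
      (NonlocalGap.hasCompactSupport_datum i₀)
  have hs1 : s < 1 ∨ s = 1 → s ≤ 1 := fun h => h.elim le_of_lt le_of_eq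
  refine ⟨fun hs' ht1 => ?_, fun hs' ht1 => ?_, fun hs' ht1 => ?_⟩ <;>
    obtain ⟨β, l, hβ, hβ1, hαβ, h0, h1, hτ, hr, hθ⟩ :=
      NonlocalGap.exists_parameters hd hp hq (hs1 (by simp [hs'])) hα hsuper hcond
  · exact NonlocalGap.exists_isPairWeight_lavrentievGap hd h0 h1 i₀ hq ht ht1 hβ hβ1 hαβ hτ hθ
      hadd (hdatum hs')
      (NonlocalGap.nonlocalPhase_tsum_correction_lt_top hd1 hs hs' hp h0 h1 hr i₀)
  · subst ht1
    exact NonlocalGap.exists_isPointWeight_lavrentievGap hd h0 h1 i₀ hq hβ hβ1 hαβ hτ hθ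
      hadd (hdatum hs')
      (NonlocalGap.nonlocalPhase_tsum_correction_lt_top hd1 hs hs' hp h0 h1 hr i₀)
  · subst hs'
    exact NonlocalGap.exists_isPairWeight_lavrentievGap (p := p) hd h0 h1 i₀ hq ht ht1 hβ hβ1 hαβ
      hτ hθ
      (fun f g _ _ => NonlocalGap.localPhase_add_le hp measurable_const
        (fun _ => zero_le_one) f g)
      (NonlocalGap.localPhase_lt_top_of_contDiff hp (fun _ => zero_le_one) (fun _ => le_rfl)
        (NonlocalGap.contDiff_one_datum i₀) (NonlocalGap.hasCompactSupport_datum i₀))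
      (NonlocalGap.localPhase_tsum_correction_lt_top hd hp h0 h1 hr i₀)
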